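/- **Setting.** Let $(X,\mathsf d)$ be a complete metric space with an auxiliary Hausdorff topology $\sigma$ such that $\mathsf d$ is sequentially $\sigma\times\sigma$-lower semicontinuous and, for every $\sigma$-open $U$ and $x\in U$, there are a $\sigma$-open $V\ni x$ and $\delta>0$ such that $\mathsf d(y,V)<\delta$ implies $y\in U$. Let $\phi:X\to(-\infty,\infty]$ be proper, $\mathrm D(\phi)=\{\phi<\infty\}$, and let $\phi$ satisfy the LSCC conditions: - (lower semicontinuity) if $(u_n)$ is $\mathsf d$-bounded and $u_n\xrightarrow{\sigma}u$, then $\liminf_n\phi(u_n)\ge\phi(u)$; - (compactness) every $\mathsf d$-bounded sequence with $\sup_n\phi(u_n)<\infty$ has a $\sigma$-convergent subsequence; - (coercivity) there are $u_*\in X$ and $\mathsf A,\mathsf B\ge0$ with $\phi(u)\ge-\mathsf B\,\mathsf d^2(u,v)-\mathsf B\,\mathsf d^2(v,u_*)-\mathsf A$ for all $u,v\in X$. Let $\phi$ be $\lambda$-geodesically convex for some $\lambda\in\mathbb R$: any $v_0,v_1\in\mathrm D(\phi)$ are joined by a minimal constant-speed geodesic $\gamma:[0,1]\to X$ with $\phi(\gamma(t))\le(1-t)\phi(v_0)+t\phi(v_1)-\frac\lambda2t(1-t)\mathsf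 d^2(v_0,v_1)$ for all $t\in[0,1]$. Let $\varepsilon>0$ with $\frac1{16\varepsilon}\ge\mathsf B$, and put $\mu_\varepsilon=\frac1\varepsilon e^{-t/\varepsilon}\,\mathrm dt$ on $(0,\infty)$. For $x\in X$ let $\mathrm{AC}_x$ be the set of all $u\in\mathrm{AC}^2_{\rm loc}([0,\infty);X)$ with $u(0)=x$ and $\int_0^\infty|u'|^2\,\mathrm d\mu_\varepsilon<\infty$, where $|u'|$ is the metric derivative, and set $$\mathcal I_\varepsilon[u]=\int_0^\infty\Big(\frac\varepsilon2|u'|^2(t)+\phi(u(t))\Big)\,\mathrm d\mu_\varepsilon(t),\qquad V_\varepsilon(x)=\inf_{u\in\mathrm{AC}_x}\mathcal I_\varepsilon[u],\qquad \mathrm D(V_\varepsilon)=\{V_\varepsilon<\infty\}.$$ A WED minimizer from $x$ is a minimizer of $\mathcal I_\varepsilon$ in $\mathrm{AC}_x$. Set $G_\varepsilon(x)=\sqrt{2(\phi(x)-V_\varepsilon(x))/\varepsilon}$ for $x\in\mathrm D(V_\varepsilon)$, $G_\varepsilon(x)=\infty$ otherwise, and let $$|\tilde\partial V_\varepsilon|(u)=\limsup_{v\to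 u,\ \phi(v)\to\phi(u)}\frac{(V_\varepsilon(u)-V_\varepsilon(v))^+}{\mathsf d(u,v)}$$ be the $\phi$-conditioned local slope (the upper limit is over $v\ne u$, and is $0$ if there are no such $v$). For $p\in[1,\infty]$, a function $g:X\to[0,\infty]$ is an $L^p$-moderated upper gradient of $W:X\to(-\infty,\infty]$ if $|W(u(t))-W(u(s))|\le\int_s^tg(u(r))|u'|(r)\,\mathrm dr$ for all $s\le t$ in $I$ (with $|\infty-\infty|:=0$), for every interval $I$ and every $u\in\mathrm{AC}(I;X)$ with $W\circ u\in L^p(I;|u'|\mathcal L^1)$ and $g\circ u\in L^1(I;|u'|\mathcal L^1)$. A curve of maximal slope for $W$ with respect to an $L^\infty$-moderated upper gradient $g$ of $W$ is a curve $u\in\mathrm{AC}^2_{\rm loc}([0,\infty);X)$ with $W\circ u$ locally bounded and $-(W\circ u)'(t)=|u'|^2(t)=g^2(u(t))$ for a.e. $t>0$. **Theorem.** For every $u\in\mathrm D(\phi)$ one has $-\infty<V_\varepsilon(u)\le\phi(u)$ and $$\sqrt{2\,\frac{\phi(u)-V_\varepsilon(u)}\varepsilon}=G_\varepsilon(u)=|\tilde\partial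 V_\varepsilon|(u).$$ Moreover, $|\tilde\partial V_\varepsilon|$ is an $L^1$-moderated upper gradient of $V_\varepsilon$ (hence also an $L^\infty$-moderated one), and for every $x\in\mathrm D(V_\varepsilon)$ every WED minimizer from $x$ is a curve of maximal slope for $V_\varepsilon$ with respect to $|\tilde\partial V_\varepsilon|$. -/

import Mathlib

open Set Filter Topology MeasureTheory
open scoped ENNReal NNReal

noncomputable section

namespace WED

/-! ### Curves in a metric space

A curve on an interval `I` is represented by a function `u : ℝ → X`, of which only the values on `I`
matter. -/

section Curves

variable {X : Type*} [MetricSpace X]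

/-- `u ∈ AC^p(I; X)`: there is `m ∈ L^p(I)` with `d(u(s), u(t)) ≤ ∫_s^t m(r) dr` for all `s ≤ t`
in `I`. -/
def IsAC (p : ℝ≥0∞) (u : ℝ → X) (I : Set ℝ) : Prop :=
  ∃ m : ℝ → ℝ, MemLp m p (volume.restrict I) ∧
    ∀ s ∈ I, ∀ t ∈ I, s ≤ t → dist (u s) (u t) ≤ ∫ r in s..t, m r

/-- `u ∈ AC^p_loc(I; X)`: the curve is in `AC^p(J; X)` for every compact interval `J ⊆ I`. -/
def IsACLoc (p : ℝ≥0∞) (u : ℝ → X) (I : Set ℝ) : Prop :=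
  ∀ a b : ℝ, a ≤ b → Icc a b ⊆ I → IsAC p u (Icc a b)

/-- The metric derivative `|u'|(t) = lim_{s → t} d(u(s), u(t)) / |s - t|`. It is written as an upper
limit, so that it is defined for every `t`; for absolutely continuous curves the limit exists at almost
every `t` of the interval. -/
def metricDeriv (u : ℝ → X) (t : ℝ) : ℝ≥0∞ :=
  limsup (fun s : ℝ => edist (u s) (u t) / ENNReal.ofReal |s - t|) (𝓝[≠] t)

/-- The measure `|u'| ℒ¹` on `I`. -/
def speedMeasure (u : ℝ → X) (I : Set ℝ) : Measure ℝ :=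
  (volume.restrict I).withDensity (metricDeriv u)

/-- Minimal constant speed geodesics, parametrised by `[0,1]`. -/
def IsGeodesic (γ : ℝ → X) : Prop :=
  ∀ s ∈ Icc (0 : ℝ) 1, ∀ t ∈ Icc (0 : ℝ) 1,
    dist (γ s) (γ t) = |t - s| * dist (γ 0) (γ 1)

/-- The proper domain `D(φ) = {φ < ∞}`. -/
def dom (φ : X → EReal) : Set X := {x | φ x < ⊤}

/-- Geodesic `λ`-convexity: any two points of `D(φ)` are joined by a geodesic along which `φ`
satisfies the `λ`-convexity inequality. -/
def IsGeodesicallyConvex (lam : ℝ) (φ : X → EReal) : Prop :=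
  ∀ v₀ ∈ dom φ, ∀ v₁ ∈ dom φ, ∃ γ : ℝ → X, IsGeodesic γ ∧ γ 0 = v₀ ∧ γ 1 = v₁ ∧
    ∀ t ∈ Icc (0 : ℝ) 1,
      φ (γ t) ≤ ((1 - t : ℝ) : EReal) * φ v₀ + (t : EReal) * φ v₁
        - ((lam / 2 * t * (1 - t) * dist v₀ v₁ ^ 2 : ℝ) : EReal)

/-- `f ∈ L^p(μ)` for an extended real valued function: finite almost everywhere, with real
representative in `L^p`. -/
def MemLpEReal (f : ℝ → EReal) (p : ℝ≥0∞) (μ : Measure ℝ) : Prop :=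
  (∀ᵐ t ∂μ, f t ≠ ⊤ ∧ f t ≠ ⊥) ∧ MemLp (fun t => (f t).toReal) p μ

/-- `g` is an `L^p`-moderated upper gradient for `φ`: for every interval `I` and every
`u ∈ AC(I; X)` with `φ ∘ u ∈ L^p(I; |u'| ℒ¹)` and `g ∘ u ∈ L¹(I; |u'| ℒ¹)`,
`|φ(u(t)) - φ(u(s))| ≤ ∫_s^t g(u(r)) |u'|(r) dr` for all `s ≤ t` in `I`.
The absolute value is written out as two inequalities (so `|∞ - ∞|` counts as `0`, which only matters
for pieces of curves that do not move). -/
def IsModeratedUpperGradient (p : ℝ≥0∞) (φ : X → EReal) (g : X → ℝ≥0∞) : Prop :=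
  ∀ (I : Set ℝ) (u : ℝ → X), I.OrdConnected → IsAC 1 u I →
    MemLpEReal (fun t => φ (u t)) p (speedMeasure u I) →
    AEMeasurable (fun t => g (u t)) (speedMeasure u I) →
    ∫⁻ t, g (u t) ∂(speedMeasure u I) < ⊤ →
    ∀ s ∈ I, ∀ t ∈ I, s ≤ t →
      φ (u t) ≤ φ (u s) + ((∫⁻ r in Icc s t, g (u r) * metricDeriv u r : ℝ≥0∞) : EReal) ∧
      φ (u s) ≤ φ (u t) + ((∫⁻ r in Icc s t, g (u r) * metricDeriv u r : ℝ≥0∞) : EReal)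

/-- `u : [0,∞) → X` is a curve of maximal slope for `φ` with respect to the `L^∞`-moderated upper
gradient `g`: it is in `AC²_loc([0,∞); X)`, `φ ∘ u` is locally bounded, and
`-(φ ∘ u)'(t) = |u'|²(t) = g²(u(t))` for a.e. `t > 0`. -/
structure IsCurveOfMaximalSlope (φ : X → EReal) (g : X → ℝ≥0∞) (u : ℝ → X) : Prop where
  upperGradient : IsModeratedUpperGradient ⊤ φ g
  ac : IsACLoc 2 u (Ici 0)
  locallyBounded : ∀ T : ℝ, ∃ C : ℝ, ∀ t ∈ Icc 0 T,
    ((-C : ℝ) : EReal) ≤ φ (u t) ∧ φ (u t) ≤ (C : EReal)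
  slope : ∀ᵐ t ∂(volume.restrict (Ioi (0 : ℝ))), ∃ c : ℝ≥0,
    HasDerivAt (fun s => (φ (u s)).toReal) (-(c : ℝ)) t ∧
      metricDeriv u t ^ 2 = (c : ℝ≥0∞) ∧ g (u t) ^ 2 = (c : ℝ≥0∞)

end Curves

/-! ### The metric-topological setting -/

section Setting

variable {X : Type*} [MetricSpace X]

/-- The auxiliary topology `σ` is Hausdorff, the distance is sequentially `σ`-lower semicontinuous,
and `σ`-neighbourhoods are uniform with respect to the distance. -/
structure IsCompatible (σ : TopologicalSpace X) : Prop where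
  hausdorff : @T2Space X σ
  dist_lsc : ∀ (u v : ℕ → X) (x y : X),
    Tendsto u atTop (@nhds X σ x) → Tendsto v atTop (@nhds X σ y) →
      edist x y ≤ liminf (fun n => edist (u n) (v n)) atTop
  nhds_uniform : ∀ U : Set X, IsOpen[σ] U → ∀ x ∈ U,
    ∃ V : Set X, IsOpen[σ] V ∧ x ∈ V ∧ ∃ δ > 0, ∀ y : X, Metric.infDist y V < δ → y ∈ U

/-- The standard lower semicontinuity, coercivity and compactness assumptions on a proper functional
`φ : X → (-∞,∞]`, with coercivity constant `B`. -/
structure IsLSCC (σ : TopologicalSpace X) (φ : X → EReal) (B : ℝ) : Prop where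
  ne_bot : ∀ x, φ x ≠ ⊥
  proper : (dom φ).Nonempty
  lsc : ∀ (u : ℕ → X) (x : X), (∃ C : ℝ, ∀ n m, dist (u n) (u m) ≤ C) →
    Tendsto u atTop (@nhds X σ x) → φ x ≤ liminf (fun n => φ (u n)) atTop
  compact : ∀ u : ℕ → X, (∃ C : ℝ, ∀ n, φ (u n) ≤ (C : EReal)) →
    (∃ C : ℝ, ∀ n m, dist (u n) (u m) ≤ C) →
      ∃ (x : X) (k : ℕ → ℕ), StrictMono k ∧ Tendsto (fun n => u (k n)) atTop (@nhds X σ x)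
  B_nonneg : 0 ≤ B
  coercive : ∃ (uStar : X) (A : ℝ), 0 ≤ A ∧ ∀ u v : X,
    ((-(B * dist u v ^ 2) - (B * dist v uStar ^ 2 + A) : ℝ) : EReal) ≤ φ u

end Setting

/-! ### The weighted energy-dissipation functional and its value function -/

section Functional

variable {X : Type*} [MetricSpace X]

/-- The probability measure `μ_ε = ε⁻¹ e^{-t/ε} ℒ¹` on `(0,∞)`. -/
def expMeasure (ε : ℝ) : Measure ℝ :=
  (volume.restrict (Ioi (0 : ℝ))).withDensity (fun t => ENNReal.ofReal (Real.exp (-t / ε) / ε))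

/-- The integral of an extended real valued function, as integral of the positive part minus integral
of the negative part. -/
def integralEReal (f : ℝ → EReal) (μ : Measure ℝ) : EReal :=
  ((∫⁻ t, (f t).toENNReal ∂μ : ℝ≥0∞) : EReal) - ((∫⁻ t, (-f t).toENNReal ∂μ : ℝ≥0∞) : EReal)

/-- Trajectories in `AC²_loc([0,∞); X)` that start from `x` and satisfy `∫ |u'|² dμ_ε < ∞`. -/
def admissible (ε : ℝ) (x : X) : Set (ℝ → X) :=
  {u | IsACLoc 2 u (Ici 0) ∧ u 0 = x ∧ ∫⁻ t, metricDeriv u t ^ 2 ∂(expMeasure ε) < ⊤}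

/-- The weighted energy-dissipation functional `I_ε[u] = ∫ (ε/2 |u'|² + φ(u)) dμ_ε`. -/
def wed (φ : X → EReal) (ε : ℝ) (u : ℝ → X) : EReal :=
  integralEReal
    (fun t => ((ε / 2 : ℝ) : EReal) * ((metricDeriv u t ^ 2 : ℝ≥0∞) : EReal) + φ (u t))
    (expMeasure ε)

/-- The value function `V_ε(x) = inf I_ε[u]` over the trajectories starting from `x`. -/
def value (φ : X → EReal) (ε : ℝ) (x : X) : EReal :=
  ⨅ u ∈ admissible ε x, wed φ ε u

/-- `u` minimises the weighted energy-dissipation functional among the trajectories starting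
from `x`. -/
def IsWEDMinimizer (φ : X → EReal) (ε : ℝ) (x : X) (u : ℝ → X) : Prop :=
  u ∈ admissible ε x ∧ ∀ w ∈ admissible ε x, wed φ ε u ≤ wed φ ε w

open Classical in
/-- `G_ε(x) = √(2 (φ(x) - V_ε(x)) / ε)` on `D(V_ε)`, and `∞` elsewhere. -/
def G (φ : X → EReal) (ε : ℝ) (x : X) : ℝ≥0∞ :=
  if value φ ε x < ⊤ then
    (2 * (φ x - value φ ε x) / (ε : EReal)).toENNReal ^ (1 / 2 : ℝ)
  else ⊤

/-- The `φ`-conditioned local slope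
`limsup_{v → u, φ(v) → φ(u)} (W(u) - W(v))⁺ / d(u,v)` of a functional `W` at `u`. -/
def conditionedSlope (φ W : X → EReal) (u : X) : ℝ≥0∞ :=
  limsup (fun v => (W u - W v).toENNReal / edist u v) (𝓝[≠] u ⊓ comap φ (𝓝 (φ u)))

end Functional

end WED

end

open WED

/-! The functional is the discounted cost of an infinite-horizon control problem. With the running
cost `m²/2 + φ/ε` and the discount `exp (-t/ε)`, its value function `V` formally solves the
Hamilton–Jacobi equation `|∂V|²/2 = (φ - V)/ε`, whose right-hand side is `G²/2`. The proof makes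
this rigorous without any continuity of `V`, and it uses almost minimizing trajectories instead of
minimizers.

Trajectories carry an arbitrary integrated speed bound `m`. This makes concatenation, shift,
reversal and reparametrisation elementary; since `|u'| ≤ m` a.e., the infimum of the cost is
unchanged. An exponential Hardy inequality (`hardy_exp`) bounds the weighted square of the distance
from the starting point by the kinetic energy, and `B ≤ 1/(16ε)` is what lets half of the kinetic
term absorb the negative part of `φ` (`Traj.energy_le`). Hence `V > -∞`. The dynamic programming
principle is `Segment.value_le` together with `Traj.value_shift_le`.

Slope at most `G` (`conditionedSlope_le_G`): to go from `x` to a nearby `v`, follow a geodesic at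
speed about `s`, then an almost optimal trajectory from `v`. The cost per unit length is `s/2 + (φ -
V)/(sε)`, and its minimum over `s` is `G`.

Slope at least `G` (`le_conditionedSlope`): along an almost minimizing trajectory from `x`, dynamic
programming and AM-GM make `V` drop at rate at least about `G` per unit distance. The conditioned
slope only sees points where `φ` is close to `φ(x)`. Lower semicontinuity bounds `φ` from below. The
bound from above holds at suitable times: comparison with the geodesic to `u(T)` shows that the mean
excess of `φ` on `[0,T]` is at most about half of its excess at `T`, and a real-variable lemma
(`exists_lt_of_integral_le`) shows that the excess cannot then stay large at all small times.

Upper gradient (`value_along_curve_le`): reparametrise a given curve so that its speed is `G + η`.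
Then `φ - V ≤ ε m²/2` along it, and a Gronwall-type argument bounds the change of `V` by `∫ m²`,
which in the old time is `∫ (G + η)|u'|`. Let `η → 0`; reversing the curve gives the other
inequality.

Minimizers: dynamic programming is an equality along a minimizer `u`, so `-(V∘u)' = |u'|²/2 + G²/2`
a.e., while the upper gradient gives `-(V∘u)' ≤ G|u'|`. Hence `(G - |u'|)² ≤ 0`. -/

noncomputable section

namespace WED

/-! ### Speed bounds and the metric derivative -/

section Speed

variable {X : Type*} [MetricSpace X]

/-- `m` bounds the speed of the curve `u` on `I`, in integrated form. -/
def SpeedBound (u : ℝ → X) (m : ℝ → ℝ) (I : Set ℝ) : Prop :=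
  ∀ s ∈ I, ∀ t ∈ I, s ≤ t → dist (u s) (u t) ≤ ∫ r in s..t, m r

theorem SpeedBound.mono {u : ℝ → X} {m : ℝ → ℝ} {I J : Set ℝ} (h : SpeedBound u m I)
    (hJ : J ⊆ I) : SpeedBound u m J :=
  fun s hs t ht hst => h s (hJ hs) t (hJ ht) hst

theorem SpeedBound.dist_le_abs {u : ℝ → X} {m : ℝ → ℝ} {a b : ℝ} (h : SpeedBound u m (Icc a b))
    (hm : IntervalIntegrable m volume a b) {s t : ℝ} (hs : s ∈ Icc a b) (ht : t ∈ Icc a b) :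
    dist (u s) (u t) ≤ |(∫ r in a..s, m r) - ∫ r in a..t, m r| := by
  have hab : a ≤ b := hs.1.trans hs.2
  have hi : ∀ x ∈ Icc a b, IntervalIntegrable m volume a x := fun x hx =>
    hm.mono_set (by rw [uIcc_of_le hab, uIcc_of_le hx.1]; exact Icc_subset_Icc_right hx.2)
  rcases le_total s t with hst | hst
  · rw [abs_sub_comm, intervalIntegral.integral_interval_sub_left (hi t ht) (hi s hs)]
    exact (h s hs t ht hst).trans (le_abs_self _)
  · rw [intervalIntegral.integral_interval_sub_left (hi s hs) (hi t ht), dist_comm]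
    exact (h t ht s hs hst).trans (le_abs_self _)

theorem SpeedBound.absolutelyContinuousOnInterval {u : ℝ → X} {m : ℝ → ℝ} {a b : ℝ} (hab : a ≤ b)
    (h : SpeedBound u m (Icc a b)) (hm : IntervalIntegrable m volume a b) :
    AbsolutelyContinuousOnInterval u a b := by
  have hF := hm.absolutelyContinuousOnInterval_intervalIntegral (c := a) left_mem_uIcc
  rw [absolutelyContinuousOnInterval_iff] at hF ⊢
  intro ε hε
  obtain ⟨δ, hδ, H⟩ := hF ε hε
  refine ⟨δ, hδ, fun E hE hlt => lt_of_le_of_lt (Finset.sum_le_sum fun i hi => ?_) (H E hE hlt)⟩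
  have hE' := hE.1 i hi
  rw [uIcc_of_le hab] at hE'
  exact h.dist_le_abs hm hE'.1 hE'.2

theorem SpeedBound.continuousOn {u : ℝ → X} {m : ℝ → ℝ} {a b : ℝ} (hab : a ≤ b)
    (h : SpeedBound u m (Icc a b)) (hm : IntervalIntegrable m volume a b) :
    ContinuousOn u (Icc a b) := by
  have hF := (hm.absolutelyContinuousOnInterval_intervalIntegral (c := a) left_mem_uIcc).continuousOn
  rw [uIcc_of_le hab, Metric.continuousOn_iff] at hF
  rw [Metric.continuousOn_iff]
  intro t ht ε hε
  obtain ⟨δ, hδ, H⟩ := hF t ht ε hε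
  exact ⟨δ, hδ, fun s hs hst => (h.dist_le_abs hm hs ht).trans_lt (H s hs hst)⟩

theorem metricDeriv_congr {u v : ℝ → X} {t : ℝ} (h : u =ᶠ[𝓝 t] v) :
    metricDeriv u t = metricDeriv v t := by
  refine limsup_congr ?_
  filter_upwards [h.filter_mono nhdsWithin_le_nhds] with s hs
  rw [hs, h.self_of_nhds]

theorem ofReal_abs_le_metricDeriv {u : ℝ → X} {f : ℝ → ℝ} {f' t : ℝ} (hf : HasDerivAt f f' t)
    (h : ∀ᶠ s in 𝓝 t, |f s - f t| ≤ dist (u s) (u t)) :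
    ENNReal.ofReal |f'| ≤ metricDeriv u t := by
  have h1 : Tendsto (fun s => ENNReal.ofReal |slope f t s|) (𝓝[≠] t) (𝓝 (ENNReal.ofReal |f'|)) :=
    (ENNReal.continuous_ofReal.tendsto _).comp
      ((continuous_abs.tendsto _).comp (hasDerivAt_iff_tendsto_slope.1 hf))
  rw [← h1.limsup_eq]
  refine limsup_le_limsup ?_
  filter_upwards [h.filter_mono nhdsWithin_le_nhds, self_mem_nhdsWithin] with s hs hne
  have hpos : 0 < |s - t| := abs_pos.2 (sub_ne_zero.2 hne)
  rw [slope_def_field, abs_div, ENNReal.ofReal_div_of_pos hpos, edist_dist]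
  gcongr

/-- The difference quotients of `u` are dominated by those of the primitive of `m`, which converge
to `m t` by Lebesgue differentiation. They are nonnegative, so `0 ≤ m t` comes out a.e. without
being assumed. -/
theorem SpeedBound.metricDeriv_le {u : ℝ → X} {m : ℝ → ℝ} {a b : ℝ}
    (h : SpeedBound u m (Icc a b)) (hm : IntervalIntegrable m volume a b) :
    ∀ᵐ t, t ∈ Ioo a b → metricDeriv u t ≤ ENNReal.ofReal (m t) ∧ 0 ≤ m t := by
  filter_upwards [hm.ae_hasDerivAt_integral] with t ht htab
  have hab : a ≤ b := (htab.1.trans htab.2).le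
  have hd := ht (by rw [uIcc_of_le hab]; exact Ioo_subset_Icc_self htab) a left_mem_uIcc
  set F : ℝ → ℝ := fun x => ∫ r in a..x, m r with hF
  have hsl := hasDerivAt_iff_tendsto_slope.1 hd
  have hI : ∀ᶠ s in 𝓝[≠] t, s ∈ Icc a b :=
    nhdsWithin_le_nhds (Icc_mem_nhds htab.1 htab.2)
  have hmono : ∀ᶠ s in 𝓝[≠] t, dist (u s) (u t) / |s - t| ≤ slope F t s := by
    filter_upwards [hI, self_mem_nhdsWithin] with s hs hne
    have htI := Ioo_subset_Icc_self htab
    have hi : ∀ x ∈ Icc a b, IntervalIntegrable m volume a x := fun x hx =>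
      hm.mono_set (by rw [uIcc_of_le hab, uIcc_of_le hx.1]; exact Icc_subset_Icc_right hx.2)
    rw [slope_def_field]
    rcases lt_or_gt_of_ne hne with hlt | hlt
    · rw [abs_of_neg (by linarith), ← neg_div_neg_eq (F s - F t)]
      have := h s hs t htI hlt.le
      rw [← intervalIntegral.integral_interval_sub_left (hi t htI) (hi s hs)] at this
      gcongr
      · linarith
      · linarith
    · rw [abs_of_pos (by linarith)]
      have := h t htI s hs hlt.le
      rw [← intervalIntegral.integral_interval_sub_left (hi s hs) (hi t htI), dist_comm] at this
      gcongr
  constructor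
  · have h1 : Tendsto (fun s => ENNReal.ofReal (slope F t s)) (𝓝[≠] t)
        (𝓝 (ENNReal.ofReal (m t))) := (ENNReal.continuous_ofReal.tendsto _).comp hsl
    rw [← h1.limsup_eq]
    refine limsup_le_limsup ?_
    filter_upwards [hmono, self_mem_nhdsWithin] with s hs hne
    have hpos : 0 < |s - t| := abs_pos.2 (sub_ne_zero.2 hne)
    rw [edist_dist, ← ENNReal.ofReal_div_of_pos hpos]
    exact ENNReal.ofReal_le_ofReal hs
  · refine ge_of_tendsto hsl (hmono.mono fun s hs => le_trans (by positivity) hs)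

/-- Written in terms of the increment `h = s - t`, the supremum runs over a set independent of `t`.
It is therefore an uncountable supremum of continuous functions, hence lower semicontinuous, and
only a countable infimum remains. -/
theorem measurable_metricDeriv {u : ℝ → X} (hu : Continuous u) : Measurable (metricDeriv u) := by
  have key : metricDeriv u = fun t => ⨅ n : ℕ, ⨆ h : ℝ, ⨆ _ : 0 < |h| ∧ |h| < 1 / ((n : ℝ) + 1),
      edist (u (t + h)) (u t) / ENNReal.ofReal |h| := by
    funext t
    have hb : (𝓝[≠] t).HasBasis (fun _ : ℕ => True)
        (fun n => Metric.ball t (1 / ((n : ℝ) + 1)) ∩ {t}ᶜ) :=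
      nhdsWithin_hasBasis Metric.nhds_basis_ball_inv_nat_succ _
    unfold metricDeriv
    rw [hb.limsup_eq_iInf_iSup]
    simp only [iInf_true]
    refine iInf_congr fun n => le_antisymm ?_ ?_
    · refine iSup₂_le fun s hs => ?_
      refine le_iSup₂_of_le (s - t) ⟨abs_pos.2 (sub_ne_zero.2 hs.2), hs.1⟩ ?_
      simp
    · refine iSup₂_le fun h hh => ?_
      refine le_iSup₂_of_le (t + h) ⟨?_, ?_⟩ ?_
      · simpa [Metric.mem_ball, Real.dist_eq] using hh.2
      · simpa using hh.1
      · simp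
  rw [key]
  refine Measurable.iInf fun n => ?_
  refine (lowerSemicontinuous_iSup fun h => lowerSemicontinuous_iSup fun hh => ?_).measurable
  refine Continuous.lowerSemicontinuous ?_
  refine ENNReal.continuous_div_const _ ?_ |>.comp ?_
  · simpa using hh.1
  · fun_prop

theorem aemeasurable_metricDeriv_Icc {u : ℝ → X} {a b : ℝ} (hab : a ≤ b)
    (hu : ContinuousOn u (Icc a b)) :
    AEMeasurable (metricDeriv u) (volume.restrict (Icc a b)) := by
  refine ⟨metricDeriv (IccExtend hab ((Icc a b).domRestrict u)),
    measurable_metricDeriv (hu.domRestrict.Icc_extend'), ?_⟩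
  rw [← restrict_Ioo_eq_restrict_Icc]
  filter_upwards [ae_restrict_mem measurableSet_Ioo] with t ht
  refine metricDeriv_congr ?_
  filter_upwards [Icc_mem_nhds ht.1 ht.2] with s hs
  simp [IccExtend_of_mem _ _ hs, domRestrict_apply]

theorem aemeasurable_metricDeriv_Ici {u : ℝ → X} {a : ℝ} (hu : ContinuousOn u (Ici a)) :
    AEMeasurable (metricDeriv u) (volume.restrict (Ioi a)) := by
  refine ⟨metricDeriv (fun t => u (max a t)), measurable_metricDeriv ?_, ?_⟩
  · exact hu.comp_continuous (by fun_prop) fun t => le_max_left a t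
  filter_upwards [ae_restrict_mem measurableSet_Ioi] with t ht
  refine metricDeriv_congr ?_
  filter_upwards [Ici_mem_nhds ht] with s hs
  simp [max_eq_right (mem_Ici.1 hs)]

theorem SpeedBound.integrableOn_metricDeriv {u : ℝ → X} {m : ℝ → ℝ} {a b : ℝ} (hab : a ≤ b)
    (h : SpeedBound u m (Icc a b)) (hm : IntervalIntegrable m volume a b) :
    IntegrableOn (fun t => (metricDeriv u t).toReal) (Icc a b) := by
  have hmeas := (aemeasurable_metricDeriv_Icc hab (h.continuousOn hab hm)).ennreal_toReal
  have hmi : IntegrableOn m (Icc a b) := by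
    rwa [intervalIntegrable_iff_integrableOn_Icc_of_le hab] at hm
  refine Integrable.mono' hmi hmeas.aestronglyMeasurable ?_
  rw [← restrict_Ioo_eq_restrict_Icc, ae_restrict_iff' measurableSet_Ioo]
  filter_upwards [h.metricDeriv_le hm] with t ht htab
  rw [Real.norm_of_nonneg ENNReal.toReal_nonneg]
  exact ENNReal.toReal_le_of_le_ofReal (ht htab).2 (ht htab).1

theorem SpeedBound.metricDeriv_lt_top {u : ℝ → X} {m : ℝ → ℝ} {a b : ℝ}
    (h : SpeedBound u m (Icc a b)) (hm : IntervalIntegrable m volume a b) :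
    ∀ᵐ t ∂(volume.restrict (Icc a b)), metricDeriv u t < ∞ := by
  rw [← restrict_Ioo_eq_restrict_Icc, ae_restrict_iff' measurableSet_Ioo]
  filter_upwards [h.metricDeriv_le hm] with t ht htab
  exact (ht htab).1.trans_lt ENNReal.ofReal_lt_top

/-- The metric derivative of an absolutely continuous curve bounds its speed. -/
theorem SpeedBound.metricDeriv {u : ℝ → X} {m : ℝ → ℝ} {a b : ℝ}
    (h : SpeedBound u m (Icc a b)) (hm : IntervalIntegrable m volume a b) :
    SpeedBound u (fun t => (metricDeriv u t).toReal) (Icc a b) := by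
  intro s hs t ht hst
  have hsub : Icc s t ⊆ Icc a b := Icc_subset_Icc hs.1 ht.2
  have hab : a ≤ b := hs.1.trans hs.2
  have hst' := h.mono hsub
  have hm' : IntervalIntegrable m volume s t :=
    hm.mono_set (by rwa [uIcc_of_le hab, uIcc_of_le hst])
  -- The real function `r ↦ d(u s, u r)` vanishes at `s` and is absolutely continuous, so `d(u s, u
  -- t)` is the integral of its derivative, which is at most `|u'|`.
  have hAC : AbsolutelyContinuousOnInterval (fun r => dist (u s) (u r)) s t := by
    have hu := hst'.absolutelyContinuousOnInterval hst hm'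
    rw [absolutelyContinuousOnInterval_iff] at hu ⊢
    intro ε hε
    obtain ⟨δ, hδ, H⟩ := hu ε hε
    refine ⟨δ, hδ, fun E hE hlt => lt_of_le_of_lt (Finset.sum_le_sum fun i hi => ?_) (H E hE hlt)⟩
    rw [Real.dist_eq, dist_comm (u s), dist_comm (u s)]
    exact abs_dist_sub_le _ _ _
  have hint := hAC.integral_deriv_eq_sub
  have hmd := (hst'.integrableOn_metricDeriv hst hm')
  simp only [dist_self, sub_zero] at hint
  rw [← hint]
  refine intervalIntegral.integral_mono_ae_restrict hst hAC.intervalIntegrable_deriv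
    ((intervalIntegrable_iff_integrableOn_Icc_of_le hst).2 hmd) ?_
  have hdiff := hAC.ae_differentiableAt
  filter_upwards [hst'.metricDeriv_lt_top hm', ae_restrict_mem measurableSet_Icc,
    ae_restrict_of_ae hdiff] with r hr hrI hrd
  have := ofReal_abs_le_metricDeriv (u := u)
    (hrd (by rwa [uIcc_of_le hst])).hasDerivAt (Eventually.of_forall fun q => by
      rw [dist_comm (u s), dist_comm (u s)]; exact abs_dist_sub_le _ _ _)
  exact (le_abs_self _).trans ((ENNReal.ofReal_le_iff_le_toReal hr.ne).1 this)

end Speed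

/-! ### Weighted integral inequalities -/

section Hardy

/-- Cauchy–Schwarz with weight `p`, obtained by integrating `2cm ≤ m²p + c²/p` and optimising over
the constant `c`. -/
theorem sq_integral_le_mul {m p : ℝ → ℝ} {a b : ℝ} (hab : a ≤ b) (hp : ∀ t, 0 < p t)
    (hm : IntervalIntegrable m volume a b)
    (hmp : IntervalIntegrable (fun t => m t ^ 2 * p t) volume a b)
    (hp' : IntervalIntegrable (fun t => (p t)⁻¹) volume a b) :
    (∫ t in a..b, m t) ^ 2 ≤ (∫ t in a..b, m t ^ 2 * p t) * ∫ t in a..b, (p t)⁻¹ := by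
  set M := ∫ t in a..b, m t
  set P := ∫ t in a..b, (p t)⁻¹
  have hP : 0 ≤ P := intervalIntegral.integral_nonneg hab fun t _ => (inv_pos.2 (hp t)).le
  have key : ∀ c : ℝ, 2 * c * M ≤ (∫ t in a..b, m t ^ 2 * p t) + c ^ 2 * P := by
    intro c
    rw [← intervalIntegral.integral_const_mul, ← intervalIntegral.integral_const_mul,
      ← intervalIntegral.integral_add hmp (hp'.const_mul _)]
    refine intervalIntegral.integral_mono_on hab (hm.const_mul _) (hmp.add (hp'.const_mul _)) ?_
    intro t _
    have h1 := hp t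
    have : m t ^ 2 * p t + c ^ 2 * (p t)⁻¹ - 2 * c * m t = (m t * p t - c) ^ 2 / p t := by
      field_simp; ring
    have h2 : 0 ≤ (m t * p t - c) ^ 2 / p t := by positivity
    linarith
  -- If the second factor vanishes, `2cM` is bounded uniformly in `c`, which forces `M = 0`;
  -- otherwise `c = M/P` is optimal.
  rcases hP.eq_or_lt with h0 | h0
  · have hQ : 0 ≤ ∫ t in a..b, m t ^ 2 * p t :=
      intervalIntegral.integral_nonneg hab fun t _ => mul_nonneg (sq_nonneg _) (hp t).le
    rw [← h0, mul_zero]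
    have h1 := key ((∫ t in a..b, m t ^ 2 * p t) + 1)
    by_contra hM
    have hM0 : M ≠ 0 := by rintro h; simp [h] at hM
    have h2 := key (((∫ t in a..b, m t ^ 2 * p t) + 1) / M)
    rw [← h0] at h2
    have : 2 * (((∫ t in a..b, m t ^ 2 * p t) + 1) / M) * M
        = 2 * ((∫ t in a..b, m t ^ 2 * p t) + 1) := by field_simp
    linarith
  · have h1 := key (M / P)
    have h2 : 2 * (M / P) * M - (M / P) ^ 2 * P = M ^ 2 / P := by field_simp; ring
    have h3 : M ^ 2 / P ≤ ∫ t in a..b, m t ^ 2 * p t := by linarith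
    rwa [div_le_iff₀ h0] at h3

/-- Integration by parts for absolutely continuous functions. It serves both the Hardy inequality
and the Gronwall-type argument for the value function. -/
theorem integral_exp_mul_primitive {h : ℝ → ℝ} {a b κ : ℝ}
    (hh : IntervalIntegrable h volume a b) :
    ∫ t in a..b, κ * Real.exp (-κ * t) * ∫ r in a..t, h r
      = (∫ t in a..b, Real.exp (-κ * t) * h t) - Real.exp (-κ * b) * ∫ r in a..b, h r := by
  have hF := hh.absolutelyContinuousOnInterval_intervalIntegral (c := a) left_mem_uIcc
  have hE : AbsolutelyContinuousOnInterval (fun t => Real.exp (-κ * t)) a b :=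
    ContDiffOn.absolutelyContinuousOnInterval (by fun_prop)
  have h1 := hE.integral_mul_deriv_eq_deriv_mul hF
  have hd : ∀ t, deriv (fun t => Real.exp (-κ * t)) t = -(κ * Real.exp (-κ * t)) := by
    intro t
    have : HasDerivAt (fun t => Real.exp (-κ * t)) (Real.exp (-κ * t) * (-κ * 1)) t :=
      ((hasDerivAt_id t).const_mul (-κ)).exp
    rw [this.deriv]; ring
  have h2 : ∫ t in a..b, Real.exp (-κ * t) * deriv (fun x => ∫ r in a..x, h r) t
      = ∫ t in a..b, Real.exp (-κ * t) * h t := by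
    refine intervalIntegral.integral_congr_ae ?_
    filter_upwards [hh.ae_hasDerivAt_integral] with t ht htI
    rw [(ht (uIoc_subset_uIcc htI) a left_mem_uIcc).deriv]
  rw [h2] at h1
  simp only [hd] at h1
  simp only [intervalIntegral.integral_same, mul_zero, sub_zero, neg_mul,
    intervalIntegral.integral_neg] at h1 ⊢
  linarith

theorem intervalIntegrable_of_sq {m : ℝ → ℝ} {a b : ℝ} (hab : a ≤ b)
    (hm : AEStronglyMeasurable m (volume.restrict (Ioc a b)))
    (h : IntervalIntegrable (fun t => m t ^ 2) volume a b) :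
    IntervalIntegrable m volume a b := by
  rw [intervalIntegrable_iff_integrableOn_Ioc_of_le hab] at *
  refine Integrable.mono' (h.add (integrable_const (1 : ℝ))) hm (Eventually.of_forall fun t => ?_)
  rw [Real.norm_eq_abs, Pi.add_apply, ← sq_abs]
  nlinarith [sq_nonneg (|m t| - 1), abs_nonneg (m t)]

theorem intervalIntegrable_of_mul_exp {f : ℝ → ℝ} {a b ε : ℝ}
    (h : IntervalIntegrable (fun t => f t * Real.exp (-t / ε)) volume a b) :
    IntervalIntegrable f volume a b := by
  have := h.mul_continuousOn (g := fun t => Real.exp (t / ε)) (by fun_prop)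
  refine this.congr fun t _ => ?_
  rw [mul_assoc, ← Real.exp_add, neg_div, neg_add_cancel, Real.exp_zero, mul_one]

/-- Split the weight as `exp (-t/ε) = exp (-κt)²` with `κ = 1/(2ε)`. Cauchy–Schwarz with weight `exp
(-κr)` bounds `f(t)²` by `2ε exp (κt) ∫ m² exp (-κr)`. Integrating against `exp (-2κt)` by parts
restores the full weight on `m²` and contributes a second factor `2ε`; the boundary term has a
favourable sign. -/
theorem hardy_exp {m f : ℝ → ℝ} {ε : ℝ} (hε : 0 < ε)
    (hm : AEStronglyMeasurable m (volume.restrict (Ioi 0)))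
    (hme : IntegrableOn (fun t => m t ^ 2 * Real.exp (-t / ε)) (Ioi 0))
    (hf : ContinuousOn f (Ici 0)) (hf0 : ∀ t, 0 ≤ t → 0 ≤ f t)
    (hfm : ∀ t, 0 ≤ t → f t ≤ ∫ r in 0..t, m r) :
    IntegrableOn (fun t => f t ^ 2 * Real.exp (-t / ε)) (Ioi 0) ∧
      ∫ t in Ioi 0, f t ^ 2 * Real.exp (-t / ε)
        ≤ 4 * ε ^ 2 * ∫ t in Ioi 0, m t ^ 2 * Real.exp (-t / ε) := by
  set κ : ℝ := 1 / (2 * ε) with hκ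
  have hκ0 : 0 < κ := by positivity
  have hI : ∀ T, 0 ≤ T → IntervalIntegrable (fun t => m t ^ 2 * Real.exp (-t / ε)) volume 0 T := by
    intro T hT
    rw [intervalIntegrable_iff_integrableOn_Ioc_of_le hT]
    exact hme.mono_set Ioc_subset_Ioi_self
  have hm2 : ∀ T, 0 ≤ T → IntervalIntegrable (fun t => m t ^ 2) volume 0 T := fun T hT =>
    intervalIntegrable_of_mul_exp (hI T hT)
  have hm1 : ∀ T, 0 ≤ T → IntervalIntegrable m volume 0 T := fun T hT =>
    intervalIntegrable_of_sq hT (hm.mono_set Ioc_subset_Ioi_self) (hm2 T hT)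
  have hh : ∀ T, 0 ≤ T → IntervalIntegrable (fun t => m t ^ 2 * Real.exp (-κ * t)) volume 0 T :=
    fun T hT => (hm2 T hT).mul_continuousOn (by fun_prop)
  have hexp : ∀ T, 0 ≤ T → ∫ t in 0..T, (Real.exp (-κ * t))⁻¹ ≤ 2 * ε * Real.exp (κ * T) := by
    intro T hT
    have : ∀ t, HasDerivAt (fun t => Real.exp (κ * t) / κ) ((Real.exp (-κ * t))⁻¹) t := by
      intro t
      refine (((hasDerivAt_id' t).const_mul κ).exp.div_const κ).congr_deriv ?_
      rw [← Real.exp_neg, neg_mul, neg_neg]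
      field_simp
    rw [intervalIntegral.integral_eq_sub_of_hasDerivAt (fun t _ => this t)
      (Continuous.intervalIntegrable (by fun_prop (disch := intros; positivity)) _ _)]
    have h1 : Real.exp (κ * T) / κ = 2 * ε * Real.exp (κ * T) := by rw [hκ]; field_simp
    have h2 : 0 < Real.exp (κ * 0) / κ := by positivity
    linarith
  have hpt : ∀ t, 0 ≤ t → f t ^ 2 * Real.exp (-t / ε)
      ≤ 4 * ε ^ 2 * (κ * Real.exp (-κ * t) * ∫ r in 0..t, m r ^ 2 * Real.exp (-κ * r)) := by
    intro t ht
    have h1 : f t ^ 2 ≤ (∫ r in 0..t, m r) ^ 2 := by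
      have := hf0 t ht; have := hfm t ht; gcongr
    have h2 := sq_integral_le_mul ht (p := fun r => Real.exp (-κ * r)) (fun _ => Real.exp_pos _)
      (hm1 t ht) (hh t ht) (Continuous.intervalIntegrable (by
        fun_prop (disch := intros; positivity)) _ _)
    have h3 : 0 ≤ ∫ r in 0..t, m r ^ 2 * Real.exp (-κ * r) :=
      intervalIntegral.integral_nonneg ht fun r _ => by positivity
    have h4 : f t ^ 2 ≤ (∫ r in 0..t, m r ^ 2 * Real.exp (-κ * r)) * (2 * ε * Real.exp (κ * t)) :=
      (h1.trans h2).trans (mul_le_mul_of_nonneg_left (hexp t ht) h3)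
    calc f t ^ 2 * Real.exp (-t / ε)
        ≤ (∫ r in 0..t, m r ^ 2 * Real.exp (-κ * r)) * (2 * ε * Real.exp (κ * t))
          * Real.exp (-t / ε) := by gcongr
      _ = (∫ r in 0..t, m r ^ 2 * Real.exp (-κ * r)) * (2 * ε)
          * (Real.exp (κ * t) * Real.exp (-t / ε)) := by ring
      _ = _ := by
        rw [← Real.exp_add, show κ * t + -t / ε = -κ * t by rw [hκ]; field_simp; ring]
        rw [hκ]; field_simp; ring
  have hfin : ∀ T, 0 ≤ T → ∫ t in 0..T, f t ^ 2 * Real.exp (-t / ε)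
      ≤ 4 * ε ^ 2 * ∫ t in Ioi 0, m t ^ 2 * Real.exp (-t / ε) := by
    intro T hT
    have hfI : IntervalIntegrable (fun t => f t ^ 2 * Real.exp (-t / ε)) volume 0 T := by
      refine ContinuousOn.intervalIntegrable ?_
      rw [uIcc_of_le hT]
      have := hf.mono (show Icc 0 T ⊆ Ici 0 from fun x hx => hx.1)
      fun_prop
    have hprim : ContinuousOn (fun t => ∫ r in 0..t, m r ^ 2 * Real.exp (-κ * r)) (uIcc 0 T) :=
      ((hh T hT).absolutelyContinuousOnInterval_intervalIntegral (c := 0) left_mem_uIcc).continuousOn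
    have h1 := intervalIntegral.integral_mono_on hT hfI (ContinuousOn.intervalIntegrable (by
      fun_prop)) fun t ht => hpt t ht.1
    rw [intervalIntegral.integral_const_mul, integral_exp_mul_primitive (hh T hT)] at h1
    have h3 : 0 ≤ ∫ r in 0..T, m r ^ 2 * Real.exp (-κ * r) :=
      intervalIntegral.integral_nonneg hT fun r _ => by positivity
    have h4 : ∫ t in 0..T, Real.exp (-κ * t) * (m t ^ 2 * Real.exp (-κ * t))
        = ∫ t in 0..T, m t ^ 2 * Real.exp (-t / ε) := by
      refine intervalIntegral.integral_congr fun t _ => ?_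
      rw [mul_left_comm, ← Real.exp_add]
      congr 2
      rw [hκ]; field_simp; ring
    have h5 : ∫ t in 0..T, m t ^ 2 * Real.exp (-t / ε)
        ≤ ∫ t in Ioi 0, m t ^ 2 * Real.exp (-t / ε) := by
      rw [intervalIntegral.integral_of_le hT]
      exact setIntegral_mono_set hme (Eventually.of_forall fun t => by positivity)
        (Eventually.of_forall fun t ht => ht.1)
    rw [h4] at h1
    refine h1.trans (mul_le_mul_of_nonneg_left ?_ (by positivity))
    have : 0 ≤ Real.exp (-κ * T) * ∫ r in 0..T, m r ^ 2 * Real.exp (-κ * r) := by positivity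
    linarith
  have hint : IntegrableOn (fun t => f t ^ 2 * Real.exp (-t / ε)) (Ioi 0) := by
    refine integrableOn_Ioi_of_intervalIntegral_norm_bounded
      (4 * ε ^ 2 * ∫ t in Ioi 0, m t ^ 2 * Real.exp (-t / ε)) 0 (b := fun n : ℕ => (n : ℝ))
      (fun n => ?_) tendsto_natCast_atTop_atTop (Eventually.of_forall fun n => ?_)
    · have := hf.mono (show Icc 0 (n : ℝ) ⊆ Ici 0 from fun x hx => hx.1)
      exact (ContinuousOn.integrableOn_Icc (by fun_prop)).mono_set Ioc_subset_Icc_self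
    · refine le_of_eq_of_le (intervalIntegral.integral_congr fun t _ => ?_)
        (hfin n (Nat.cast_nonneg n))
      exact Real.norm_of_nonneg (by positivity)
  refine ⟨hint, le_of_tendsto (intervalIntegral_tendsto_integral_Ioi 0 hint
    tendsto_natCast_atTop_atTop) (Eventually.of_forall fun n : ℕ => hfin n (Nat.cast_nonneg n))⟩

theorem integrableOn_exp_neg_div {ε : ℝ} (hε : 0 < ε) (a : ℝ) :
    IntegrableOn (fun t : ℝ => Real.exp (-t / ε)) (Ioi a) := by
  have := exp_neg_integrableOn_Ioi a (b := 1 / ε) (by positivity)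
  refine this.congr_fun (fun t _ => ?_) measurableSet_Ioi
  ring_nf

theorem integral_exp_neg_div_Ioi {ε : ℝ} (hε : 0 < ε) :
    ∫ t in Ioi (0 : ℝ), Real.exp (-t / ε) = ε := by
  have := integral_exp_mul_Ioi (a := -(1 / ε)) (by simp; positivity) 0
  simp only [mul_zero, Real.exp_zero] at this
  rw [show (-1 : ℝ) / (-(1/ε)) = ε by field_simp] at this
  refine (integral_congr_ae (Eventually.of_forall fun t => ?_)).trans this
  ring_nf

theorem hasDerivAt_exp_neg_div (ε t : ℝ) :
    HasDerivAt (fun t => Real.exp (-t / ε)) (-(Real.exp (-t / ε) / ε)) t := by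
  refine (((hasDerivAt_id' t).fun_neg.div_const ε).exp).congr_deriv ?_
  ring

theorem integral_exp_neg_div {ε : ℝ} (hε : 0 < ε) (T : ℝ) :
    ∫ t in 0..T, Real.exp (-t / ε) = ε * (1 - Real.exp (-T / ε)) := by
  have h : ∀ t, HasDerivAt (fun t => -ε * Real.exp (-t / ε)) (Real.exp (-t / ε)) t := by
    intro t
    refine ((hasDerivAt_exp_neg_div ε t).const_mul (-ε)).congr_deriv ?_
    field_simp
  rw [intervalIntegral.integral_eq_sub_of_hasDerivAt (fun t _ => h t)
      (Continuous.intervalIntegrable (by fun_prop) _ _)]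
  simp; ring

end Hardy

/-! ### Trajectories with a speed bound and their cost -/

section Cost

variable {X : Type*} [MetricSpace X]

/-- Distance to a `σ`-neighbourhood of `x` is at most distance to `x`, so uniformity of
neighbourhoods makes metric convergence stronger than `σ`-convergence. Lower semicontinuity along
`σ`-convergent bounded sequences thereby becomes metric lower semicontinuity. -/
theorem IsCompatible.tendsto_of_dist {σ : TopologicalSpace X} (hσ : IsCompatible σ) {v : ℕ → X}
    {x : X} (hv : Tendsto (fun n => dist (v n) x) atTop (𝓝 0)) :
    Tendsto v atTop (@nhds X σ x) := by
  intro S hS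
  obtain ⟨U, hUS, hU, hxU⟩ := mem_nhds_iff.1 hS
  obtain ⟨V, -, hxV, δ, hδ, H⟩ := hσ.nhds_uniform U hU x hxU
  have h1 : ∀ᶠ n in atTop, dist (v n) x < δ := hv.eventually_lt_const hδ
  exact h1.mono fun n hn => hUS (H _ ((Metric.infDist_le_dist_of_mem hxV).trans_lt hn))

theorem IsLSCC.le_liminf {σ : TopologicalSpace X} (hσ : IsCompatible σ) {φ : X → EReal}
    {B : ℝ} (hφ : IsLSCC σ φ B) {v : ℕ → X} {x : X}
    (hv : Tendsto (fun n => dist (v n) x) atTop (𝓝 0)) :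
    φ x ≤ liminf (fun n => φ (v n)) atTop := by
  refine hφ.lsc v x ?_ (hσ.tendsto_of_dist hv)
  obtain ⟨C, hC⟩ := hv.bddAbove_range
  refine ⟨C + C, fun n m => (dist_triangle_right _ _ x).trans ?_⟩
  exact add_le_add (hC ⟨n, rfl⟩) (hC ⟨m, rfl⟩)

theorem lowerSemicontinuous_of_seq {φ : X → EReal}
    (h : ∀ (v : ℕ → X) (x : X), Tendsto (fun n => dist (v n) x) atTop (𝓝 0) →
      φ x ≤ liminf (fun n => φ (v n)) atTop) : LowerSemicontinuous φ := by
  intro x y hy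
  by_contra hcon
  rw [Filter.not_eventually] at hcon
  obtain ⟨v, hv, hvy⟩ := exists_seq_forall_of_frequently hcon
  have h1 := h v x (tendsto_iff_dist_tendsto_zero.1 hv)
  have h2 : liminf (fun n => φ (v n)) atTop ≤ y :=
    liminf_le_of_frequently_le' (Frequently.of_forall fun n => not_lt.1 (hvy n))
  exact absurd (h1.trans h2) (not_le.2 hy)

/-- Lower semicontinuity and the quadratic lower bound for `φ`, with explicit constants. -/
structure QuadBound (φ : X → EReal) (ε B A : ℝ) (p : X) : Prop where
  eps_pos : 0 < ε
  lsc : LowerSemicontinuous φ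
  B_nonneg : 0 ≤ B
  B_le : B ≤ 1 / (16 * ε)
  A_nonneg : 0 ≤ A
  bound : ∀ u v : X, ((-(B * dist u v ^ 2) - (B * dist v p ^ 2 + A) : ℝ) : EReal) ≤ φ u

/-- An admissible trajectory with finite potential energy, with a bound `m` for its speed. -/
structure Traj (φ : X → EReal) (ε : ℝ) (u : ℝ → X) (m : ℝ → ℝ) : Prop where
  speed : SpeedBound u m (Ici 0)
  meas : AEStronglyMeasurable m (volume.restrict (Ioi 0))
  energy : IntegrableOn (fun t => m t ^ 2 * Real.exp (-t / ε)) (Ioi 0)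
  finite : ∀ᵐ t ∂(volume.restrict (Ioi 0)), φ (u t) ≠ ⊤
  potential : IntegrableOn (fun t => (φ (u t)).toReal * Real.exp (-t / ε)) (Ioi 0)

/-- The integrand of the functional, up to the exponential weight. -/
def lagrangian (φ : X → EReal) (ε : ℝ) (u : ℝ → X) (m : ℝ → ℝ) (t : ℝ) : ℝ :=
  m t ^ 2 / 2 + (φ (u t)).toReal / ε

/-- The functional for a trajectory with speed bound `m`. -/
def cost (φ : X → EReal) (ε : ℝ) (u : ℝ → X) (m : ℝ → ℝ) : ℝ :=
  ∫ t in Ioi 0, lagrangian φ ε u m t * Real.exp (-t / ε)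

variable {φ : X → EReal} {ε B A : ℝ} {p : X}

theorem QuadBound.ne_bot (h : QuadBound φ ε B A p) (x : X) : φ x ≠ ⊥ := by
  intro hx
  have := h.bound x x
  rw [hx, le_bot_iff] at this
  exact EReal.coe_ne_bot _ this

theorem QuadBound.le_toReal (h : QuadBound φ ε B A p) (u v : X) (hu : φ u ≠ ⊤) :
    -(B * dist u v ^ 2) - (B * dist v p ^ 2 + A) ≤ (φ u).toReal := by
  have := h.bound u v
  rwa [← EReal.coe_toReal hu (h.ne_bot u), EReal.coe_le_coe_iff] at this

/-! ### Local consequences of a finite weighted energy -/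

section Local

variable {u : ℝ → X} {m : ℝ → ℝ}

theorem intervalIntegrable_sq_of_energy
    (he : IntegrableOn (fun t => m t ^ 2 * Real.exp (-t / ε)) (Ioi 0)) {a b : ℝ} (ha : 0 ≤ a)
    (hab : a ≤ b) : IntervalIntegrable (fun t => m t ^ 2) volume a b := by
  refine intervalIntegrable_of_mul_exp (ε := ε) ?_
  rw [intervalIntegrable_iff_integrableOn_Ioc_of_le hab]
  exact he.mono_set fun t ht => ha.trans_lt ht.1

theorem intervalIntegrable_of_energy (hm : AEStronglyMeasurable m (volume.restrict (Ioi 0)))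
    (he : IntegrableOn (fun t => m t ^ 2 * Real.exp (-t / ε)) (Ioi 0)) {a b : ℝ} (ha : 0 ≤ a)
    (hab : a ≤ b) : IntervalIntegrable m volume a b :=
  intervalIntegrable_of_sq hab (hm.mono_set fun _ ht => ha.trans_lt ht.1)
    (intervalIntegrable_sq_of_energy he ha hab)

theorem continuousOn_Ici_of_Icc {Y : Type*} [TopologicalSpace Y] {u : ℝ → Y}
    (h : ∀ T, 0 ≤ T → ContinuousOn u (Icc 0 T)) : ContinuousOn u (Ici 0) := by
  intro t ht
  have h1 := h (t + 1) (by linarith [mem_Ici.1 ht]) t ⟨ht, by linarith⟩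
  refine h1.mono_of_mem_nhdsWithin ?_
  filter_upwards [self_mem_nhdsWithin, mem_nhdsWithin_of_mem_nhds (Iio_mem_nhds (lt_add_one t))]
    with s hs hs' using ⟨hs, le_of_lt hs'⟩

theorem continuousOn_of_energy (hs : SpeedBound u m (Ici 0))
    (hm : AEStronglyMeasurable m (volume.restrict (Ioi 0)))
    (he : IntegrableOn (fun t => m t ^ 2 * Real.exp (-t / ε)) (Ioi 0)) :
    ContinuousOn u (Ici 0) :=
  continuousOn_Ici_of_Icc fun _ hT => (hs.mono fun _ hx => hx.1).continuousOn hT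
    (intervalIntegrable_of_energy hm he le_rfl hT)

theorem aemeasurable_comp_of_continuousOn (h : LowerSemicontinuous φ) {S : Set ℝ}
    (hS : MeasurableSet S) (hu : ContinuousOn u S) :
    AEMeasurable (fun t => φ (u t)) (volume.restrict S) := by
  have h1 : Measurable (fun t : S => φ (u t)) :=
    (h.comp hu.domRestrict).measurable
  exact (aemeasurable_restrict_iff_comap_subtype hS).2 h1.aemeasurable

theorem ae_Ioi_of_forall_Ioo {P : ℝ → Prop}
    (h : ∀ n : ℕ, ∀ᵐ t : ℝ, t ∈ Ioo (0 : ℝ) n → P t) :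
    ∀ᵐ t ∂(volume.restrict (Ioi (0 : ℝ))), P t := by
  rw [ae_restrict_iff' measurableSet_Ioi]
  filter_upwards [ae_all_iff.2 h] with t ht h0
  obtain ⟨n, hn⟩ := exists_nat_gt t
  exact ht n ⟨h0, hn⟩

theorem metricDeriv_le_of_energy (hs : SpeedBound u m (Ici 0))
    (hm : AEStronglyMeasurable m (volume.restrict (Ioi 0)))
    (he : IntegrableOn (fun t => m t ^ 2 * Real.exp (-t / ε)) (Ioi 0)) :
    ∀ᵐ t ∂(volume.restrict (Ioi (0 : ℝ))), metricDeriv u t ≤ ENNReal.ofReal (m t) ∧ 0 ≤ m t :=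
  ae_Ioi_of_forall_Ioo fun n => (hs.mono fun _ hx => hx.1).metricDeriv_le
    (intervalIntegrable_of_energy hm he le_rfl (Nat.cast_nonneg n))

end Local

theorem lintegral_expMeasure (f : ℝ → ℝ≥0∞) :
    ∫⁻ t, f t ∂(expMeasure ε)
      = ∫⁻ t in Ioi 0, ENNReal.ofReal (Real.exp (-t / ε) / ε) * f t := by
  unfold expMeasure
  rw [lintegral_withDensity_eq_lintegral_mul_non_measurable]
  · rfl
  · fun_prop
  · exact Eventually.of_forall fun _ => ENNReal.ofReal_lt_top

theorem expMeasure_absolutelyContinuous : expMeasure ε ≪ volume.restrict (Ioi 0) :=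
  withDensity_absolutelyContinuous _ _

theorem integrable_expMeasure_iff (hε : 0 < ε) {f : ℝ → ℝ} :
    Integrable f (expMeasure ε) ↔ IntegrableOn (fun t => f t * Real.exp (-t / ε)) (Ioi 0) := by
  unfold expMeasure
  rw [integrable_withDensity_iff (by fun_prop)
    (Eventually.of_forall fun _ => ENNReal.ofReal_lt_top), IntegrableOn]
  have : (fun t => f t * (ENNReal.ofReal (Real.exp (-t / ε) / ε)).toReal)
      = fun t => (f t * Real.exp (-t / ε)) * ε⁻¹ := by
    funext t
    rw [ENNReal.toReal_ofReal (by positivity)]; ring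
  rw [this]
  exact integrable_mul_const_iff (isUnit_iff_ne_zero.2 (inv_ne_zero hε.ne')) _

theorem integral_expMeasure (hε : 0 < ε) (f : ℝ → ℝ) :
    ∫ t, f t ∂(expMeasure ε) = ∫ t in Ioi 0, f t / ε * Real.exp (-t / ε) := by
  unfold expMeasure
  rw [integral_withDensity_eq_integral_toReal_smul (by fun_prop)
    (Eventually.of_forall fun _ => ENNReal.ofReal_lt_top)]
  refine integral_congr_ae (Eventually.of_forall fun t => ?_)
  simp only [smul_eq_mul]
  rw [ENNReal.toReal_ofReal (by positivity)]; ring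

theorem integralEReal_eq_coe {μ : Measure ℝ} {f : ℝ → EReal} {g : ℝ → ℝ}
    (h : f =ᵐ[μ] fun t => (g t : EReal)) (hg : Integrable g μ) :
    integralEReal f μ = ((∫ t, g t ∂μ : ℝ) : EReal) := by
  unfold integralEReal
  have h1 : ∫⁻ t, (f t).toENNReal ∂μ = ∫⁻ t, ENNReal.ofReal (g t) ∂μ :=
    lintegral_congr_ae (h.mono fun t ht => by simp only [ht]; exact EReal.toENNReal_of_ne_top (EReal.coe_ne_top _))
  have h2 : ∫⁻ t, (-f t).toENNReal ∂μ = ∫⁻ t, ENNReal.ofReal (-g t) ∂μ :=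
    lintegral_congr_ae (h.mono fun t ht => by
      simp only [ht, ← EReal.coe_neg]; exact EReal.toENNReal_of_ne_top (EReal.coe_ne_top _))
  have h3 := hg.lintegral_lt_top.ne
  have h4 := hg.neg.lintegral_lt_top.ne
  simp only [Pi.neg_apply] at h4
  rw [h1, h2, integral_eq_lintegral_pos_part_sub_lintegral_neg_part hg, EReal.coe_sub,
    EReal.coe_ennreal_toReal h3, EReal.coe_ennreal_toReal h4]

end Cost

/-! ### From the functional to the real-valued cost; coercivity and bounds for the value function -/

section Value

variable {X : Type*} [MetricSpace X] {φ : X → EReal} {ε B A : ℝ} {p : X} {u : ℝ → X} {m : ℝ → ℝ}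

theorem hardy_dist (hε : 0 < ε) (hs : SpeedBound u m (Ici 0))
    (hm : AEStronglyMeasurable m (volume.restrict (Ioi 0)))
    (he : IntegrableOn (fun t => m t ^ 2 * Real.exp (-t / ε)) (Ioi 0)) :
    IntegrableOn (fun t => dist (u t) (u 0) ^ 2 * Real.exp (-t / ε)) (Ioi 0) ∧
      ∫ t in Ioi 0, dist (u t) (u 0) ^ 2 * Real.exp (-t / ε)
        ≤ 4 * ε ^ 2 * ∫ t in Ioi 0, m t ^ 2 * Real.exp (-t / ε) := by
  have hc := continuousOn_of_energy hs hm he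
  refine hardy_exp (f := fun t => dist (u t) (u 0)) hε hm he (by fun_prop)
    (fun t _ => dist_nonneg) fun t ht => ?_
  rw [dist_comm]
  exact hs 0 self_mem_Ici t ht ht

/-- Since `|u'| ≤ m` a.e., a speed bound with finite weighted energy certifies admissibility, with
no computation of metric derivatives. -/
theorem mem_admissible_of_energy (hε : 0 < ε) (hs : SpeedBound u m (Ici 0))
    (hm : AEStronglyMeasurable m (volume.restrict (Ioi 0)))
    (he : IntegrableOn (fun t => m t ^ 2 * Real.exp (-t / ε)) (Ioi 0)) :
    u ∈ admissible ε (u 0) := by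
  refine ⟨fun a b hab hI => ⟨m, ?_, hs.mono hI⟩, rfl, ?_⟩
  · have ha : 0 ≤ a := hI (left_mem_Icc.2 hab)
    have h1 : AEStronglyMeasurable m (volume.restrict (Icc a b)) := by
      rw [← restrict_Ioc_eq_restrict_Icc]
      exact hm.mono_set fun t ht => ha.trans_lt ht.1
    rw [memLp_two_iff_integrable_sq h1]
    have := intervalIntegrable_sq_of_energy he ha hab
    rwa [intervalIntegrable_iff_integrableOn_Icc_of_le hab] at this
  · rw [lintegral_expMeasure]
    have h1 : ∫⁻ t in Ioi 0, ENNReal.ofReal (Real.exp (-t / ε) / ε) * metricDeriv u t ^ 2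
        ≤ ∫⁻ t in Ioi 0, ENNReal.ofReal (m t ^ 2 * Real.exp (-t / ε) * ε⁻¹) := by
      refine lintegral_mono_ae ?_
      filter_upwards [metricDeriv_le_of_energy hs hm he] with t ht
      calc ENNReal.ofReal (Real.exp (-t / ε) / ε) * metricDeriv u t ^ 2
          ≤ ENNReal.ofReal (Real.exp (-t / ε) / ε) * ENNReal.ofReal (m t) ^ 2 := by
            gcongr; exact ht.1
        _ = _ := by
            rw [← ENNReal.ofReal_pow ht.2, ← ENNReal.ofReal_mul (by positivity)]
            congr 1; ring
    exact h1.trans_lt (he.mul_const _).lintegral_lt_top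

/-- Converse direction: `|u'|` is itself a speed bound with finite energy. The local `L²` bounds
from the definition serve only to get continuity, a.e. finiteness and the speed bound on compact
intervals. -/
theorem energy_of_mem_admissible (hε : 0 < ε) {x : X} (h : u ∈ admissible ε x) :
    SpeedBound u (fun t => (metricDeriv u t).toReal) (Ici 0) ∧
    AEStronglyMeasurable (fun t => (metricDeriv u t).toReal) (volume.restrict (Ioi 0)) ∧
    IntegrableOn (fun t => (metricDeriv u t).toReal ^ 2 * Real.exp (-t / ε)) (Ioi 0) ∧
    ∀ᵐ t ∂(volume.restrict (Ioi (0 : ℝ))), metricDeriv u t < ∞ := by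
  obtain ⟨hac, -, hfin⟩ := h
  have hloc : ∀ T, 0 ≤ T → ∃ m, SpeedBound u m (Icc 0 T) ∧ IntervalIntegrable m volume 0 T := by
    intro T hT
    obtain ⟨m, hm, hd⟩ := hac 0 T hT fun x hx => hx.1
    refine ⟨m, hd, ?_⟩
    rw [intervalIntegrable_iff_integrableOn_Icc_of_le hT]
    exact hm.integrable (by norm_num)
  have hcont : ContinuousOn u (Ici 0) := continuousOn_Ici_of_Icc fun T hT => by
    obtain ⟨m, h1, h2⟩ := hloc T hT
    exact h1.continuousOn hT h2
  have hmeas := aemeasurable_metricDeriv_Ici hcont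
  have hlt : ∀ᵐ t ∂(volume.restrict (Ioi (0 : ℝ))), metricDeriv u t < ∞ := by
    refine ae_Ioi_of_forall_Ioo fun n => ?_
    obtain ⟨m, h1, h2⟩ := hloc n (Nat.cast_nonneg n)
    filter_upwards [h1.metricDeriv_le h2] with t ht htI
    exact (ht htI).1.trans_lt ENNReal.ofReal_lt_top
  refine ⟨?_, hmeas.ennreal_toReal.aestronglyMeasurable, ?_, hlt⟩
  · intro s hs t ht hst
    obtain ⟨m, h1, h2⟩ := hloc t ht
    exact h1.metricDeriv h2 s ⟨hs, hst⟩ t ⟨ht, le_rfl⟩ hst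
  · have hmm : AEMeasurable (fun t => (metricDeriv u t).toReal ^ 2 * Real.exp (-t / ε) * ε⁻¹)
        (volume.restrict (Ioi 0)) :=
      ((hmeas.ennreal_toReal.pow_const 2).mul (by fun_prop)).mul_const _
    have h2 : IntegrableOn (fun t => (metricDeriv u t).toReal ^ 2 * Real.exp (-t / ε) * ε⁻¹)
        (Ioi 0) := by
      refine ⟨hmm.aestronglyMeasurable, ?_⟩
      rw [hasFiniteIntegral_iff_ofReal (Eventually.of_forall fun t => by positivity)]
      rw [lintegral_expMeasure] at hfin
      refine lt_of_le_of_lt (lintegral_mono_ae ?_) hfin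
      filter_upwards [hlt] with t ht
      rw [show (metricDeriv u t).toReal ^ 2 * Real.exp (-t / ε) * ε⁻¹
        = Real.exp (-t / ε) / ε * (metricDeriv u t).toReal ^ 2 by ring,
        ENNReal.ofReal_mul (by positivity), ENNReal.ofReal_pow ENNReal.toReal_nonneg,
        ENNReal.ofReal_toReal ht.ne]
    exact (integrable_mul_const_iff (isUnit_iff_ne_zero.2 (inv_ne_zero hε.ne')) _).1 h2

theorem Traj.mem_admissible (hε : 0 < ε) (h : Traj φ ε u m) : u ∈ admissible ε (u 0) :=
  mem_admissible_of_energy hε h.speed h.meas h.energy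

theorem Traj.continuousOn (h : Traj φ ε u m) : ContinuousOn u (Ici 0) :=
  continuousOn_of_energy h.speed h.meas h.energy

theorem Traj.integrableOn (h : Traj φ ε u m) :
    IntegrableOn (fun t => lagrangian φ ε u m t * Real.exp (-t / ε)) (Ioi 0) := by
  refine ((h.energy.div_const 2).add (h.potential.div_const ε)).congr
    (Eventually.of_forall fun t => ?_)
  simp only [lagrangian, Pi.add_apply]; ring

theorem Traj.cost_eq (h : Traj φ ε u m) :
    cost φ ε u m = (∫ t in Ioi 0, m t ^ 2 * Real.exp (-t / ε)) / 2
      + (∫ t in Ioi 0, (φ (u t)).toReal * Real.exp (-t / ε)) / ε := by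
  rw [← integral_div, ← integral_div, ← integral_add (h.energy.div_const 2)
    (h.potential.div_const ε)]
  refine integral_congr_ae (Eventually.of_forall fun t => ?_)
  simp only [lagrangian]; ring

theorem Traj.wed_eq (hφ : ∀ x, φ x ≠ ⊥) (hε : 0 < ε) (h : Traj φ ε u m) :
    wed φ ε u = ((cost φ ε u (fun t => (metricDeriv u t).toReal) : ℝ) : EReal) := by
  obtain ⟨h1, h2, h3, h4⟩ := energy_of_mem_admissible hε (h.mem_admissible hε)
  unfold wed
  rw [integralEReal_eq_coe (g := fun t => ε / 2 * (metricDeriv u t).toReal ^ 2 + (φ (u t)).toReal),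
    integral_expMeasure hε, cost]
  · congr 1
    refine integral_congr_ae (Eventually.of_forall fun t => ?_)
    simp only [lagrangian]; field_simp
  · refine expMeasure_absolutelyContinuous.ae_le ?_
    filter_upwards [h.finite, h4] with t ht ht4
    rw [EReal.coe_add, EReal.coe_mul, EReal.coe_toReal ht (hφ _), ← ENNReal.toReal_pow,
      EReal.coe_ennreal_toReal (ENNReal.pow_ne_top ht4.ne)]
  · rw [integrable_expMeasure_iff hε]
    refine ((h3.const_mul (ε / 2)).add h.potential).congr (Eventually.of_forall fun t => ?_)
    simp only [Pi.add_apply]; ring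

theorem Traj.metricDeriv (hε : 0 < ε) (h : Traj φ ε u m) :
    Traj φ ε u (fun t => (metricDeriv u t).toReal) := by
  obtain ⟨h1, h2, h3, h4⟩ := energy_of_mem_admissible hε (h.mem_admissible hε)
  exact ⟨h1, h2, h3, h.finite, h.potential⟩

theorem Traj.wed_le (hφ : ∀ x, φ x ≠ ⊥) (hε : 0 < ε) (h : Traj φ ε u m) :
    wed φ ε u ≤ (cost φ ε u m : EReal) := by
  rw [h.wed_eq hφ hε, EReal.coe_le_coe_iff]
  refine integral_mono_ae (h.metricDeriv hε).integrableOn h.integrableOn ?_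
  filter_upwards [metricDeriv_le_of_energy h.speed h.meas h.energy] with t ht
  have : (WED.metricDeriv u t).toReal ≤ m t := ENNReal.toReal_le_of_le_ofReal ht.2 ht.1
  simp only [lagrangian]
  gcongr

theorem Traj.value_le (hφ : ∀ x, φ x ≠ ⊥) (hε : 0 < ε) (h : Traj φ ε u m) :
    value φ ε (u 0) ≤ (cost φ ε u m : EReal) :=
  (iInf₂_le u (h.mem_admissible hε)).trans (h.wed_le hφ hε)

/-- The Hardy inequality makes the quadratic lower bound for `φ ∘ u` integrable, so the negative
part of the integrand has finite integral. An infinite positive part would then make the functional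
`⊤`; hence both parts are finite and the potential is integrable. -/
theorem traj_of_wed_ne_top (hQ : QuadBound φ ε B A p) {x : X} (h : u ∈ admissible ε x)
    (hw : wed φ ε u ≠ ⊤) : Traj φ ε u (fun t => (metricDeriv u t).toReal) := by
  have hε := hQ.eps_pos
  obtain ⟨h1, h2, h3, h4⟩ := energy_of_mem_admissible hε h
  have hcont := continuousOn_of_energy h1 h2 h3
  set d : ℝ → ℝ := fun t => B * dist (u t) (u 0) ^ 2 + (B * dist (u 0) p ^ 2 + A) with hd
  have hB := hQ.B_nonneg
  have hA := hQ.A_nonneg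
  have hd0 : ∀ t, 0 ≤ d t := fun t => by positivity
  have hdI : Integrable d (expMeasure ε) := by
    rw [integrable_expMeasure_iff hε]
    refine (((hardy_dist hε h1 h2 h3).1.const_mul B).add
      ((integrableOn_exp_neg_div hε 0).const_mul (B * dist (u 0) p ^ 2 + A))).congr
      (Eventually.of_forall fun t => ?_)
    simp only [hd, Pi.add_apply]; ring
  have hφd : ∀ t, ((-d t : ℝ) : EReal) ≤ φ (u t) := fun t => by
    refine le_trans (le_of_eq ?_) (hQ.bound (u t) (u 0))
    simp only [hd]; congr 1; ring
  set f : ℝ → EReal := fun t =>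
    ((ε / 2 : ℝ) : EReal) * ((metricDeriv u t ^ 2 : ℝ≥0∞) : EReal) + φ (u t) with hf
  have hk0 : ∀ t, (0 : EReal) ≤ ((ε / 2 : ℝ) : EReal) * ((metricDeriv u t ^ 2 : ℝ≥0∞) : EReal) :=
    fun t => mul_nonneg (by exact_mod_cast (by positivity : (0:ℝ) ≤ ε / 2)) (EReal.coe_ennreal_nonneg _)
  have hφf : ∀ t, φ (u t) ≤ f t := fun t => le_add_of_nonneg_left (hk0 t)
  have hmeasφ : AEMeasurable (fun t => φ (u t)) (expMeasure ε) :=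
    (aemeasurable_comp_of_continuousOn hQ.lsc measurableSet_Ioi
      (hcont.mono Ioi_subset_Ici_self)).mono_ac expMeasure_absolutelyContinuous
  have hmeasd : AEMeasurable (fun t => metricDeriv u t) (expMeasure ε) :=
    (aemeasurable_metricDeriv_Ici hcont).mono_ac expMeasure_absolutelyContinuous
  have hmeasf : AEMeasurable f (expMeasure ε) := by
    have hk : AEMeasurable
        (fun t => ((ε / 2 : ℝ) : EReal) * ((metricDeriv u t ^ 2 : ℝ≥0∞) : EReal))
        (expMeasure ε) := by
      have : (fun t => ((ε / 2 : ℝ) : EReal) * ((metricDeriv u t ^ 2 : ℝ≥0∞) : EReal))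
          = fun t => ((ENNReal.ofReal (ε / 2) * metricDeriv u t ^ 2 : ℝ≥0∞) : EReal) := by
        funext t
        rw [EReal.coe_ennreal_mul, EReal.coe_ennreal_ofReal, max_eq_left (by positivity)]
      rw [this]
      exact ((hmeasd.pow_const 2).const_mul _).coe_ereal_ennreal
    exact hk.add hmeasφ
  -- This must come before the positive part, because `⊤ - ⊤ = ⊥` in `EReal` would otherwise be
  -- compatible with a functional different from `⊤`.
  have hneg : ∫⁻ t, (-f t).toENNReal ∂(expMeasure ε) ≠ ∞ := by
    refine (lt_of_le_of_lt (lintegral_mono fun t => ?_) hdI.lintegral_lt_top).ne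
    have h5 : -f t ≤ ((d t : ℝ) : EReal) := by
      rw [EReal.neg_le, ← EReal.coe_neg]
      exact (hφd t).trans (hφf t)
    refine (EReal.toENNReal_le_toENNReal h5).trans (le_of_eq ?_)
    exact EReal.toENNReal_of_ne_top (EReal.coe_ne_top _)
  have hpos : ∫⁻ t, (f t).toENNReal ∂(expMeasure ε) ≠ ∞ := by
    intro htop
    apply hw
    unfold wed integralEReal
    rw [htop, ← EReal.coe_ennreal_toReal hneg]
    rfl
  have hfinf : ∀ᵐ t ∂(expMeasure ε), φ (u t) ≠ ⊤ := by
    filter_upwards [ae_lt_top' hmeasf.ereal_toENNReal hpos] with t ht htop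
    have : f t = ⊤ := top_le_iff.1 (htop ▸ hφf t)
    simp [this] at ht
  have hac : volume.restrict (Ioi (0 : ℝ)) ≪ expMeasure ε :=
    withDensity_absolutelyContinuous' (by fun_prop) (Eventually.of_forall fun t => by
      simp only [ne_eq, ENNReal.ofReal_eq_zero, not_le]; positivity)
  refine ⟨h1, h2, h3, hac.ae_le hfinf, ?_⟩
  rw [← integrable_expMeasure_iff hε]
  refine Integrable.mono' ((integrable_toReal_of_lintegral_ne_top hmeasf.ereal_toENNReal hpos).add hdI)
    hmeasφ.ereal_toReal.aestronglyMeasurable ?_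
  filter_upwards [hfinf, ae_lt_top' hmeasf.ereal_toENNReal hpos] with t ht ht2
  have h6 : -d t ≤ (φ (u t)).toReal := by
    have := hφd t
    rwa [← EReal.coe_toReal ht (hQ.ne_bot _), EReal.coe_le_coe_iff] at this
  have h7 : (φ (u t)).toReal ≤ ((f t).toENNReal).toReal := by
    have h8 : (φ (u t)).toENNReal ≤ (f t).toENNReal := EReal.toENNReal_le_toENNReal (hφf t)
    have h9 := ENNReal.toReal_mono ht2.ne h8
    refine le_trans ?_ h9
    rw [EReal.toENNReal_of_ne_top ht]
    rw [ENNReal.toReal_ofReal']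
    exact le_max_left _ _
  rw [Real.norm_eq_abs, abs_le, Pi.add_apply]
  have := hd0 t
  have : 0 ≤ ((f t).toENNReal).toReal := ENNReal.toReal_nonneg
  constructor <;> linarith

/-- By Hardy the potential costs at most `4Bε` times the kinetic integral, and `4Bε ≤ 1/4`. Half of
the kinetic integral therefore leaves a quarter. This is where the smallness of `ε` relative to `B`
enters. -/
theorem Traj.energy_le (hQ : QuadBound φ ε B A p) (h : Traj φ ε u m) :
    (∫ t in Ioi 0, m t ^ 2 * Real.exp (-t / ε)) / 4 - (B * dist (u 0) p ^ 2 + A)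
      ≤ cost φ ε u m := by
  have hε := hQ.eps_pos
  have hB := hQ.B_nonneg
  obtain ⟨h1, h2⟩ := hardy_dist hε h.speed h.meas h.energy
  rw [h.cost_eq]
  set E := ∫ t in Ioi 0, m t ^ 2 * Real.exp (-t / ε)
  have hE : 0 ≤ E := integral_nonneg fun t => by positivity
  set C := B * dist (u 0) p ^ 2 + A
  have h3 : -(B * (4 * ε ^ 2 * E)) - C * ε
      ≤ ∫ t in Ioi 0, (φ (u t)).toReal * Real.exp (-t / ε) := by
    have h4 : ∫ t in Ioi 0, (-B * (dist (u t) (u 0) ^ 2 * Real.exp (-t / ε))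
        - C * Real.exp (-t / ε)) ≤ ∫ t in Ioi 0, (φ (u t)).toReal * Real.exp (-t / ε) := by
      refine integral_mono_ae ((h1.const_mul (-B)).sub
        ((integrableOn_exp_neg_div hε 0).const_mul C)) h.potential ?_
      filter_upwards [h.finite] with t ht
      have := hQ.le_toReal (u t) (u 0) ht
      have h5 := mul_le_mul_of_nonneg_right this (Real.exp_pos (-t / ε)).le
      refine le_trans (le_of_eq ?_) h5
      ring
    rw [integral_sub (h1.const_mul (-B)) ((integrableOn_exp_neg_div hε 0).const_mul C),
      integral_const_mul, integral_const_mul, integral_exp_neg_div_Ioi hε] at h4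
    have := mul_le_mul_of_nonneg_left h2 hB
    linarith
  have h5 : B * (4 * ε ^ 2 * E) / ε ≤ E / 4 := by
    have : B * (4 * ε ^ 2 * E) / ε = B * (4 * ε * E) := by field_simp
    rw [this]
    refine (mul_le_mul_of_nonneg_right hQ.B_le (by positivity)).trans (le_of_eq ?_)
    field_simp; norm_num
  have h6 : (-(B * (4 * ε ^ 2 * E)) - C * ε) / ε
      ≤ (∫ t in Ioi 0, (φ (u t)).toReal * Real.exp (-t / ε)) / ε := by gcongr
  have h7 : (-(B * (4 * ε ^ 2 * E)) - C * ε) / ε = - (B * (4 * ε ^ 2 * E) / ε) - C := by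
    field_simp
  linarith

theorem exists_traj_of_value_lt (hQ : QuadBound φ ε B A p) {x : X} {c : ℝ}
    (h : value φ ε x < (c : EReal)) : ∃ u m, Traj φ ε u m ∧ u 0 = x ∧ cost φ ε u m < c := by
  unfold value at h
  simp only [iInf_lt_iff] at h
  obtain ⟨u, hu, hlt⟩ := h
  have hT := traj_of_wed_ne_top hQ hu (hlt.trans (EReal.coe_lt_top c)).ne
  refine ⟨u, _, hT, hu.2.1, ?_⟩
  rwa [hT.wed_eq hQ.ne_bot hQ.eps_pos, EReal.coe_lt_coe_iff] at hlt

theorem value_ge (hQ : QuadBound φ ε B A p) (x : X) :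
    ((-(B * dist x p ^ 2 + A) : ℝ) : EReal) ≤ value φ ε x := by
  by_contra hcon
  obtain ⟨u, m, hT, rfl, hlt⟩ := exists_traj_of_value_lt hQ (not_le.1 hcon)
  have := hT.energy_le hQ
  have : 0 ≤ ∫ t in Ioi 0, m t ^ 2 * Real.exp (-t / ε) := integral_nonneg fun t => by positivity
  linarith

theorem value_ne_bot (hQ : QuadBound φ ε B A p) (x : X) : value φ ε x ≠ ⊥ := by
  intro hx
  have := value_ge hQ x
  rw [hx, le_bot_iff] at this
  exact EReal.coe_ne_bot _ this

/-- The constant trajectory is a competitor, and its cost is `φ x` because the weight has total mass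
one. -/
theorem value_le_self (hQ : QuadBound φ ε B A p) (x : X) : value φ ε x ≤ φ x := by
  have hε := hQ.eps_pos
  by_cases hx : φ x = ⊤
  · simp [hx]
  have hT : Traj φ ε (fun _ => x) (fun _ => 0) := by
    refine ⟨fun s _ t _ _ => by simp, aestronglyMeasurable_const, by simp,
      Eventually.of_forall fun _ => hx, ?_⟩
    exact (integrableOn_exp_neg_div hε 0).const_mul _
  refine (hT.value_le hQ.ne_bot hε).trans ?_
  rw [hT.cost_eq, integral_const_mul (φ x).toReal, integral_exp_neg_div_Ioi hε,
    mul_div_cancel_right₀ _ hε.ne']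
  simp [EReal.coe_toReal hx (hQ.ne_bot x)]

end Value

/-! ### Dynamic programming -/

section Translation

theorem measurePreserving_const_add_Ioi (c a : ℝ) :
    MeasurePreserving (fun t => c + t) (volume.restrict (Ioi a)) (volume.restrict (Ioi (c + a))) := by
  have := (measurePreserving_add_left (volume : Measure ℝ) c).restrict_preimage
    (measurableSet_Ioi (a := c + a))
  have h : (fun t => c + t) ⁻¹' Ioi (c + a) = Ioi a := by ext t; simp
  rwa [h] at this

theorem integrableOn_const_add_Ioi {f : ℝ → ℝ} {c a : ℝ} :
    IntegrableOn (fun t => f (c + t)) (Ioi a) ↔ IntegrableOn f (Ioi (c + a)) :=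
  (measurePreserving_const_add_Ioi c a).integrable_comp_emb (measurableEmbedding_addLeft c)

theorem integral_const_add_Ioi (f : ℝ → ℝ) (c a : ℝ) :
    ∫ t in Ioi a, f (c + t) = ∫ t in Ioi (c + a), f t :=
  (measurePreserving_const_add_Ioi c a).integral_comp (measurableEmbedding_addLeft c) f

theorem ae_const_add_Ioi {P : ℝ → Prop} {c a : ℝ}
    (h : ∀ᵐ t ∂(volume.restrict (Ioi (c + a))), P t) :
    ∀ᵐ t ∂(volume.restrict (Ioi a)), P (c + t) :=
  (measurePreserving_const_add_Ioi c a).quasiMeasurePreserving.ae h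

end Translation

section Dynamic

variable {X : Type*} [MetricSpace X] {φ : X → EReal} {ε B A : ℝ} {p : X} {u : ℝ → X} {m : ℝ → ℝ}

theorem SpeedBound.comp_const_add {I : Set ℝ} (h : SpeedBound u m I) (c : ℝ) :
    SpeedBound (fun t => u (c + t)) (fun t => m (c + t)) ((fun t => c + t) ⁻¹' I) := by
  intro s hs t ht hst
  have := h (c + s) hs (c + t) ht (by linarith)
  simpa [intervalIntegral.integral_comp_add_left (fun r => m r) c] using this

theorem Traj.shift (h : Traj φ ε u m) {T : ℝ} (hT : 0 ≤ T) :
    Traj φ ε (fun t => u (T + t)) (fun t => m (T + t)) := by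
  have hsub : Ioi (T + 0) ⊆ Ioi 0 := by rw [add_zero]; exact Ioi_subset_Ioi hT
  have hexp : ∀ t, Real.exp (-t / ε) = Real.exp (T / ε) * Real.exp (-(T + t) / ε) := by
    intro t; rw [← Real.exp_add]; congr 1; ring
  refine ⟨(h.speed.comp_const_add T).mono fun t ht => ?_, ?_, ?_, ?_, ?_⟩
  · exact add_nonneg hT ht
  · exact (h.meas.mono_set hsub).comp_measurePreserving (measurePreserving_const_add_Ioi T 0)
  · have := (integrableOn_const_add_Ioi (a := 0)).2 (h.energy.mono_set hsub)
    refine (this.const_mul (Real.exp (T / ε))).congr (Eventually.of_forall fun t => ?_)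
    simp only [hexp t]; ring
  · exact ae_const_add_Ioi (P := fun t => φ (u t) ≠ ⊤) (ae_restrict_of_ae_restrict_of_subset hsub h.finite)
  · have := (integrableOn_const_add_Ioi (a := 0)).2 (h.potential.mono_set hsub)
    refine (this.const_mul (Real.exp (T / ε))).congr (Eventually.of_forall fun t => ?_)
    simp only [hexp t]; ring

theorem cost_shift {Y : Type*} (φ : Y → EReal) (ε : ℝ) (u : ℝ → Y) (m : ℝ → ℝ) (T : ℝ) :
    Real.exp (-T / ε) * cost φ ε (fun t => u (T + t)) (fun t => m (T + t))
      = ∫ t in Ioi T, lagrangian φ ε u m t * Real.exp (-t / ε) := by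
  have := integral_const_add_Ioi (fun t => lagrangian φ ε u m t * Real.exp (-t / ε)) T 0
  rw [add_zero] at this
  rw [← this, cost, ← integral_const_mul]
  refine integral_congr_ae (Eventually.of_forall fun t => ?_)
  have hexp : Real.exp (-(T + t) / ε) = Real.exp (-T / ε) * Real.exp (-t / ε) := by
    rw [← Real.exp_add]; congr 1; ring
  simp only [lagrangian, hexp]; ring

theorem Traj.cost_eq_add (h : Traj φ ε u m) {T : ℝ} (hT : 0 ≤ T) :
    cost φ ε u m = (∫ t in 0..T, lagrangian φ ε u m t * Real.exp (-t / ε))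
      + Real.exp (-T / ε) * cost φ ε (fun t => u (T + t)) (fun t => m (T + t)) := by
  rw [cost_shift, cost, intervalIntegral.integral_of_le hT, ← Ioc_union_Ioi_eq_Ioi hT]
  have hi := h.integrableOn
  exact setIntegral_union (Ioc_disjoint_Ioi le_rfl) measurableSet_Ioi
    (hi.mono_set Ioc_subset_Ioi_self) (hi.mono_set (Ioi_subset_Ioi hT))

/-- A finite piece of trajectory, parametrised by `[0,T]`, with a bound `m` for its speed. -/
structure Segment (φ : X → EReal) (w : ℝ → X) (m : ℝ → ℝ) (T : ℝ) : Prop where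
  nonneg : 0 ≤ T
  speed : SpeedBound w m (Icc 0 T)
  integrable : IntervalIntegrable m volume 0 T
  sq_integrable : IntervalIntegrable (fun t => m t ^ 2) volume 0 T
  finite : ∀ᵐ t ∂(volume.restrict (Ioc 0 T)), φ (w t) ≠ ⊤
  potential : IntervalIntegrable (fun t => (φ (w t)).toReal) volume 0 T

theorem Segment.lagrangian_integrable {w : ℝ → X} {T : ℝ} (h : Segment φ w m T) :
    IntervalIntegrable (fun t => lagrangian φ ε w m t * Real.exp (-t / ε)) volume 0 T :=
  ((h.sq_integrable.div_const 2).add (h.potential.div_const ε)).mul_continuousOn (by fun_prop)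

theorem Traj.segment (h : Traj φ ε u m) {T : ℝ} (hT : 0 ≤ T) : Segment φ u m T := by
  refine ⟨hT, h.speed.mono fun _ hx => hx.1, intervalIntegrable_of_energy h.meas h.energy le_rfl hT,
    intervalIntegrable_sq_of_energy h.energy le_rfl hT,
    ae_restrict_of_ae_restrict_of_subset Ioc_subset_Ioi_self h.finite,
    intervalIntegrable_of_mul_exp (ε := ε) ?_⟩
  rw [intervalIntegrable_iff_integrableOn_Ioc_of_le hT]
  exact h.potential.mono_set Ioc_subset_Ioi_self

/-- Concatenation of a curve on `[0,T]` with another one. -/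
def concat {Y : Type*} (T : ℝ) (w z : ℝ → Y) (t : ℝ) : Y := if t ≤ T then w t else z (-T + t)

theorem concat_of_mem_Ioc {Y : Type*} {T t : ℝ} (w z : ℝ → Y) (ht : t ∈ Ioc 0 T) :
    concat T w z t = w t := if_pos ht.2

theorem concat_of_mem_Ioi {Y : Type*} {T t : ℝ} (w z : ℝ → Y) (ht : t ∈ Ioi T) :
    concat T w z t = z (-T + t) := if_neg (not_le.2 ht)

theorem SpeedBound.concat {w z : ℝ → X} {m n : ℝ → ℝ} {T : ℝ}
    (hw : SpeedBound w m (Icc 0 T)) (hm : IntervalIntegrable m volume 0 T)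
    (hz : SpeedBound z n (Ici 0)) (hn : ∀ b, 0 ≤ b → IntervalIntegrable n volume 0 b)
    (hwz : z 0 = w T) : SpeedBound (concat T w z) (concat T m n) (Ici 0) := by
  have hl : ∀ s t, t ≤ T → s ≤ t → ∫ r in s..t, WED.concat T m n r = ∫ r in s..t, m r := by
    intro s t ht hst
    refine intervalIntegral.integral_congr fun r hr => ?_
    rw [uIcc_of_le hst] at hr
    exact if_pos (hr.2.trans ht)
  have hr : ∀ s t, T ≤ s → s ≤ t →
      ∫ r in s..t, WED.concat T m n r = ∫ r in (-T + s)..(-T + t), n r := by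
    intro s t hs hst
    rw [← intervalIntegral.integral_comp_add_left (fun r => n r)]
    refine intervalIntegral.integral_congr_ae (Eventually.of_forall fun r hr => ?_)
    rw [uIoc_of_le hst] at hr
    exact if_neg (not_le.2 (hs.trans_lt hr.1))
  intro s hs t ht hst
  have hs0 : 0 ≤ s := hs
  rcases le_total t T with htT | htT
  · rw [hl s t htT hst]
    simp only [WED.concat, if_pos htT, if_pos (hst.trans htT)]
    exact hw s ⟨hs, hst.trans htT⟩ t ⟨ht, htT⟩ hst
  have hzt : WED.concat T w z t = z (-T + t) := by
    rcases htT.eq_or_lt with rfl | hlt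
    · simp [WED.concat, hwz]
    · exact if_neg (not_le.2 hlt)
  rcases le_total s T with hsT | hsT
  · have h1 := hw s ⟨hs, hsT⟩ T ⟨hs0.trans hsT, le_rfl⟩ hsT
    have h2 := hz 0 self_mem_Ici (-T + t) (by simpa using htT) (by linarith)
    have hi1 : IntervalIntegrable (WED.concat T m n) volume s T := by
      refine (hm.mono_set (c := s) (d := T) ?_).congr fun r hr => ?_
      · rw [uIcc_of_le hsT, uIcc_of_le (hs0.trans hsT)]; exact Icc_subset_Icc_left hs
      · rw [uIoc_of_le hsT] at hr
        exact (if_pos hr.2).symm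
    have hi2 : IntervalIntegrable (WED.concat T m n) volume T t := by
      have := (hn (-T + t) (by linarith)).comp_add_left (-T)
      simp only [sub_neg_eq_add, zero_add, neg_add_cancel_comm] at this
      refine this.congr fun r hr => ?_
      rw [uIoc_of_le htT] at hr
      exact (if_neg (not_le.2 hr.1)).symm
    rw [← intervalIntegral.integral_add_adjacent_intervals hi1 hi2, hl s T le_rfl hsT,
      hr T t le_rfl htT, hzt, neg_add_cancel]
    refine (dist_triangle _ (w T) _).trans (add_le_add ?_ ?_)
    · simpa only [WED.concat, if_pos hsT] using h1
    · rw [← hwz]; exact h2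
  · have hzs : WED.concat T w z s = z (-T + s) := by
      rcases hsT.eq_or_lt with rfl | hlt
      · simp [WED.concat, hwz]
      · exact if_neg (not_le.2 hlt)
    rw [hr s t hsT hst, hzs, hzt]
    exact hz _ (by simpa using hsT) _ (by simpa using htT) (by linarith)

theorem Segment.concat {w z : ℝ → X} {n : ℝ → ℝ} {T : ℝ} (hw : Segment φ w m T)
    (hz : Traj φ ε z n) (hwz : z 0 = w T) : Traj φ ε (concat T w z) (concat T m n) := by
  have hT := hw.nonneg
  have hexp : ∀ t, Real.exp (-(t) / ε) = Real.exp (-T / ε) * Real.exp (-(-T + t) / ε) := by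
    intro t; rw [← Real.exp_add]; congr 1; ring
  have hMP := measurePreserving_const_add_Ioi (-T) T
  rw [neg_add_cancel] at hMP
  refine ⟨hw.speed.concat hw.integrable hz.speed
    (fun b hb => intervalIntegrable_of_energy hz.meas hz.energy le_rfl hb) hwz, ?_, ?_, ?_, ?_⟩
  · rw [← Ioc_union_Ioi_eq_Ioi hT, aestronglyMeasurable_union_iff]
    constructor
    · refine hw.integrable.1.aestronglyMeasurable.congr ?_
      filter_upwards [ae_restrict_mem measurableSet_Ioc] with t ht
      exact (concat_of_mem_Ioc m n ht).symm
    · refine (hz.meas.comp_measurePreserving hMP).congr ?_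
      filter_upwards [ae_restrict_mem measurableSet_Ioi] with t ht
      exact (concat_of_mem_Ioi m n ht).symm
  · rw [← Ioc_union_Ioi_eq_Ioi hT, integrableOn_union]
    constructor
    · have := hw.sq_integrable.mul_continuousOn (g := fun t => Real.exp (-t / ε)) (by fun_prop)
      refine IntegrableOn.congr_fun this.1 (fun t ht => ?_) measurableSet_Ioc
      simp only [concat_of_mem_Ioc m n ht]
    · have h1 := integrableOn_const_add_Ioi (f := fun t => n t ^ 2 * Real.exp (-t / ε))
        (c := -T) (a := T)
      rw [neg_add_cancel] at h1
      refine IntegrableOn.congr_fun ((h1.2 hz.energy).const_mul (Real.exp (-T / ε)))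
        (fun t ht => ?_) measurableSet_Ioi
      simp only [concat_of_mem_Ioi m n ht, hexp t]; ring
  · rw [← Ioc_union_Ioi_eq_Ioi hT, ae_restrict_union_iff]
    constructor
    · filter_upwards [hw.finite, ae_restrict_mem measurableSet_Ioc] with t ht htI
      rwa [concat_of_mem_Ioc w z htI]
    · filter_upwards [hMP.quasiMeasurePreserving.ae hz.finite, ae_restrict_mem measurableSet_Ioi]
        with t ht htI
      rwa [concat_of_mem_Ioi w z htI]
  · rw [← Ioc_union_Ioi_eq_Ioi hT, integrableOn_union]
    constructor
    · have := hw.potential.mul_continuousOn (g := fun t => Real.exp (-t / ε)) (by fun_prop)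
      refine IntegrableOn.congr_fun this.1 (fun t ht => ?_) measurableSet_Ioc
      simp only [concat_of_mem_Ioc w z ht]
    · have h1 := integrableOn_const_add_Ioi
        (f := fun t => (φ (z t)).toReal * Real.exp (-t / ε)) (c := -T) (a := T)
      rw [neg_add_cancel] at h1
      refine IntegrableOn.congr_fun ((h1.2 hz.potential).const_mul (Real.exp (-T / ε)))
        (fun t ht => ?_) measurableSet_Ioi
      simp only [concat_of_mem_Ioi w z ht, hexp t]; ring

theorem Segment.cost_concat {w z : ℝ → X} {n : ℝ → ℝ} {T : ℝ} (hw : Segment φ w m T)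
    (hz : Traj φ ε z n) (hwz : z 0 = w T) :
    cost φ ε (WED.concat T w z) (WED.concat T m n)
      = (∫ t in 0..T, lagrangian φ ε w m t * Real.exp (-t / ε))
        + Real.exp (-T / ε) * cost φ ε z n := by
  rw [(hw.concat hz hwz).cost_eq_add hw.nonneg]
  congr 1
  · refine intervalIntegral.integral_congr_ae (Eventually.of_forall fun t ht => ?_)
    rw [uIoc_of_le hw.nonneg] at ht
    simp only [lagrangian, WED.concat, if_pos ht.2]
  · congr 1
    refine setIntegral_congr_fun measurableSet_Ioi fun t ht => ?_
    have : ¬ T + t ≤ T := by simpa using mem_Ioi.1 ht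
    simp only [lagrangian, WED.concat, if_neg this, neg_add_cancel_left]

/-- First half of dynamic programming: follow `w` and then an almost optimal trajectory from `w T`
of cost below `c`. Letting `c` decrease to the value at `w T` avoids the existence of minimizers. -/
theorem Segment.value_le {w : ℝ → X} {T : ℝ} (hQ : QuadBound φ ε B A p) (hw : Segment φ w m T)
    (hT : value φ ε (w T) ≠ ⊤) :
    value φ ε (w 0) ≠ ⊤ ∧ (value φ ε (w 0)).toReal
      ≤ (∫ t in 0..T, lagrangian φ ε w m t * Real.exp (-t / ε))
        + Real.exp (-T / ε) * (value φ ε (w T)).toReal := by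
  set I := ∫ t in 0..T, lagrangian φ ε w m t * Real.exp (-t / ε)
  have key : ∀ c : ℝ, (value φ ε (w T)).toReal < c →
      value φ ε (w 0) ≤ ((I + Real.exp (-T / ε) * c : ℝ) : EReal) := by
    intro c hc
    have hlt : value φ ε (w T) < (c : EReal) := by
      rwa [← EReal.coe_toReal hT (value_ne_bot hQ _), EReal.coe_lt_coe_iff]
    obtain ⟨z, n, hz, hz0, hcost⟩ := exists_traj_of_value_lt hQ hlt
    have h0 : WED.concat T w z 0 = w 0 := if_pos hw.nonneg
    have := (hw.concat hz hz0).value_le hQ.ne_bot hQ.eps_pos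
    rw [h0, hw.cost_concat hz hz0] at this
    refine this.trans (EReal.coe_le_coe_iff.2 ?_)
    gcongr
  have hne : value φ ε (w 0) ≠ ⊤ :=
    ((key _ (lt_add_one _)).trans_lt (EReal.coe_lt_top _)).ne
  refine ⟨hne, ?_⟩
  have key2 : ∀ c : ℝ, (value φ ε (w T)).toReal < c →
      (value φ ε (w 0)).toReal ≤ I + Real.exp (-T / ε) * c := by
    intro c hc
    have := key c hc
    rwa [← EReal.coe_toReal hne (value_ne_bot hQ _), EReal.coe_le_coe_iff] at this
  have hcont : Tendsto (fun c : ℝ => I + Real.exp (-T / ε) * c)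
      (𝓝[>] (value φ ε (w T)).toReal) (𝓝 (I + Real.exp (-T / ε) * (value φ ε (w T)).toReal)) :=
    (Continuous.tendsto (by fun_prop) _).mono_left nhdsWithin_le_nhds
  exact ge_of_tendsto hcont (eventually_nhdsWithin_of_forall key2)

/-- Second half of dynamic programming: the tail of a trajectory is a competitor from `u T`. In
particular the value is finite at every point of a trajectory of finite cost. -/
theorem Traj.value_shift_le (hQ : QuadBound φ ε B A p) (h : Traj φ ε u m) {T : ℝ} (hT : 0 ≤ T) :
    value φ ε (u T) ≠ ⊤ ∧ (∫ t in 0..T, lagrangian φ ε u m t * Real.exp (-t / ε))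
        + Real.exp (-T / ε) * (value φ ε (u T)).toReal ≤ cost φ ε u m := by
  have h1 := (h.shift hT).value_le hQ.ne_bot hQ.eps_pos
  simp only [add_zero] at h1
  have h2 : value φ ε (u T) ≠ ⊤ := (h1.trans_lt (EReal.coe_lt_top _)).ne
  refine ⟨h2, ?_⟩
  rw [← EReal.coe_toReal h2 (value_ne_bot hQ _), EReal.coe_le_coe_iff] at h1
  rw [h.cost_eq_add hT]
  gcongr

end Dynamic

/-! ### The value function along curves -/

section Along

variable {X : Type*} [MetricSpace X] {φ : X → EReal} {ε B A : ℝ} {p : X} {w : ℝ → X} {m : ℝ → ℝ}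
  {L : ℝ}

theorem ae_restrict_Ioc_const_add {P : ℝ → Prop} {a b c : ℝ}
    (h : ∀ᵐ t ∂(volume.restrict (Ioc (c + a) (c + b))), P t) :
    ∀ᵐ t ∂(volume.restrict (Ioc a b)), P (c + t) := by
  have := (measurePreserving_add_left (volume : Measure ℝ) c).restrict_preimage
    (measurableSet_Ioc (a := c + a) (b := c + b))
  have h' : (fun t => c + t) ⁻¹' Ioc (c + a) (c + b) = Ioc a b := by ext t; simp
  rw [h'] at this
  exact this.quasiMeasurePreserving.ae h

theorem Segment.sub (h : Segment φ w m L) {a b : ℝ} (ha : 0 ≤ a) (hab : a ≤ b) (hb : b ≤ L) :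
    Segment φ (fun t => w (a + t)) (fun t => m (a + t)) (b - a) := by
  have hi : ∀ {f : ℝ → ℝ}, IntervalIntegrable f volume 0 L →
      IntervalIntegrable (fun t => f (a + t)) volume 0 (b - a) := by
    intro f hf
    have h1 : IntervalIntegrable f volume a b := hf.mono_set (by
      rw [uIcc_of_le hab, uIcc_of_le h.nonneg]; exact Icc_subset_Icc ha hb)
    simpa using h1.comp_add_left a
  refine ⟨by linarith, (h.speed.comp_const_add a).mono fun t ht => ?_, hi h.integrable,
    hi h.sq_integrable, ?_, hi h.potential⟩
  · exact ⟨by linarith [ht.1], by linarith [ht.2]⟩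
  · refine ae_restrict_Ioc_const_add (P := fun t => φ (w t) ≠ ⊤)
      (ae_restrict_of_ae_restrict_of_subset (Ioc_subset_Ioc ?_ ?_) h.finite) <;> linarith

theorem ae_restrict_Ioc_const_sub {P : ℝ → Prop}
    (h : ∀ᵐ t ∂(volume.restrict (Ioc 0 L)), P t) :
    ∀ᵐ t ∂(volume.restrict (Ioc 0 L)), P (L - t) := by
  -- The reflection maps `Ioc` to `Ico`; the open interval is invariant and differs by a null set.
  rw [← restrict_Ioo_eq_restrict_Ioc] at h ⊢
  have := (Measure.measurePreserving_sub_left (volume : Measure ℝ) L).restrict_preimage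
    (measurableSet_Ioo (a := 0) (b := L))
  have h' : (fun t => L - t) ⁻¹' Ioo 0 L = Ioo 0 L := by ext t; simp [and_comm]
  rw [h'] at this
  exact this.quasiMeasurePreserving.ae h

theorem Segment.reverse (h : Segment φ w m L) :
    Segment φ (fun t => w (L - t)) (fun t => m (L - t)) L := by
  have hi : ∀ {f : ℝ → ℝ}, IntervalIntegrable f volume 0 L →
      IntervalIntegrable (fun t => f (L - t)) volume 0 L := by
    intro f hf
    simpa using (hf.comp_sub_left L).symm
  refine ⟨h.nonneg, fun s hs t ht hst => ?_, hi h.integrable, hi h.sq_integrable,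
    ae_restrict_Ioc_const_sub (P := fun t => φ (w t) ≠ ⊤) h.finite, hi h.potential⟩
  have := h.speed (L - t) ⟨by linarith [ht.2], by linarith [ht.1]⟩ (L - s)
    ⟨by linarith [hs.2], by linarith [hs.1]⟩ (by linarith)
  rw [dist_comm, intervalIntegral.integral_comp_sub_left (fun r => m r)]
  exact this

theorem Segment.exp_mul_value_le (hQ : QuadBound φ ε B A p) (h : Segment φ w m L) {a b : ℝ}
    (ha : 0 ≤ a) (hab : a ≤ b) (hb : b ≤ L) (hT : value φ ε (w b) ≠ ⊤) :
    value φ ε (w a) ≠ ⊤ ∧ Real.exp (-a / ε) * (value φ ε (w a)).toReal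
      ≤ (∫ t in a..b, lagrangian φ ε w m t * Real.exp (-t / ε))
        + Real.exp (-b / ε) * (value φ ε (w b)).toReal := by
  have h1 := (h.sub ha hab hb).value_le hQ (by simpa using hT)
  simp only [add_zero, add_sub_cancel] at h1
  refine ⟨h1.1, ?_⟩
  have h2 := mul_le_mul_of_nonneg_left h1.2 (Real.exp_pos (-a / ε)).le
  refine h2.trans (le_of_eq ?_)
  rw [mul_add, ← mul_assoc, ← Real.exp_add, ← intervalIntegral.integral_const_mul]
  congr 1
  · have h3 := intervalIntegral.integral_comp_add_left (a := 0) (b := b - a)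
      (fun t => lagrangian φ ε w m t * Real.exp (-t / ε)) a
    rw [add_zero, add_sub_cancel] at h3
    rw [← h3]
    refine intervalIntegral.integral_congr fun t _ => ?_
    have : Real.exp (-(a + t) / ε) = Real.exp (-a / ε) * Real.exp (-t / ε) := by
      rw [← Real.exp_add]; congr 1; ring
    simp only [lagrangian, this]; ring
  · congr 2; ring

/-- Along a curve whose speed `m` satisfies `φ - V ≤ ε m² / 2`, the value function decreases by at
most the integral of `m²`. -/
theorem Segment.value_le_add_integral_sq (hQ : QuadBound φ ε B A p) (h : Segment φ w m L)
    (hT : value φ ε (w L) ≠ ⊤)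
    (hfast : ∀ᵐ t ∂(volume.restrict (Ioc 0 L)),
      (φ (w t)).toReal - (value φ ε (w t)).toReal ≤ ε * m t ^ 2 / 2) :
    value φ ε (w 0) ≠ ⊤ ∧
      (value φ ε (w 0)).toReal ≤ (value φ ε (w L)).toReal + ∫ t in 0..L, m t ^ 2 := by
  have hε := hQ.eps_pos
  have hL := h.nonneg
  set ω : ℝ → ℝ := fun t => (value φ ε (w t)).toReal with hω
  have hV : ∀ a ∈ Icc 0 L, Real.exp (-a / ε) * ω a
      ≤ (∫ t in a..L, lagrangian φ ε w m t * Real.exp (-t / ε)) + Real.exp (-L / ε) * ω L :=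
    fun a ha => (h.exp_mul_value_le hQ ha.1 ha.2 le_rfl hT).2
  refine ⟨(h.exp_mul_value_le hQ le_rfl hL le_rfl hT).1, ?_⟩
  set κ : ℝ := 1 / ε with hκ
  have hexp : ∀ t, Real.exp (-t / ε) = Real.exp (-κ * t) := fun t => by
    congr 1; rw [hκ]; field_simp
  have hsub : ∀ {f : ℝ → ℝ}, IntervalIntegrable f volume 0 L → ∀ a ∈ Icc 0 L,
      IntervalIntegrable f volume a L := fun hf a ha => hf.mono_set (by
        rw [uIcc_of_le ha.2, uIcc_of_le hL]; exact Icc_subset_Icc_left ha.1)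
  set H : ℝ → ℝ := fun a => ∫ t in a..L, m t ^ 2 with hH
  have hHnn : ∀ a ∈ Icc 0 L, 0 ≤ H a := fun a ha =>
    intervalIntegral.integral_nonneg ha.2 fun _ _ => sq_nonneg _
  -- The claim is `D 0 ≤ 0`. Nothing is known about the regularity of `V ∘ w`, so a differential
  -- inequality is not available. Instead, the supremum `S` of `D` is shown to satisfy `S ≤ (1 - exp
  -- (-L/ε)) S`.
  set D : ℝ → ℝ := fun a => ω a - ω L - H a with hD
  have hli : IntervalIntegrable (fun t => lagrangian φ ε w m t * Real.exp (-t / ε)) volume 0 L :=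
    h.lagrangian_integrable
  -- Dynamic programming from `a` to `L` bounds `V (w a)` by a function continuous in `a`.
  have hbdd : BddAbove (D '' Icc 0 L) := by
    have hcont : ContinuousOn (fun a => ∫ t in a..L, lagrangian φ ε w m t * Real.exp (-t / ε))
        (Icc 0 L) := by
      have := (hli.absolutelyContinuousOnInterval_intervalIntegral (c := L)
        right_mem_uIcc).continuousOn
      rw [uIcc_of_le hL] at this
      refine this.neg.congr fun a _ => ?_
      exact intervalIntegral.integral_symm (f := fun t => lagrangian φ ε w m t * Real.exp (-t / ε))
        (μ := volume) L a
    have hcont2 : ContinuousOn (fun a => Real.exp (a / ε) *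
        ((∫ t in a..L, lagrangian φ ε w m t * Real.exp (-t / ε)) + Real.exp (-L / ε) * ω L) - ω L)
        (Icc 0 L) := by fun_prop
    obtain ⟨C, hC⟩ := isCompact_Icc.bddAbove_image hcont2
    refine ⟨C, ?_⟩
    rintro _ ⟨a, ha, rfl⟩
    refine le_trans ?_ (hC ⟨a, ha, rfl⟩)
    have h1 := mul_le_mul_of_nonneg_left (hV a ha) (Real.exp_pos (a / ε)).le
    rw [← mul_assoc, ← Real.exp_add, neg_div, add_neg_cancel, Real.exp_zero, one_mul] at h1
    have := hHnn a ha
    simp only [hD]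
    linarith
  set S := sSup (D '' Icc 0 L) with hS
  have hDS : ∀ a ∈ Icc 0 L, D a ≤ S := fun a ha => le_csSup hbdd ⟨a, ha, rfl⟩
  have hS0 : 0 ≤ S := by
    have := hDS L ⟨hL, le_rfl⟩
    simpa [hD, hH] using this
  have key : ∀ a ∈ Icc 0 L, D a ≤ (1 - Real.exp (-L / ε)) * S := by
    intro a ha
    have hsqa := hsub h.sq_integrable a ha
    have hprim : ContinuousOn (fun t => ∫ r in a..t, m r ^ 2) (uIcc a L) :=
      (hsqa.absolutelyContinuousOnInterval_intervalIntegral (c := a) left_mem_uIcc).continuousOn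
    have hint1 : IntervalIntegrable (fun t => Real.exp (-κ * t) * m t ^ 2) volume a L :=
      hsqa.continuousOn_mul (by fun_prop)
    have hint2 : IntervalIntegrable (fun t => κ * Real.exp (-κ * t) * ∫ r in a..t, m r ^ 2)
        volume a L := ContinuousOn.intervalIntegrable (by fun_prop)
    have hint3 : IntervalIntegrable (fun t => (ω L + S + H a) * (κ * Real.exp (-κ * t))) volume a L :=
      ContinuousOn.intervalIntegrable (by fun_prop)
    -- The speed hypothesis gives `m²/2 + φ/ε ≤ m² + V/ε`, and the definition of `S` gives `V(w t) ≤
    -- V(w L) + S + H t` with `H t = H a - ∫_a^t m²`. After integrating the primitive by parts, the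
    -- weighted integrals of `m²` cancel.
    have h1 : ∫ t in a..L, lagrangian φ ε w m t * Real.exp (-t / ε)
        ≤ ∫ t in a..L, (Real.exp (-κ * t) * m t ^ 2 + (ω L + S + H a) * (κ * Real.exp (-κ * t))
          - κ * Real.exp (-κ * t) * ∫ r in a..t, m r ^ 2) := by
      refine intervalIntegral.integral_mono_ae_restrict ha.2 (hsub hli a ha)
        ((hint1.add hint3).sub hint2) ?_
      rw [← restrict_Ioc_eq_restrict_Icc]
      filter_upwards [ae_restrict_of_ae_restrict_of_subset (Ioc_subset_Ioc_left ha.1) hfast,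
        ae_restrict_mem measurableSet_Ioc] with t ht htI
      have h2 := hDS t ⟨ha.1.trans htI.1.le, htI.2⟩
      have hsplit : (∫ r in a..t, m r ^ 2) + H t = H a :=
        intervalIntegral.integral_add_adjacent_intervals
          (hsqa.mono_set (by rw [uIcc_of_le htI.1.le, uIcc_of_le ha.2]; exact Icc_subset_Icc_right htI.2))
          (hsqa.mono_set (by rw [uIcc_of_le htI.2, uIcc_of_le ha.2]; exact Icc_subset_Icc_left htI.1.le))
      simp only [hD] at h2
      have h3 : lagrangian φ ε w m t
          ≤ m t ^ 2 + κ * (ω L + S + H a - ∫ r in a..t, m r ^ 2) := by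
        have h4 : lagrangian φ ε w m t ≤ m t ^ 2 + κ * ω t := by
          have h5 : (φ (w t)).toReal / ε ≤ (ε * m t ^ 2 / 2 + ω t) / ε := by
            gcongr; simp only [hω]; linarith
          have h6 : (ε * m t ^ 2 / 2 + ω t) / ε = m t ^ 2 / 2 + κ * ω t := by
            rw [hκ]; field_simp
          simp only [lagrangian]; linarith
        have hκ0 : 0 ≤ κ := by positivity
        refine h4.trans (add_le_add le_rfl (mul_le_mul_of_nonneg_left ?_ hκ0))
        linarith
      have h7 := mul_le_mul_of_nonneg_right h3 (Real.exp_pos (-κ * t)).le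
      rw [hexp]
      refine h7.trans (le_of_eq ?_)
      ring
    rw [intervalIntegral.integral_sub (hint1.add hint3) hint2,
      intervalIntegral.integral_add hint1 hint3, integral_exp_mul_primitive hsqa,
      intervalIntegral.integral_const_mul] at h1
    have h8 : ∫ t in a..L, κ * Real.exp (-κ * t) = Real.exp (-κ * a) - Real.exp (-κ * L) := by
      have hd : ∀ t, HasDerivAt (fun t => -Real.exp (-κ * t)) (κ * Real.exp (-κ * t)) t := by
        intro t
        refine (((hasDerivAt_id' t).const_mul (-κ)).exp.fun_neg).congr_deriv ?_
        ring
      rw [intervalIntegral.integral_eq_sub_of_hasDerivAt (fun t _ => hd t)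
        (Continuous.intervalIntegrable (by fun_prop) _ _)]
      ring
    rw [h8] at h1
    have h9 := hV a ha
    rw [hexp, hexp] at h9
    have h10 : Real.exp (-κ * a) * D a ≤ (Real.exp (-κ * a) - Real.exp (-κ * L)) * S := by
      simp only [hD]
      change ∫ t in a..L, lagrangian φ ε w m t * Real.exp (-t / ε) ≤ _ + _ -
        (_ - Real.exp (-κ * L) * H a) at h1
      linarith
    have h11 : Real.exp (-κ * L) ≥ Real.exp (-κ * a) * Real.exp (-κ * L) := by
      have : Real.exp (-κ * a) ≤ 1 := by
        rw [Real.exp_le_one_iff]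
        have : 0 ≤ κ * a := mul_nonneg (by positivity) ha.1
        linarith
      nlinarith [Real.exp_pos (-κ * L)]
    rw [hexp]
    have h12 : Real.exp (-κ * a) * D a ≤ Real.exp (-κ * a) * ((1 - Real.exp (-κ * L)) * S) := by
      refine h10.trans ?_
      have := mul_le_mul_of_nonneg_right h11 hS0
      linarith
    exact le_of_mul_le_mul_left h12 (Real.exp_pos _)
  have hle : S ≤ (1 - Real.exp (-L / ε)) * S :=
    csSup_le (Set.Nonempty.image _ ⟨0, le_rfl, hL⟩) (by rintro _ ⟨a, ha, rfl⟩; exact key a ha)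
  have hS1 : S ≤ 0 := by
    have := Real.exp_pos (-L / ε)
    nlinarith
  have := hDS 0 ⟨le_rfl, hL⟩
  simp only [hD, hH] at this
  linarith

end Along

/-! ### Change of time -/

section TimeChange

/-- The generalized inverse of the primitive of a nonnegative density `k` transports the Lebesgue
measure onto the measure with density `k`. -/
theorem exists_time_change {k : ℝ → ℝ} {s t : ℝ} (hst : s ≤ t)
    (hk0 : ∀ r, 0 ≤ k r) (hki : IntegrableOn k (Ioc s t)) :
    ∃ ρ : ℝ → ℝ,
      (∀ τ ∈ Icc 0 (∫ r in s..t, k r), ρ τ ∈ Icc s t ∧ ∫ r in s..(ρ τ), k r = τ) ∧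
      ρ 0 = s ∧
      (∀ τ ∈ Icc 0 (∫ r in s..t, k r), ∀ c ∈ Icc s t, ρ τ ≤ c ↔ τ ≤ ∫ r in s..c, k r) ∧
      MeasurePreserving ρ (volume.restrict (Ioc 0 (∫ r in s..t, k r)))
        ((volume.restrict (Ioc s t)).withDensity fun r => ENNReal.ofReal (k r)) := by
  set T : ℝ → ℝ := fun c => ∫ r in s..c, k r with hT
  set L : ℝ := ∫ r in s..t, k r with hL
  have hii : IntervalIntegrable k volume s t := by
    rwa [intervalIntegrable_iff_integrableOn_Ioc_of_le hst]
  have hTc : ContinuousOn T (Icc s t) := by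
    have := (hii.absolutelyContinuousOnInterval_intervalIntegral (c := s) left_mem_uIcc).continuousOn
    rwa [uIcc_of_le hst] at this
  have hTm : MonotoneOn T (Icc s t) := by
    intro a ha b hb hab
    have hsub : ∀ c ∈ Icc s t, IntervalIntegrable k volume s c := fun c hc =>
      hii.mono_set (by rw [uIcc_of_le hc.1, uIcc_of_le hst]; exact Icc_subset_Icc_right hc.2)
    have h1 := intervalIntegral.integral_interval_sub_left (hsub b hb) (hsub a ha)
    have h2 : 0 ≤ ∫ r in a..b, k r := intervalIntegral.integral_nonneg hab fun r _ => hk0 r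
    simp only [hT]; linarith
  have hTs : T s = 0 := intervalIntegral.integral_same
  have hL0 : 0 ≤ L := intervalIntegral.integral_nonneg hst fun r _ => hk0 r
  -- Clamping keeps the superlevel sets nonempty for every real `τ`, so that `ρ` is monotone on the
  -- whole line and hence measurable.
  set cl : ℝ → ℝ := fun τ => min (max τ 0) L with hcl
  have hclI : ∀ τ ∈ Icc 0 L, cl τ = τ := fun τ hτ => by
    simp [hcl, max_eq_left hτ.1, min_eq_left hτ.2]
  have hclL : ∀ τ, cl τ ≤ L := fun τ => min_le_right _ _
  have hcl0 : ∀ τ, 0 ≤ cl τ := fun τ => le_min (le_max_right _ _) hL0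
  set S : ℝ → Set ℝ := fun τ => Icc s t ∩ T ⁻¹' Ici (cl τ) with hS
  have hSt : ∀ τ, t ∈ S τ := fun τ => ⟨⟨hst, le_rfl⟩, hclL τ⟩
  have hSc : ∀ τ, IsClosed (S τ) := fun τ => hTc.preimage_isClosed_of_isClosed isClosed_Icc isClosed_Ici
  have hSb : ∀ τ, BddBelow (S τ) := fun τ => ⟨s, fun c hc => hc.1.1⟩
  set ρ : ℝ → ℝ := fun τ => sInf (S τ) with hρ
  have hmem : ∀ τ, ρ τ ∈ S τ := fun τ => (hSc τ).csInf_mem ⟨t, hSt τ⟩ (hSb τ)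
  have hiff : ∀ τ ∈ Icc 0 L, ∀ c ∈ Icc s t, ρ τ ≤ c ↔ τ ≤ T c := by
    intro τ hτ c hc
    constructor
    · intro h
      have h1 : cl τ ≤ T (ρ τ) := (hmem τ).2
      rw [hclI τ hτ] at h1
      exact h1.trans (hTm (hmem τ).1 hc h)
    · intro h
      exact csInf_le (hSb τ) ⟨hc, by rw [mem_preimage, hclI τ hτ]; exact h⟩
  have heq : ∀ τ ∈ Icc 0 L, T (ρ τ) = τ := by
    intro τ hτ
    refine le_antisymm ?_ ((hiff τ hτ _ (hmem τ).1).1 le_rfl)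
    obtain ⟨c, hc, hcτ⟩ : τ ∈ T '' Icc s t :=
      intermediate_value_Icc hst hTc ⟨by rw [hTs]; exact hτ.1, hτ.2⟩
    rw [← hcτ]
    refine hTm (hmem _).1 hc ?_
    rw [hcτ]
    exact (hiff τ hτ c hc).2 hcτ.ge
  have hmono : Monotone ρ := by
    intro a b hab
    refine csInf_le_csInf (hSb a) ⟨t, hSt b⟩ fun c hc => ⟨hc.1, ?_⟩
    exact le_trans (min_le_min_right _ (max_le_max_right _ hab)) hc.2
  have hρ0 : ρ 0 = s :=
    le_antisymm ((hiff 0 ⟨le_rfl, hL0⟩ s ⟨le_rfl, hst⟩).2 hTs.ge) (hmem 0).1.1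
  refine ⟨ρ, fun τ hτ => ⟨(hmem τ).1, heq τ hτ⟩, hρ0, hiff, hmono.measurable, ?_⟩
  have : IsFiniteMeasure ((volume.restrict (Ioc s t)).withDensity fun r => ENNReal.ofReal (k r)) :=
    isFiniteMeasure_withDensity_ofReal hki.2
  have : IsFiniteMeasure (Measure.map ρ (volume.restrict (Ioc 0 L))) :=
    Measure.isFiniteMeasure_map _ _
  have hdens : ∀ c ∈ Icc s t, ∫⁻ r in Ioc s c, ENNReal.ofReal (k r) = ENNReal.ofReal (T c) := by
    intro c hc
    simp only [hT]
    rw [intervalIntegral.integral_of_le hc.1, ofReal_integral_eq_lintegral_ofReal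
      (hki.mono_set (Ioc_subset_Ioc_right hc.2)) (Eventually.of_forall fun r => hk0 r)]
  -- Two finite measures are compared on half-lines: by the Galois-type relation `hiff`, `ρ τ ≤ c`
  -- means `τ ≤ T c`, so both sides have mass `T c` (with `c` cut off at `t`).
  refine Measure.ext_of_Iic _ _ fun c => ?_
  rw [Measure.map_apply hmono.measurable measurableSet_Iic,
    Measure.restrict_apply (hmono.measurable measurableSet_Iic),
    withDensity_apply _ measurableSet_Iic, Measure.restrict_restrict measurableSet_Iic]
  rcases lt_or_ge c s with hcs | hcs
  · have h1 : ρ ⁻¹' Iic c ∩ Ioc 0 L = ∅ := by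
      ext τ
      simp only [mem_inter_iff, mem_preimage, mem_Iic, mem_empty_iff_false, iff_false, not_and]
      intro h
      exact absurd h (not_le.2 (hcs.trans_le (hmem τ).1.1))
    have h2 : Iic c ∩ Ioc s t = ∅ := by
      ext r
      simp only [mem_inter_iff, mem_Iic, mem_Ioc, mem_empty_iff_false, iff_false, not_and]
      intro h h'
      linarith
    simp [h1, h2]
  · have hcI : min c t ∈ Icc s t := ⟨le_min hcs hst, min_le_right _ _⟩
    have h1 : ρ ⁻¹' Iic c ∩ Ioc 0 L = Ioc 0 (T (min c t)) := by
      ext τ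
      simp only [mem_inter_iff, mem_preimage, mem_Iic, mem_Ioc]
      constructor
      · rintro ⟨h, h0, hτL⟩
        exact ⟨h0, (hiff τ ⟨h0.le, hτL⟩ _ hcI).1 (le_min h (hmem τ).1.2)⟩
      · rintro ⟨h0, h⟩
        have hτL : τ ≤ L := h.trans (hTm hcI ⟨hst, le_rfl⟩ hcI.2)
        exact ⟨((hiff τ ⟨h0.le, hτL⟩ _ hcI).2 h).trans (min_le_left _ _), h0, hτL⟩
    have h2 : Iic c ∩ Ioc s t = Ioc s (min c t) := by
      ext r
      simp only [mem_inter_iff, mem_Iic, mem_Ioc, le_min_iff]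
      tauto
    rw [h1, h2, hdens _ hcI, Real.volume_Ioc, sub_zero]

variable {X : Type*} [MetricSpace X] {φ : X → EReal} {ε B A : ℝ} {p : X} {u : ℝ → X}

/-- Reparametrisation of a curve with speed bound `a` so that its speed becomes `σ`. -/
theorem exists_segment_of_speed {a σ : ℝ → ℝ} {s t η : ℝ} (hst : s ≤ t)
    (hu : SpeedBound u a (Icc s t)) (ha : Measurable a) (ha0 : ∀ r, 0 ≤ a r)
    (hai : IntegrableOn a (Ioc s t)) (hη : 0 < η) (hσ : Measurable σ) (hση : ∀ r, η ≤ σ r)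
    (hσa : IntegrableOn (fun r => σ r * a r) (Ioc s t))
    (hfin : ∀ᵐ r ∂(volume.restrict (Ioc s t)), a r ≠ 0 → φ (u r) ≠ ⊤)
    (hpot : IntegrableOn (fun r => a r / σ r * (φ (u r)).toReal) (Ioc s t))
    (hmeas : AEMeasurable (fun r => φ (u r)) (volume.restrict (Ioc s t))) :
    ∃ (w : ℝ → X) (m : ℝ → ℝ) (L : ℝ), Segment φ w m L ∧ w 0 = u s ∧ w L = u t ∧
      ∫ τ in 0..L, m τ ^ 2 = ∫ r in s..t, σ r * a r ∧
      ∀ Q : X → ℝ → Prop, (∀ᵐ r ∂(volume.restrict (Ioc s t)), a r ≠ 0 → Q (u r) (σ r)) →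
        ∀ᵐ τ ∂(volume.restrict (Ioc 0 L)), Q (w τ) (m τ) := by
  have hσ0 : ∀ r, 0 < σ r := fun r => hη.trans_le (hση r)
  -- Density of the new time with respect to the old: length element divided by the desired speed.
  -- It may vanish, in which case `ρ` jumps over an interval on which the curve rests.
  set k : ℝ → ℝ := fun r => a r / σ r with hk
  have hkm : Measurable k := ha.div hσ
  have hk0 : ∀ r, 0 ≤ k r := fun r => div_nonneg (ha0 r) (hσ0 r).le
  have hki : IntegrableOn k (Ioc s t) := by
    refine Integrable.mono' (hai.div_const η) hkm.aestronglyMeasurable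
      (Eventually.of_forall fun r => ?_)
    rw [Real.norm_of_nonneg (hk0 r)]
    exact div_le_div_of_nonneg_left (ha0 r) hη (hση r)
  obtain ⟨ρ, hρ, hρ0, hiff, hMP⟩ := exists_time_change hst hk0 hki
  set L := ∫ r in s..t, k r with hL
  have hL0 : 0 ≤ L := intervalIntegral.integral_nonneg hst fun r _ => hk0 r
  set ν := (volume.restrict (Ioc s t)).withDensity fun r => ENNReal.ofReal (k r) with hν
  have hνac : ν ≪ volume.restrict (Ioc s t) := withDensity_absolutelyContinuous _ _
  have hint_iff : ∀ f : ℝ → ℝ, AEMeasurable f (volume.restrict (Ioc s t)) →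
      IntegrableOn (fun r => k r * f r) (Ioc s t) →
      IntervalIntegrable (fun τ => f (ρ τ)) volume 0 L := by
    intro f hf hi
    rw [intervalIntegrable_iff_integrableOn_Ioc_of_le hL0]
    refine (hMP.integrable_comp (hf.mono_ac hνac).aestronglyMeasurable).2 ?_
    rw [hν, integrable_withDensity_iff hkm.ennreal_ofReal
      (Eventually.of_forall fun _ => ENNReal.ofReal_lt_top)]
    refine hi.congr (Eventually.of_forall fun r => ?_)
    simp only [ENNReal.toReal_ofReal (hk0 r)]; ring
  have hint_eq : ∀ f : ℝ → ℝ, AEMeasurable f (volume.restrict (Ioc s t)) →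
      ∫ τ in Ioc 0 L, f (ρ τ) = ∫ r in Ioc s t, k r * f r := by
    intro f hf
    have h1 : ∫ τ in Ioc 0 L, f (ρ τ) = ∫ r, f r ∂ν := by
      rw [← hMP.map_eq, integral_map hMP.measurable.aemeasurable]
      rw [hMP.map_eq]
      exact (hf.mono_ac hνac).aestronglyMeasurable
    rw [h1, hν, integral_withDensity_eq_integral_toReal_smul hkm.ennreal_ofReal
      (Eventually.of_forall fun _ => ENNReal.ofReal_lt_top)]
    refine integral_congr_ae (Eventually.of_forall fun r => ?_)
    simp only [ENNReal.toReal_ofReal (hk0 r), smul_eq_mul]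
  have hkσ : ∀ r, k r * σ r = a r := fun r => div_mul_cancel₀ _ (hσ0 r).ne'
  -- The transported measure has density `k`, which vanishes with `a`. Information is therefore
  -- needed only where the original curve moves.
  have htrans : ∀ Q : X → ℝ → Prop,
      (∀ᵐ r ∂(volume.restrict (Ioc s t)), a r ≠ 0 → Q (u r) (σ r)) →
        ∀ᵐ τ ∂(volume.restrict (Ioc 0 L)), Q (u (ρ τ)) (σ (ρ τ)) := by
    intro Q hQ
    have h1 : ∀ᵐ r ∂ν, Q (u r) (σ r) := by
      rw [hν, ae_withDensity_iff hkm.ennreal_ofReal]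
      filter_upwards [hQ] with r hr hne
      refine hr fun h0 => hne ?_
      simp [hk, h0]
    exact hMP.quasiMeasurePreserving.ae h1
  have hσi : IntervalIntegrable (fun τ => σ (ρ τ)) volume 0 L :=
    hint_iff σ hσ.aemeasurable (hai.congr (Eventually.of_forall fun r => (hkσ r).symm))
  refine ⟨fun τ => u (ρ τ), fun τ => σ (ρ τ), L, ⟨hL0, ?_, hσi, ?_, ?_, ?_⟩, ?_, ?_, ?_, htrans⟩
  · intro τ₁ h₁ τ₂ h₂ h12
    have hr12 : ρ τ₁ ≤ ρ τ₂ := by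
      rw [hiff τ₁ h₁ _ (hρ τ₂ h₂).1, (hρ τ₂ h₂).2]; exact h12
    refine (hu _ (hρ τ₁ h₁).1 _ (hρ τ₂ h₂).1 hr12).trans ?_
    rw [intervalIntegral.integral_of_le hr12, intervalIntegral.integral_of_le h12]
    have h3 : ∫ r in Ioc (ρ τ₁) (ρ τ₂), a r
        = ∫ r in Ioc s t, k r * (Ioc (ρ τ₁) (ρ τ₂)).indicator σ r := by
      have : (fun r => k r * (Ioc (ρ τ₁) (ρ τ₂)).indicator σ r)
          = (Ioc (ρ τ₁) (ρ τ₂)).indicator a := by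
        funext r
        by_cases hr : r ∈ Ioc (ρ τ₁) (ρ τ₂)
        · rw [indicator_of_mem hr, indicator_of_mem hr, hkσ]
        · rw [indicator_of_notMem hr, indicator_of_notMem hr, mul_zero]
      rw [this, setIntegral_indicator measurableSet_Ioc, inter_eq_right.2
        (Ioc_subset_Ioc (hρ τ₁ h₁).1.1 (hρ τ₂ h₂).1.2)]
    rw [h3, ← hint_eq _ (hσ.indicator measurableSet_Ioc).aemeasurable]
    have h4 : Ioc τ₁ τ₂ ⊆ Ioc 0 L := Ioc_subset_Ioc h₁.1 h₂.2
    have hσI : IntegrableOn (fun τ => σ (ρ τ)) (Ioc 0 L) := hσi.1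
    have h5 : ∫ τ in Ioc τ₁ τ₂, σ (ρ τ)
        = ∫ τ in Ioc 0 L, (Ioc τ₁ τ₂).indicator (fun τ => σ (ρ τ)) τ := by
      rw [setIntegral_indicator measurableSet_Ioc, inter_eq_right.2 h4]
    rw [h5]
    refine le_of_eq (setIntegral_congr_fun measurableSet_Ioc fun τ hτ => ?_)
    have hτ' : τ ∈ Icc 0 L := ⟨hτ.1.le, hτ.2⟩
    have h6 : ρ τ ∈ Ioc (ρ τ₁) (ρ τ₂) ↔ τ ∈ Ioc τ₁ τ₂ := by
      rw [mem_Ioc, mem_Ioc, ← not_le, ← not_le, hiff τ hτ' _ (hρ τ₁ h₁).1, (hρ τ₁ h₁).2,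
        hiff τ hτ' _ (hρ τ₂ h₂).1, (hρ τ₂ h₂).2]
    by_cases h7 : τ ∈ Ioc τ₁ τ₂
    · simp only [indicator_of_mem h7, indicator_of_mem (h6.2 h7)]
    · simp only [indicator_of_notMem h7, indicator_of_notMem (fun h => h7 (h6.1 h))]
  · refine hint_iff (fun r => σ r ^ 2) (by fun_prop)
      (hσa.congr (Eventually.of_forall fun r => ?_))
    simp only [← hkσ r]; ring
  · exact htrans (fun x _ => φ x ≠ ⊤) hfin
  · exact hint_iff (fun r => (φ (u r)).toReal) hmeas.ereal_toReal hpot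
  · simp only [hρ0]
  · simp only
    have hLI : L ∈ Icc 0 L := ⟨hL0, le_rfl⟩
    obtain ⟨h1, h2⟩ := hρ L hLI
    -- The generalized inverse may reach total time `L` at some `ρ L < t`. Then `k`, and with it
    -- `a`, vanishes a.e. on the remainder, so `u` has already arrived at `u t`.
    have h3 : ∫ r in (ρ L)..t, k r = 0 := by
      have hii : IntervalIntegrable k volume s t := by
        rwa [intervalIntegrable_iff_integrableOn_Ioc_of_le hst]
      have := intervalIntegral.integral_add_adjacent_intervals (μ := volume) (f := k)
        (hii.mono_set (c := s) (d := ρ L) (by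
          rw [uIcc_of_le h1.1, uIcc_of_le hst]; exact Icc_subset_Icc_right h1.2))
        (hii.mono_set (c := ρ L) (d := t) (by
          rw [uIcc_of_le h1.2, uIcc_of_le hst]; exact Icc_subset_Icc_left h1.1))
      linarith
    have h4 : ∫ r in (ρ L)..t, a r = 0 := by
      rw [intervalIntegral.integral_of_le h1.2] at h3 ⊢
      rw [setIntegral_eq_zero_iff_of_nonneg_ae (Eventually.of_forall fun r => hk0 r)
        (hki.mono_set (Ioc_subset_Ioc_left h1.1))] at h3
      refine integral_eq_zero_of_ae ?_
      filter_upwards [h3] with r hr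
      rw [← hkσ r, hr]; simp
    have h5 := hu _ h1 t ⟨hst, le_rfl⟩ h1.2
    rw [h4] at h5
    exact dist_le_zero.1 h5
  · rw [intervalIntegral.integral_of_le hL0, intervalIntegral.integral_of_le hst,
      hint_eq (fun r => σ r ^ 2) (by fun_prop)]
    refine integral_congr_ae (Eventually.of_forall fun r => ?_)
    simp only [← hkσ r]; ring

/-- The value function varies along a curve at most by the integral of `g` with respect to arclength
if `φ = V + ε g² / 2` along the curve. -/
theorem value_along_curve_le (hQ : QuadBound φ ε B A p) {a g : ℝ → ℝ} {s t : ℝ} (hst : s ≤ t)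
    (hu : SpeedBound u a (Icc s t)) (ha : Measurable a) (ha0 : ∀ r, 0 ≤ a r)
    (hai : IntegrableOn a (Ioc s t)) (hg : Measurable g) (hg0 : ∀ r, 0 ≤ g r)
    (hga : IntegrableOn (fun r => g r * a r) (Ioc s t))
    (hVa : IntegrableOn (fun r => (value φ ε (u r)).toReal * a r) (Ioc s t))
    (heq : ∀ᵐ r ∂(volume.restrict (Ioc s t)), a r ≠ 0 → φ (u r) ≠ ⊤ ∧
      (φ (u r)).toReal = (value φ ε (u r)).toReal + ε * g r ^ 2 / 2) :
    (value φ ε (u t) ≠ ⊤ → value φ ε (u s) ≠ ⊤ ∧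
      (value φ ε (u s)).toReal ≤ (value φ ε (u t)).toReal + ∫ r in s..t, g r * a r) ∧
    (value φ ε (u s) ≠ ⊤ → value φ ε (u t) ≠ ⊤ ∧
      (value φ ε (u t)).toReal ≤ (value φ ε (u s)).toReal + ∫ r in s..t, g r * a r) := by
  have hε := hQ.eps_pos
  have hcont : ContinuousOn u (Icc s t) := hu.continuousOn hst (by
    rwa [intervalIntegrable_iff_integrableOn_Ioc_of_le hst])
  have hmeas : AEMeasurable (fun r => φ (u r)) (volume.restrict (Ioc s t)) :=
    aemeasurable_comp_of_continuousOn hQ.lsc measurableSet_Ioc (hcont.mono Ioc_subset_Icc_self)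
  -- The target speed is `g + η`: the shift bounds the travel time where `g` vanishes, costs `η`
  -- times the length, and preserves `φ - V ≤ ε m²/2`.
  have main : ∀ η : ℝ, 0 < η → ∃ (w : ℝ → X) (m : ℝ → ℝ) (L : ℝ), Segment φ w m L ∧ w 0 = u s ∧
      w L = u t ∧ ∫ τ in 0..L, m τ ^ 2 = (∫ r in s..t, g r * a r) + η * ∫ r in s..t, a r ∧
      ∀ᵐ τ ∂(volume.restrict (Ioc 0 L)),
        (φ (w τ)).toReal - (value φ ε (w τ)).toReal ≤ ε * m τ ^ 2 / 2 := by
    intro η hη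
    have hσa : IntegrableOn (fun r => (g r + η) * a r) (Ioc s t) := by
      refine (hga.add (hai.const_mul η)).congr (Eventually.of_forall fun r => ?_)
      simp only [Pi.add_apply]; ring
    -- Insert `φ = V + ε g²/2`: the first term is at most `|V| a/η`, where integrability of `V` with
    -- respect to length is used, and the second at most `(ε/2) g a`.
    have hpot : IntegrableOn (fun r => a r / (g r + η) * (φ (u r)).toReal) (Ioc s t) := by
      refine Integrable.mono' ((hVa.norm.div_const η).add (hga.const_mul (ε / 2)))
        ((ha.div (hg.add_const η)).aemeasurable.mul hmeas.ereal_toReal).aestronglyMeasurable ?_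
      filter_upwards [heq] with r hr
      have hga0 := mul_nonneg (hg0 r) (ha0 r)
      simp only [Pi.add_apply]
      by_cases h0 : a r = 0
      · simp [h0]
      · rw [(hr h0).2, norm_mul, Real.norm_of_nonneg (div_nonneg (ha0 r) (by linarith [hg0 r])),
          norm_mul, Real.norm_of_nonneg (ha0 r)]
        have hgη : 0 < g r + η := by linarith [hg0 r]
        have h1 : ‖(value φ ε (u r)).toReal + ε * g r ^ 2 / 2‖
            ≤ ‖(value φ ε (u r)).toReal‖ + ε * g r ^ 2 / 2 := by
          refine (norm_add_le _ _).trans (le_of_eq ?_)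
          rw [Real.norm_of_nonneg (by positivity : 0 ≤ ε * g r ^ 2 / 2)]
        have h2 : a r / (g r + η) * ‖(value φ ε (u r)).toReal + ε * g r ^ 2 / 2‖
            ≤ a r / (g r + η) * (‖(value φ ε (u r)).toReal‖ + ε * g r ^ 2 / 2) :=
          mul_le_mul_of_nonneg_left h1 (div_nonneg (ha0 r) hgη.le)
        refine h2.trans ?_
        rw [mul_add]
        refine add_le_add ?_ ?_
        · rw [mul_comm (‖_‖), mul_div_right_comm]
          refine mul_le_mul_of_nonneg_right ?_ (norm_nonneg _)
          exact div_le_div_of_nonneg_left (ha0 r) hη (by linarith [hg0 r])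
        · have h3 : a r / (g r + η) * (ε * g r ^ 2 / 2)
              = ε / 2 * (g r * a r) * (g r / (g r + η)) := by field_simp
          rw [h3]
          refine mul_le_of_le_one_right (by positivity) ?_
          rw [div_le_one hgη]; linarith
    obtain ⟨w, m, L, h1, h2, h3, h4, h5⟩ := exists_segment_of_speed (φ := φ) (σ := fun r => g r + η)
      hst hu ha ha0 hai hη (by fun_prop) (fun r => by linarith [hg0 r]) hσa
      (heq.mono fun r hr h0 => (hr h0).1) hpot hmeas
    refine ⟨w, m, L, h1, h2, h3, ?_, ?_⟩
    · rw [h4, ← intervalIntegral.integral_const_mul, ← intervalIntegral.integral_add]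
      · refine intervalIntegral.integral_congr fun r _ => ?_
        ring
      · rwa [intervalIntegrable_iff_integrableOn_Ioc_of_le hst]
      · rw [intervalIntegrable_iff_integrableOn_Ioc_of_le hst]; exact hai.const_mul η
    · refine h5 (fun x y => (φ x).toReal - (value φ ε x).toReal ≤ ε * y ^ 2 / 2) ?_
      filter_upwards [heq] with r hr h0
      rw [(hr h0).2]
      have : ε * g r ^ 2 ≤ ε * (g r + η) ^ 2 := by
        have := hg0 r
        gcongr; linarith
      linarith
  have lim : ∀ x y : ℝ, (∀ η > 0, x ≤ y + ((∫ r in s..t, g r * a r) + η * ∫ r in s..t, a r)) →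
      x ≤ y + ∫ r in s..t, g r * a r := by
    intro x y h
    have hc : Tendsto (fun η : ℝ => y + ((∫ r in s..t, g r * a r) + η * ∫ r in s..t, a r)) (𝓝[>] 0)
        (𝓝 (y + ((∫ r in s..t, g r * a r) + 0 * ∫ r in s..t, a r))) :=
      (Continuous.tendsto (by fun_prop) _).mono_left nhdsWithin_le_nhds
    rw [zero_mul, add_zero] at hc
    exact ge_of_tendsto hc (eventually_nhdsWithin_of_forall h)
  constructor
  · intro hne
    have hall : ∀ η > 0, value φ ε (u s) ≠ ⊤ ∧ (value φ ε (u s)).toReal ≤ (value φ ε (u t)).toReal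
        + ((∫ r in s..t, g r * a r) + η * ∫ r in s..t, a r) := by
      intro η hη
      obtain ⟨w, m, L, h1, h2, h3, h4, h5⟩ := main η hη
      have := h1.value_le_add_integral_sq hQ (by rwa [h3]) h5
      rwa [h2, h3, h4] at this
    exact ⟨(hall 1 one_pos).1, lim _ _ fun η hη => (hall η hη).2⟩
  · intro hne
    have hall : ∀ η > 0, value φ ε (u t) ≠ ⊤ ∧ (value φ ε (u t)).toReal ≤ (value φ ε (u s)).toReal
        + ((∫ r in s..t, g r * a r) + η * ∫ r in s..t, a r) := by
      intro η hη
      obtain ⟨w, m, L, h1, h2, h3, h4, h5⟩ := main η hη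
      have := h1.reverse.value_le_add_integral_sq hQ (by simpa [h2] using hne)
        (ae_restrict_Ioc_const_sub (P := fun τ => (φ (w τ)).toReal - (value φ ε (w τ)).toReal
          ≤ ε * m τ ^ 2 / 2) h5)
      simp only [sub_zero, sub_self, h2, h3] at this
      rw [intervalIntegral.integral_comp_sub_left (fun r => m r ^ 2), sub_self, sub_zero, h4]
        at this
      exact this
    exact ⟨(hall 1 one_pos).1, lim _ _ fun η hη => (hall η hη).2⟩

end TimeChange

/-! ### Geodesic competitors -/

section Geodesic

variable {X : Type*} [MetricSpace X] {φ : X → EReal} {ε B A lam : ℝ} {p : X}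

theorem hasDerivAt_exp_div (ε t : ℝ) :
    HasDerivAt (fun t => Real.exp (t / ε)) (Real.exp (t / ε) / ε) t := by
  refine (((hasDerivAt_id' t).div_const ε).exp).congr_deriv ?_
  ring

/-- The convexity defect is at most `|λ|/8` times the squared distance, since `t(1-t) ≤ 1/4`. It is
of second order and disappears in every later limit. -/
theorem IsGeodesicallyConvex.exists_bound (hφ : ∀ x, φ x ≠ ⊥) (hc : IsGeodesicallyConvex lam φ)
    {x v : X} (hx : φ x ≠ ⊤) (hv : φ v ≠ ⊤) :
    ∃ γ : ℝ → X, IsGeodesic γ ∧ γ 0 = x ∧ γ 1 = v ∧ ∀ t ∈ Icc (0 : ℝ) 1, φ (γ t) ≠ ⊤ ∧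
      (φ (γ t)).toReal ≤ (1 - t) * (φ x).toReal + t * (φ v).toReal
        + |lam| / 8 * dist x v ^ 2 := by
  obtain ⟨γ, hγ, h0, h1, hb⟩ := hc x (lt_top_iff_ne_top.2 hx) v (lt_top_iff_ne_top.2 hv)
  refine ⟨γ, hγ, h0, h1, fun t ht => ?_⟩
  have h := hb t ht
  rw [← EReal.coe_toReal hx (hφ x), ← EReal.coe_toReal hv (hφ v), ← EReal.coe_mul, ← EReal.coe_mul,
    ← EReal.coe_add, ← EReal.coe_sub] at h
  have hne : φ (γ t) ≠ ⊤ := (h.trans_lt (EReal.coe_lt_top _)).ne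
  refine ⟨hne, ?_⟩
  rw [← EReal.coe_toReal hne (hφ _), EReal.coe_le_coe_iff] at h
  refine h.trans ?_
  have h2 : -(lam / 2 * t * (1 - t)) ≤ |lam| / 8 := by
    have h3 : 0 ≤ t * (1 - t) := mul_nonneg ht.1 (by linarith [ht.2])
    have h4 : t * (1 - t) ≤ 1 / 4 := by nlinarith [sq_nonneg (t - 1 / 2)]
    have h5 : -lam * (t * (1 - t)) ≤ |lam| * (1 / 4) :=
      mul_le_mul (neg_le_abs lam) h4 h3 (abs_nonneg _)
    linarith
  have := mul_le_mul_of_nonneg_right h2 (sq_nonneg (dist x v))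
  linarith

/-- Speed proportional to `exp (t/ε)` gives equality in the weighted Cauchy–Schwarz inequality, so
this parametrisation has the least weighted kinetic energy among curves from `x` to `v` in time `T`.
Convexity of the exponential gives `θ t ≤ t/T`: the geodesic is never ahead of the uniform
parametrisation. -/
theorem exists_geodesic_segment (hQ : QuadBound φ ε B A p) (hc : IsGeodesicallyConvex lam φ)
    {x v : X} (hx : φ x ≠ ⊤) (hv : φ v ≠ ⊤) {T : ℝ} (hT : 0 < T) :
    ∃ (w : ℝ → X) (m : ℝ → ℝ), Segment φ w m T ∧ w 0 = x ∧ w T = v ∧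
      ∫ t in 0..T, m t ^ 2 * Real.exp (-t / ε) = dist x v ^ 2 / (ε * (Real.exp (T / ε) - 1)) ∧
      ∀ t ∈ Icc 0 T, φ (w t) ≠ ⊤ ∧ ∃ θ : ℝ, 0 ≤ θ ∧ θ ≤ t / T ∧ θ ≤ 1 ∧
        (φ (w t)).toReal ≤ (1 - θ) * (φ x).toReal + θ * (φ v).toReal
          + |lam| / 8 * dist x v ^ 2 := by
  have hε := hQ.eps_pos
  obtain ⟨γ, hγ, h0, h1, hb⟩ := hc.exists_bound hQ.ne_bot hx hv
  set E : ℝ := Real.exp (T / ε) - 1 with hE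
  have hE0 : 0 < E := by
    have : 1 < Real.exp (T / ε) := Real.one_lt_exp_iff.2 (by positivity)
    linarith
  set D := dist x v with hD
  set θ : ℝ → ℝ := fun t => (Real.exp (t / ε) - 1) / E with hθ
  have hθd : ∀ t, HasDerivAt θ (Real.exp (t / ε) / ε / E) t := fun t =>
    ((hasDerivAt_exp_div ε t).sub_const 1).div_const E
  have hθmono : Monotone θ := fun s t hst => by
    simp only [hθ]
    gcongr
  have hθ0 : θ 0 = 0 := by simp [hθ]
  have hθT : θ T = 1 := div_self hE0.ne'
  have hθI : ∀ t ∈ Icc 0 T, θ t ∈ Icc (0 : ℝ) 1 := fun t ht =>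
    ⟨hθ0 ▸ hθmono ht.1, hθT ▸ hθmono ht.2⟩
  have hθle : ∀ t ∈ Icc 0 T, θ t ≤ t / T := by
    intro t ht
    have hconv := convexOn_exp.2 (mem_univ 0) (mem_univ (T / ε))
      (show 0 ≤ 1 - t / T by rw [sub_nonneg, div_le_one hT]; exact ht.2)
      (div_nonneg ht.1 hT.le) (by ring)
    simp only [smul_eq_mul, mul_zero, zero_add, Real.exp_zero, mul_one] at hconv
    have h2 : t / T * (T / ε) = t / ε := by field_simp
    rw [h2] at hconv
    simp only [hθ]
    rw [div_le_iff₀ hE0]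
    simp only [hE]; linarith
  have hmc : Continuous (fun t => D * (Real.exp (t / ε) / ε / E)) := by fun_prop
  have hspeed : SpeedBound (fun t => γ (θ t)) (fun t => D * (Real.exp (t / ε) / ε / E))
      (Icc 0 T) := by
    intro s hs t ht hst
    rw [intervalIntegral.integral_eq_sub_of_hasDerivAt
      (fun r _ => (hθd r).const_mul D) (hmc.intervalIntegrable _ _),
      hγ _ (hθI s hs) _ (hθI t ht), h0, h1, abs_of_nonneg (sub_nonneg.2 (hθmono hst))]
    exact le_of_eq (by ring)
  have hcont : ContinuousOn (fun t => γ (θ t)) (Icc 0 T) :=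
    hspeed.continuousOn hT.le (hmc.intervalIntegrable _ _)
  refine ⟨fun t => γ (θ t), fun t => D * (Real.exp (t / ε) / ε / E),
    ⟨hT.le, hspeed, hmc.intervalIntegrable _ _, (hmc.pow 2).intervalIntegrable _ _, ?_, ?_⟩,
    ?_, ?_, ?_, fun t ht => ?_⟩
  · filter_upwards [ae_restrict_mem measurableSet_Ioc] with t ht
    exact (hb _ (hθI t (Ioc_subset_Icc_self ht))).1
  · rw [intervalIntegrable_iff_integrableOn_Icc_of_le hT.le]
    have hmeas := (aemeasurable_comp_of_continuousOn hQ.lsc measurableSet_Icc hcont).ereal_toReal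
    set C := |(φ x).toReal| + |(φ v).toReal| + |lam| / 8 * D ^ 2 with hC
    set C' := B * D ^ 2 + (B * dist x p ^ 2 + A) with hC'
    have hB := hQ.B_nonneg
    have hA := hQ.A_nonneg
    refine Integrable.mono' (integrable_const (C + C')) hmeas.aestronglyMeasurable ?_
    filter_upwards [ae_restrict_mem measurableSet_Icc] with t ht
    have hI := hθI t ht
    obtain ⟨h2, h3⟩ := hb _ hI
    have h4 := hQ.le_toReal _ x h2
    have h5 : dist (γ (θ t)) x ≤ D := by
      rw [dist_comm, ← h0, hγ _ ⟨le_rfl, zero_le_one⟩ _ hI, h0, h1, sub_zero, abs_of_nonneg hI.1]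
      exact mul_le_of_le_one_left dist_nonneg hI.2
    have h6 : B * dist (γ (θ t)) x ^ 2 ≤ B * D ^ 2 := by gcongr
    have h7 : (1 - θ t) * (φ x).toReal ≤ |(φ x).toReal| := by
      refine (mul_le_mul_of_nonneg_left (le_abs_self _) (by linarith [hI.2])).trans ?_
      exact mul_le_of_le_one_left (abs_nonneg _) (by linarith [hI.1])
    have h8 : θ t * (φ v).toReal ≤ |(φ v).toReal| := by
      refine (mul_le_mul_of_nonneg_left (le_abs_self _) hI.1).trans ?_
      exact mul_le_of_le_one_left (abs_nonneg _) hI.2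
    have h9 : 0 ≤ C := by positivity
    have h10 : 0 ≤ C' := by positivity
    rw [Real.norm_eq_abs, abs_le]
    constructor <;> linarith
  · simp only [hθ0, h0]
  · simp only [hθT, h1]
  · have hpt : ∀ t, (D * (Real.exp (t / ε) / ε / E)) ^ 2 * Real.exp (-t / ε)
        = D ^ 2 / (ε * E ^ 2) * (Real.exp (t / ε) / ε) := by
      intro t
      have : Real.exp (-t / ε) = (Real.exp (t / ε))⁻¹ := by rw [← Real.exp_neg]; congr 1; ring
      rw [this]
      have := Real.exp_pos (t / ε)
      field_simp
    simp only [hpt]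
    rw [intervalIntegral.integral_const_mul, intervalIntegral.integral_eq_sub_of_hasDerivAt
      (fun t _ => hasDerivAt_exp_div ε t) (Continuous.intervalIntegrable (by fun_prop) _ _),
      zero_div, Real.exp_zero, ← hE]
    field_simp
  · exact ⟨(hb _ (hθI t ht)).1, θ t, (hθI t ht).1, hθle t ht, (hθI t ht).2, (hb _ (hθI t ht)).2⟩

theorem Segment.integral_lagrangian {w : ℝ → X} {m : ℝ → ℝ} {T : ℝ} (h : Segment φ w m T) :
    ∫ t in 0..T, lagrangian φ ε w m t * Real.exp (-t / ε)
      = (∫ t in 0..T, m t ^ 2 * Real.exp (-t / ε)) / 2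
        + (∫ t in 0..T, (φ (w t)).toReal * Real.exp (-t / ε)) / ε := by
  rw [← intervalIntegral.integral_div, ← intervalIntegral.integral_div,
    ← intervalIntegral.integral_add]
  · refine intervalIntegral.integral_congr fun t _ => ?_
    simp only [lagrangian]; ring
  · exact (h.sq_integrable.mul_continuousOn (by fun_prop)).div_const 2
  · exact (h.potential.mul_continuousOn (by fun_prop)).div_const ε

/-- Dynamic programming along the geodesic segment whose duration satisfies `exp (T/ε) = 1 + E`,
multiplied by `1 + E`. The free parameter `E` stands for travel time divided by `ε`, to first order.
-/
theorem value_sub_le_of_geodesic (hQ : QuadBound φ ε B A p) (hc : IsGeodesicallyConvex lam φ)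
    {x v : X} (hx : φ x ≠ ⊤) (hv : φ v ≠ ⊤) {E : ℝ} (hE : 0 < E) :
    (value φ ε x).toReal - (value φ ε v).toReal ≤ (1 + E) * dist x v ^ 2 / (2 * ε * E)
      + E * (max (φ x).toReal (φ v).toReal + |lam| / 8 * dist x v ^ 2
        - (value φ ε x).toReal) := by
  have hε := hQ.eps_pos
  set T := ε * Real.log (1 + E) with hT
  have hlog : 0 < Real.log (1 + E) := Real.log_pos (by linarith)
  have hT0 : 0 < T := by positivity
  have hTε : T / ε = Real.log (1 + E) := by rw [hT]; field_simp
  have hexp : Real.exp (T / ε) = 1 + E := by rw [hTε, Real.exp_log (by linarith)]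
  have hexpn : Real.exp (-T / ε) = (1 + E)⁻¹ := by rw [neg_div, Real.exp_neg, hexp]
  obtain ⟨w, m, hw, hw0, hwT, hkin, hpot⟩ := exists_geodesic_segment hQ hc hx hv hT0
  set M := max (φ x).toReal (φ v).toReal + |lam| / 8 * dist x v ^ 2 with hM
  have h1 := (hw.value_le hQ (by
    rw [hwT]; exact ((value_le_self hQ v).trans_lt (lt_top_iff_ne_top.2 hv)).ne)).2
  have h2 : ∫ t in 0..T, (φ (w t)).toReal * Real.exp (-t / ε) ≤ M * (ε * (1 - (1 + E)⁻¹)) := by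
    rw [← hexpn, ← integral_exp_neg_div hε, ← intervalIntegral.integral_const_mul]
    refine intervalIntegral.integral_mono_on hT0.le
      (hw.potential.mul_continuousOn (by fun_prop))
      (Continuous.intervalIntegrable (by fun_prop) _ _) fun t ht => ?_
    obtain ⟨-, θ, hθ0, -, hθ1, hθ⟩ := hpot t ht
    refine mul_le_mul_of_nonneg_right (hθ.trans ?_) (Real.exp_pos _).le
    have h3 : (1 - θ) * (φ x).toReal ≤ (1 - θ) * max (φ x).toReal (φ v).toReal :=
      mul_le_mul_of_nonneg_left (le_max_left _ _) (by linarith)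
    have h4 : θ * (φ v).toReal ≤ θ * max (φ x).toReal (φ v).toReal :=
      mul_le_mul_of_nonneg_left (le_max_right _ _) hθ0
    simp only [hM]; linarith
  rw [hw.integral_lagrangian, hw0, hwT, hkin, hexp, hexpn] at h1
  have h5 : (∫ t in 0..T, (φ (w t)).toReal * Real.exp (-t / ε)) / ε ≤ M * (1 - (1 + E)⁻¹) := by
    rw [div_le_iff₀ hε]; linarith
  have h6 : (value φ ε x).toReal ≤ dist x v ^ 2 / (ε * E) / 2 + M * (1 - (1 + E)⁻¹)
      + (1 + E)⁻¹ * (value φ ε v).toReal := by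
    have : 1 + E - 1 = E := by ring
    rw [this] at h1
    linarith
  have h7 := mul_le_mul_of_nonneg_left h6 (by linarith : (0 : ℝ) ≤ 1 + E)
  have h8 : (1 + E) * (dist x v ^ 2 / (ε * E) / 2 + M * (1 - (1 + E)⁻¹)
      + (1 + E)⁻¹ * (value φ ε v).toReal)
      = (1 + E) * dist x v ^ 2 / (2 * ε * E) + E * M + (value φ ε v).toReal := by
    field_simp; ring
  rw [h8] at h7
  linarith

theorem toENNReal_sub_eq {a b : EReal} (ha : a ≠ ⊤) (ha' : a ≠ ⊥) (hb : b ≠ ⊤) (hb' : b ≠ ⊥) :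
    (a - b).toENNReal = ENNReal.ofReal (a.toReal - b.toReal) := by
  lift a to ℝ using ⟨ha, ha'⟩
  lift b to ℝ using ⟨hb, hb'⟩
  rw [← EReal.coe_sub, EReal.toENNReal_of_ne_top (EReal.coe_ne_top _)]
  rfl

theorem G_of_ne_top (hQ : QuadBound φ ε B A p) {x : X} (hx : φ x ≠ ⊤) :
    G φ ε x = ENNReal.ofReal (Real.sqrt (2 * ((φ x).toReal - (value φ ε x).toReal) / ε)) := by
  have hε := hQ.eps_pos
  have hle := value_le_self hQ x
  have hV : value φ ε x < ⊤ := hle.trans_lt (lt_top_iff_ne_top.2 hx)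
  have h0 : 0 ≤ (φ x).toReal - (value φ ε x).toReal :=
    sub_nonneg.2 (EReal.toReal_le_toReal hle (value_ne_bot hQ x) hx)
  have h1 : 2 * (φ x - value φ ε x) / (ε : EReal)
      = ((2 * ((φ x).toReal - (value φ ε x).toReal) / ε : ℝ) : EReal) := by
    conv_lhs => rw [← EReal.coe_toReal hx (hQ.ne_bot x),
      ← EReal.coe_toReal hV.ne (value_ne_bot hQ x)]
    rw [EReal.coe_div, EReal.coe_mul, EReal.coe_sub]
    rfl
  rw [G, if_pos hV, h1, EReal.toENNReal_of_ne_top (EReal.coe_ne_top _), EReal.toReal_coe,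
    Real.sqrt_eq_rpow, ENNReal.ofReal_rpow_of_nonneg (by positivity) (by norm_num)]

theorem G_of_eq_top (hQ : QuadBound φ ε B A p) {x : X} (hx : φ x = ⊤) :
    G φ ε x = ⊤ := by
  have hε := hQ.eps_pos
  unfold G
  split_ifs with h
  · rw [hx, EReal.top_sub h.ne, EReal.mul_top_of_pos (by norm_num), EReal.top_div_of_pos_ne_top
      (by exact_mod_cast hε) (EReal.coe_ne_top _), EReal.toENNReal_top]
    exact ENNReal.top_rpow_of_pos (by norm_num)
  · rfl

/-- Taking `E = d(x,v)/(sε)` means travelling at speed about `s`. As `v → x`, the convexity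
correction vanishes, and `max (φ x) (φ v)` tends to `φ x` exactly because the limit is conditioned
on `φ v → φ x`. -/
theorem conditionedSlope_le (hQ : QuadBound φ ε B A p) (hc : IsGeodesicallyConvex lam φ) {x : X}
    (hx : φ x ≠ ⊤) {s : ℝ} (hs : 0 < s) :
    conditionedSlope φ (value φ ε) x
      ≤ ENNReal.ofReal (s / 2 + ((φ x).toReal - (value φ ε x).toReal) / (s * ε)) := by
  have hε := hQ.eps_pos
  unfold conditionedSlope
  set F := 𝓝[≠] x ⊓ comap φ (𝓝 (φ x)) with hF
  rcases eq_or_neBot F with hbot | hne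
  · rw [hbot]; simp
  have hφF : Tendsto φ F (𝓝 (φ x)) := tendsto_comap.mono_left inf_le_right
  have hdF : Tendsto (fun v => dist x v) F (𝓝 0) := by
    have : Tendsto (fun v => dist x v) (𝓝 x) (𝓝 (dist x x)) := Continuous.tendsto (by fun_prop) _
    rw [dist_self] at this
    exact this.mono_left (inf_le_left.trans nhdsWithin_le_nhds)
  have hrF : Tendsto (fun v => (φ v).toReal) F (𝓝 (φ x).toReal) :=
    (EReal.tendsto_toReal hx (hQ.ne_bot x)).comp hφF
  have hlim : Tendsto (fun v => s / 2 + dist x v / (2 * ε) + (max (φ x).toReal (φ v).toReal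
      + |lam| / 8 * dist x v ^ 2 - (value φ ε x).toReal) / (s * ε)) F
      (𝓝 (s / 2 + 0 / (2 * ε) + (max (φ x).toReal (φ x).toReal
      + |lam| / 8 * 0 ^ 2 - (value φ ε x).toReal) / (s * ε))) :=
    ((hdF.div_const _).const_add _).add ((((((tendsto_const_nhds (x := (φ x).toReal)).max hrF).add
      ((hdF.pow 2).const_mul _)).sub_const _)).div_const _)
  have hval : s / 2 + 0 / (2 * ε) + (max (φ x).toReal (φ x).toReal
      + |lam| / 8 * 0 ^ 2 - (value φ ε x).toReal) / (s * ε)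
      = s / 2 + ((φ x).toReal - (value φ ε x).toReal) / (s * ε) := by
    simp
  rw [hval] at hlim
  have hlim' := (ENNReal.continuous_ofReal.tendsto _).comp hlim
  rw [← hlim'.limsup_eq]
  refine limsup_le_limsup ?_
  have hne' : ∀ᶠ v in F, v ≠ x :=
    (eventually_mem_of_tendsto_nhdsWithin tendsto_id).filter_mono inf_le_left
  filter_upwards [hne', hφF.eventually_lt_const (lt_top_iff_ne_top.2 hx)] with v hvx hv
  have hD : 0 < dist x v := dist_pos.2 hvx.symm
  have hVx : value φ ε x ≠ ⊤ := ((value_le_self hQ x).trans_lt (lt_top_iff_ne_top.2 hx)).ne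
  have hVv : value φ ε v ≠ ⊤ := ((value_le_self hQ v).trans_lt hv).ne
  rw [toENNReal_sub_eq hVx (value_ne_bot hQ x) hVv (value_ne_bot hQ v), edist_dist,
    ← ENNReal.ofReal_div_of_pos hD]
  refine ENNReal.ofReal_le_ofReal ?_
  have h1 := value_sub_le_of_geodesic hQ hc hx hv.ne (E := dist x v / (s * ε)) (by positivity)
  rw [div_le_iff₀ hD]
  refine h1.trans (le_of_eq ?_)
  field_simp

theorem conditionedSlope_le_G (hQ : QuadBound φ ε B A p) (hc : IsGeodesicallyConvex lam φ) {x : X}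
    (hx : φ x ≠ ⊤) : conditionedSlope φ (value φ ε) x ≤ G φ ε x := by
  have hε := hQ.eps_pos
  rw [G_of_ne_top hQ hx]
  set Δ := (φ x).toReal - (value φ ε x).toReal with hΔ
  have h0 : 0 ≤ Δ := sub_nonneg.2 (EReal.toReal_le_toReal (value_le_self hQ x) (value_ne_bot hQ x) hx)
  -- The optimal speed is `s = √(2Δ/ε)`; when `Δ = 0` it is not admissible and `s → 0` is used
  -- instead.
  rcases h0.eq_or_lt with h | h
  · rw [← h]
    have hlim : Tendsto (fun s : ℝ => ENNReal.ofReal (s / 2)) (𝓝[>] 0)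
        (𝓝 (ENNReal.ofReal (0 / 2))) :=
      ((ENNReal.continuous_ofReal.comp (continuous_id.div_const 2)).tendsto 0).mono_left
        nhdsWithin_le_nhds
    simp only [mul_zero, zero_div, Real.sqrt_zero] at hlim ⊢
    refine ge_of_tendsto hlim (eventually_nhdsWithin_of_forall fun s hs => ?_)
    have := conditionedSlope_le hQ hc hx hs
    rwa [← hΔ, ← h, zero_div, add_zero] at this
  · have hs : 0 < Real.sqrt (2 * Δ / ε) := Real.sqrt_pos.2 (by positivity)
    refine (conditionedSlope_le hQ hc hx hs).trans (le_of_eq ?_)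
    congr 1
    have hsq : Real.sqrt (2 * Δ / ε) ^ 2 = 2 * Δ / ε := Real.sq_sqrt (by positivity)
    rw [← hΔ]
    have : Δ = Real.sqrt (2 * Δ / ε) ^ 2 * ε / 2 := by rw [hsq]; field_simp
    set S := Real.sqrt (2 * Δ / ε)
    rw [this]; field_simp; ring

end Geodesic

/-! ### Descent along almost minimizing trajectories -/

section Descent

variable {X : Type*} [MetricSpace X] {φ : X → EReal} {ε B A lam : ℝ} {p : X} {u : ℝ → X}
  {m : ℝ → ℝ}

theorem integral_exp_div {ε : ℝ} (hε : 0 < ε) (T : ℝ) :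
    ∫ t in 0..T, Real.exp (t / ε) = ε * (Real.exp (T / ε) - 1) := by
  have h : ∀ t, HasDerivAt (fun t => ε * Real.exp (t / ε)) (Real.exp (t / ε)) t := by
    intro t
    refine ((hasDerivAt_exp_div ε t).const_mul ε).congr_deriv ?_
    field_simp
  rw [intervalIntegral.integral_eq_sub_of_hasDerivAt (fun t _ => h t)
      (Continuous.intervalIntegrable (by fun_prop) _ _)]
  simp; ring

/-- Weighted Cauchy–Schwarz. The right-hand factor is the one in the kinetic energy of
`exists_geodesic_segment`, so geodesic competitors never have larger kinetic energy. -/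
theorem Segment.sq_dist_le (hε : 0 < ε) {T : ℝ} (h : Segment φ u m T) :
    dist (u 0) (u T) ^ 2
      ≤ (∫ t in 0..T, m t ^ 2 * Real.exp (-t / ε)) * (ε * (Real.exp (T / ε) - 1)) := by
  have h1 := h.speed 0 ⟨le_rfl, h.nonneg⟩ T ⟨h.nonneg, le_rfl⟩ h.nonneg
  have h2 := sq_integral_le_mul (p := fun t => Real.exp (-t / ε)) h.nonneg
    (fun t => Real.exp_pos _) h.integrable (h.sq_integrable.mul_continuousOn (by fun_prop))
    (Continuous.intervalIntegrable (by fun_prop (disch := intros; positivity)) _ _)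
  have h3 : ∫ t in 0..T, (Real.exp (-t / ε))⁻¹ = ε * (Real.exp (T / ε) - 1) := by
    rw [← integral_exp_div hε]
    refine intervalIntegral.integral_congr fun t _ => ?_
    rw [← Real.exp_neg]; congr 1; ring
  rw [h3] at h2
  refine le_trans ?_ h2
  gcongr

/-- The bound depends only on the cost and tends to zero with `T`, so all trajectories from a point
with bounded cost leave it uniformly slowly. -/
theorem Traj.sq_dist_le (hQ : QuadBound φ ε B A p) (h : Traj φ ε u m) {T c : ℝ} (hT : 0 ≤ T)
    (hc : cost φ ε u m ≤ c) :
    dist (u 0) (u T) ^ 2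
      ≤ 4 * (c + (B * dist (u 0) p ^ 2 + A)) * (ε * (Real.exp (T / ε) - 1)) := by
  have hε := hQ.eps_pos
  have h1 := h.energy_le hQ
  have h2 : ∫ t in 0..T, m t ^ 2 * Real.exp (-t / ε) ≤ ∫ t in Ioi 0, m t ^ 2 * Real.exp (-t / ε) := by
    rw [intervalIntegral.integral_of_le hT]
    exact setIntegral_mono_set h.energy (Eventually.of_forall fun t => by positivity)
      (Eventually.of_forall fun t ht => ht.1)
  refine ((h.segment hT).sq_dist_le hε).trans ?_
  have h3 : 0 ≤ Real.exp (T / ε) - 1 := by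
    have := Real.one_le_exp (x := T / ε) (by positivity)
    linarith
  refine mul_le_mul_of_nonneg_right ?_ (by positivity)
  linarith

/-- If `φ` exceeds `V(u 0)` by at least `K` on `[0,T]`, dynamic programming converts both the
kinetic energy and this excess into a decrease of `V`, up to the optimality gap `δ` multiplied by
`exp (T/ε)`. -/
theorem Traj.descent (hQ : QuadBound φ ε B A p) (h : Traj φ ε u m) {T δ K : ℝ} (hT : 0 < T)
    (hc : cost φ ε u m ≤ (value φ ε (u 0)).toReal + δ)
    (hK : ∀ t ∈ Icc 0 T, (((value φ ε (u 0)).toReal + K : ℝ) : EReal) ≤ φ (u t)) :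
    dist (u 0) (u T) ^ 2 / (2 * ε * (Real.exp (T / ε) - 1)) + (Real.exp (T / ε) - 1) * K
      ≤ (value φ ε (u 0)).toReal - (value φ ε (u T)).toReal + Real.exp (T / ε) * δ := by
  have hε := hQ.eps_pos
  have h1 := (h.value_shift_le hQ hT.le).2
  have hseg := h.segment hT.le
  have hd := hseg.sq_dist_le hε
  set V0 := (value φ ε (u 0)).toReal
  set V1 := (value φ ε (u T)).toReal
  set e := Real.exp (T / ε) with he
  have he1 : 1 < e := Real.one_lt_exp_iff.2 (by positivity)
  have hen : Real.exp (-T / ε) = e⁻¹ := by rw [neg_div, Real.exp_neg]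
  have h2 : (V0 + K) * (ε * (1 - e⁻¹)) ≤ ∫ t in 0..T, (φ (u t)).toReal * Real.exp (-t / ε) := by
    rw [← hen, ← integral_exp_neg_div hε, ← intervalIntegral.integral_const_mul]
    refine intervalIntegral.integral_mono_ae_restrict hT.le
      (Continuous.intervalIntegrable (by fun_prop) _ _)
      (hseg.potential.mul_continuousOn (by fun_prop)) ?_
    rw [← restrict_Ioc_eq_restrict_Icc]
    filter_upwards [hseg.finite, ae_restrict_mem measurableSet_Ioc] with t ht htI
    have h3 := hK t (Ioc_subset_Icc_self htI)
    rw [← EReal.coe_toReal ht (hQ.ne_bot _), EReal.coe_le_coe_iff] at h3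
    exact mul_le_mul_of_nonneg_right h3 (Real.exp_pos _).le
  rw [hseg.integral_lagrangian, hen] at h1
  set J := ∫ t in 0..T, m t ^ 2 * Real.exp (-t / ε)
  have h4 : (V0 + K) * (1 - e⁻¹) ≤ (∫ t in 0..T, (φ (u t)).toReal * Real.exp (-t / ε)) / ε := by
    rw [le_div_iff₀ hε]; linarith
  have h5 : J / 2 + (V0 + K) * (1 - e⁻¹) + e⁻¹ * V1 ≤ V0 + δ := by linarith
  have h6 := mul_le_mul_of_nonneg_left h5 (by linarith : 0 ≤ e)
  have h7 : e * (J / 2 + (V0 + K) * (1 - e⁻¹) + e⁻¹ * V1)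
      = e * J / 2 + (V0 + K) * (e - 1) + V1 := by field_simp
  rw [h7] at h6
  have hE : 0 < e - 1 := by linarith
  have h8 : dist (u 0) (u T) ^ 2 / (2 * ε * (e - 1)) ≤ J / 2 := by
    rw [div_le_iff₀ (by positivity)]; linarith
  have hJ : 0 ≤ J := intervalIntegral.integral_nonneg hT.le fun t _ => by positivity
  have h9 : J / 2 ≤ e * J / 2 := by nlinarith
  linarith

/-- Comparison of an almost minimizing trajectory with the geodesic to one of its points. -/
theorem Traj.integral_potential_le (hQ : QuadBound φ ε B A p) (hc : IsGeodesicallyConvex lam φ)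
    (h : Traj φ ε u m) {T δ : ℝ} (hT : 0 < T) (h0 : φ (u 0) ≠ ⊤) (hφT : φ (u T) ≠ ⊤)
    (hle : (φ (u 0)).toReal ≤ (φ (u T)).toReal)
    (hcost : cost φ ε u m ≤ (value φ ε (u 0)).toReal + δ) :
    ∫ t in 0..T, (φ (u t)).toReal * Real.exp (-t / ε)
      ≤ ε * δ + ∫ t in 0..T, ((φ (u 0)).toReal + t / T * ((φ (u T)).toReal - (φ (u 0)).toReal)
        + |lam| / 8 * dist (u 0) (u T) ^ 2) * Real.exp (-t / ε) := by
  have hε := hQ.eps_pos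
  obtain ⟨w, n, hw, hw0, hwT, hkin, hpot⟩ := exists_geodesic_segment hQ hc h0 hφT hT
  have hseg := h.segment hT.le
  have h1 := (h.value_shift_le hQ hT.le).2
  have h2 := (hw.value_le hQ (by
    rw [hwT]; exact ((value_le_self hQ _).trans_lt (lt_top_iff_ne_top.2 hφT)).ne)).2
  have hd := hseg.sq_dist_le hε
  rw [hseg.integral_lagrangian] at h1
  rw [hw.integral_lagrangian, hw0, hwT, hkin] at h2
  have he1 : 1 < Real.exp (T / ε) := Real.one_lt_exp_iff.2 (by positivity)
  -- The geodesic competitor has no more kinetic energy than `u` and the same endpoint value, so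
  -- only the potentials remain to be compared.
  have h3 : dist (u 0) (u T) ^ 2 / (ε * (Real.exp (T / ε) - 1))
      ≤ ∫ t in 0..T, m t ^ 2 * Real.exp (-t / ε) := by
    have : 0 < ε * (Real.exp (T / ε) - 1) := mul_pos hε (by linarith)
    rwa [div_le_iff₀ this]
  have h4 : (∫ t in 0..T, (φ (u t)).toReal * Real.exp (-t / ε)) / ε
      ≤ δ + (∫ t in 0..T, (φ (w t)).toReal * Real.exp (-t / ε)) / ε := by linarith
  have h5 : ∫ t in 0..T, (φ (u t)).toReal * Real.exp (-t / ε)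
      ≤ ε * δ + ∫ t in 0..T, (φ (w t)).toReal * Real.exp (-t / ε) := by
    rw [div_le_iff₀ hε, add_mul, div_mul_cancel₀ _ hε.ne'] at h4
    linarith
  refine h5.trans (add_le_add le_rfl ?_)
  refine intervalIntegral.integral_mono_on hT.le (hw.potential.mul_continuousOn (by fun_prop))
    (Continuous.intervalIntegrable (by fun_prop) _ _) fun t ht => ?_
  obtain ⟨-, θ, hθ0, hθt, hθ1, hθ⟩ := hpot t ht
  refine mul_le_mul_of_nonneg_right (hθ.trans ?_) (Real.exp_pos _).le
  have := mul_le_mul_of_nonneg_right hθt (sub_nonneg.2 hle)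
  linarith

theorem integral_sqrt_Icc {a b : ℝ} (ha : 0 < a) (hab : a ≤ b) :
    ∫ t in a..b, Real.sqrt t = 2 / 3 * (b * Real.sqrt b - a * Real.sqrt a) := by
  have h : ∀ t ∈ uIcc a b, HasDerivAt (fun t => 2 / 3 * (t * Real.sqrt t)) (Real.sqrt t) t := by
    intro t ht
    rw [uIcc_of_le hab] at ht
    have ht0 : 0 < t := ha.trans_le ht.1
    refine (((hasDerivAt_id' t).mul (Real.hasDerivAt_sqrt ht0.ne')).const_mul (2 / 3)).congr_deriv ?_
    have hs : 0 < Real.sqrt t := Real.sqrt_pos.2 ht0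
    have hsq : t = Real.sqrt t ^ 2 := (Real.sq_sqrt ht0.le).symm
    field_simp
    linarith
  rw [intervalIntegral.integral_eq_sub_of_hasDerivAt h
    (Continuous.intervalIntegrable (by fun_prop) _ _)]
  ring

/-- Suppose `ψ ≥ η` on `[T₁,T₂]` wherever `P` holds, and let `c` be the infimum of `ψ/√t` there. At
a time `T` where this is below `11c/10`, comparison with `c√t` gives `∫ ψ ≥ (2/3)(999/1000) c T√T`,
whereas the hypothesis gives at most `(14/25)(11/10) c T√T`, which is smaller. Any factor below
`2/3` leaves room for such an argument. In the application `P` says that `φ` is finite. -/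
theorem exists_lt_of_integral_le {ψ : ℝ → ℝ} {P : ℝ → Prop} {T₁ T₂ η C : ℝ} (hT₁ : 0 < T₁)
    (hT₂ : T₁ ≤ T₂ / 2) (hη : 0 < η) (hC : 0 < C) (hψ : IntervalIntegrable ψ volume 0 T₂)
    (hP : ∀ᵐ t ∂(volume.restrict (Ioc 0 T₂)), P t ∧ 0 ≤ ψ t) (hCψ : ∫ t in 0..T₂, ψ t < C)
    (hsmall : 11 * (2 * C / T₂) * Real.sqrt T₁ ≤ η * Real.sqrt (T₂ / 2))
    (hq : ∀ T ∈ Icc T₁ T₂, P T → η ≤ ψ T → ∫ t in 0..T, ψ t ≤ 14 / 25 * (T * ψ T)) :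
    ∃ T ∈ Icc T₁ T₂, P T ∧ ψ T < η := by
  by_contra! hcon
  have hT₂0 : 0 < T₂ := by linarith
  have hsubi : ∀ {a b : ℝ}, 0 ≤ a → a ≤ b → b ≤ T₂ → IntervalIntegrable ψ volume a b :=
    fun ha hab hb => hψ.mono_set (by
      rw [uIcc_of_le hab, uIcc_of_le hT₂0.le]; exact Icc_subset_Icc ha hb)
  have htail : ∀ a b : ℝ, 0 ≤ a → a ≤ b → b ≤ T₂ → ∫ t in a..b, ψ t ≤ ∫ t in 0..b, ψ t := by
    intro a b ha hab hb
    rw [← intervalIntegral.integral_add_adjacent_intervals (hsubi le_rfl ha (hab.trans hb))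
      (hsubi ha hab hb)]
    have : 0 ≤ ∫ t in 0..a, ψ t := by
      refine intervalIntegral.integral_nonneg_of_ae_restrict ha ?_
      rw [← restrict_Ioc_eq_restrict_Icc]
      exact (ae_restrict_of_ae_restrict_of_subset (Ioc_subset_Ioc_right (hab.trans hb)) hP).mono
        fun t ht => ht.2
    linarith
  -- Chebyshev on the upper half of the interval; this bounds `c` from above.
  obtain ⟨T', hT'I, hPT', hψT'⟩ : ∃ T ∈ Icc (T₂ / 2) T₂, P T ∧ ψ T ≤ 2 * C / T₂ := by
    by_contra! hcon'
    have h1 : ∫ t in (T₂ / 2)..T₂, (2 * C / T₂) ≤ ∫ t in (T₂ / 2)..T₂, ψ t := by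
      refine intervalIntegral.integral_mono_ae_restrict (by linarith) (by simp)
        (hsubi (by linarith) (by linarith) le_rfl) ?_
      rw [← restrict_Ioc_eq_restrict_Icc]
      filter_upwards [ae_restrict_of_ae_restrict_of_subset
        (Ioc_subset_Ioc_left (by linarith : (0 : ℝ) ≤ T₂ / 2)) hP,
        ae_restrict_mem measurableSet_Ioc] with t ht htI
      exact (hcon' t (Ioc_subset_Icc_self htI) ht.1).le
    rw [intervalIntegral.integral_const, smul_eq_mul] at h1
    have h2 : (T₂ - T₂ / 2) * (2 * C / T₂) = C := by field_simp; ring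
    have h3 := htail (T₂ / 2) T₂ (by linarith) (by linarith) le_rfl
    linarith
  set S : Set ℝ := (fun T => ψ T / Real.sqrt T) '' {T | T ∈ Icc T₁ T₂ ∧ P T} with hS
  have hSlow : ∀ y ∈ S, η / Real.sqrt T₂ ≤ y := by
    rintro _ ⟨T, ⟨hT, hPT⟩, rfl⟩
    have h1 := hcon T hT hPT
    have hT0 : 0 < T := hT₁.trans_le hT.1
    have h2 : Real.sqrt T ≤ Real.sqrt T₂ := Real.sqrt_le_sqrt hT.2
    have h3 : 0 < Real.sqrt T := Real.sqrt_pos.2 hT0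
    have h4 := hη.le.trans h1
    simp only
    gcongr
  have hT'mem : ψ T' / Real.sqrt T' ∈ S := ⟨T', ⟨⟨hT₂.trans hT'I.1, hT'I.2⟩, hPT'⟩, rfl⟩
  have hSb : BddBelow S := ⟨_, hSlow⟩
  set c := sInf S with hc
  have hc0 : 0 < c := lt_of_lt_of_le (by have := Real.sqrt_pos.2 hT₂0; positivity)
    (le_csInf ⟨_, hT'mem⟩ hSlow)
  have hcC : c * Real.sqrt (T₂ / 2) ≤ 2 * C / T₂ := by
    have h1 : c ≤ ψ T' / Real.sqrt T' := csInf_le hSb hT'mem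
    have h2 : 0 < Real.sqrt T' := Real.sqrt_pos.2 (by linarith [hT'I.1])
    rw [le_div_iff₀ h2] at h1
    have h3 : Real.sqrt (T₂ / 2) ≤ Real.sqrt T' := Real.sqrt_le_sqrt hT'I.1
    nlinarith
  obtain ⟨_, ⟨T, ⟨hT, hPT⟩, rfl⟩, hTlt⟩ := exists_lt_of_csInf_lt ⟨_, hT'mem⟩
    (show sInf S < 11 / 10 * c by rw [← hc]; linarith)
  have hT0 : 0 < T := hT₁.trans_le hT.1
  have hsT : 0 < Real.sqrt T := Real.sqrt_pos.2 hT0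
  have hsT₁ : 0 < Real.sqrt T₁ := Real.sqrt_pos.2 hT₁
  have hsT₂ : 0 < Real.sqrt (T₂ / 2) := Real.sqrt_pos.2 (by linarith)
  rw [div_lt_iff₀ hsT] at hTlt
  have hψη := hcon T hT hPT
  have hψ0 : 0 < ψ T := hη.trans_le hψη
  -- The smallness of `T₁` keeps the almost optimal `T` away from the left end, so omitting `[0,T₁]`
  -- from the lower bound loses only a fraction `1/1000`.
  have hroot : Real.sqrt T₁ ≤ Real.sqrt T / 10 := by
    have h1 : η < 11 / 10 * c * Real.sqrt T := hψη.trans_lt hTlt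
    have h2 : 11 * (c * Real.sqrt (T₂ / 2)) * Real.sqrt T₁ ≤ η * Real.sqrt (T₂ / 2) :=
      le_trans (by gcongr) hsmall
    have h3 : 11 * c * Real.sqrt T₁ ≤ η := by
      refine le_of_mul_le_mul_right (le_trans (le_of_eq (by ring)) h2) hsT₂
    have h4 : c * (10 * Real.sqrt T₁) ≤ c * Real.sqrt T := by linarith
    have := le_of_mul_le_mul_left h4 hc0
    linarith
  have hlow : c * (2 / 3 * (T * Real.sqrt T - T₁ * Real.sqrt T₁)) ≤ ∫ t in 0..T, ψ t := by
    refine le_trans ?_ (htail T₁ T hT₁.le hT.1 hT.2)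
    rw [← integral_sqrt_Icc hT₁ hT.1, ← intervalIntegral.integral_const_mul]
    refine intervalIntegral.integral_mono_ae_restrict hT.1
      (Continuous.intervalIntegrable (by fun_prop) _ _) (hsubi hT₁.le hT.1 hT.2) ?_
    rw [← restrict_Ioc_eq_restrict_Icc]
    filter_upwards [ae_restrict_of_ae_restrict_of_subset
      (Ioc_subset_Ioc hT₁.le hT.2) hP, ae_restrict_mem measurableSet_Ioc] with t ht htI
    have h1 : c ≤ ψ t / Real.sqrt t :=
      csInf_le hSb ⟨t, ⟨⟨htI.1.le, htI.2.trans hT.2⟩, ht.1⟩, rfl⟩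
    rwa [le_div_iff₀ (Real.sqrt_pos.2 (hT₁.trans htI.1))] at h1
  have hup := hq T hT hPT hψη
  have hcube : T₁ * Real.sqrt T₁ ≤ T * Real.sqrt T / 1000 := by
    have h1 : T₁ = Real.sqrt T₁ ^ 2 := (Real.sq_sqrt hT₁.le).symm
    have h2 : T = Real.sqrt T ^ 2 := (Real.sq_sqrt hT0.le).symm
    have h3 : T₁ ≤ T / 100 := by
      rw [h1, h2]
      have : Real.sqrt T₁ ^ 2 ≤ (Real.sqrt T / 10) ^ 2 := by gcongr
      linarith
    calc T₁ * Real.sqrt T₁ ≤ T / 100 * (Real.sqrt T / 10) := by gcongr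
      _ = _ := by ring
  have h5 : c * (2 / 3 * (999 / 1000 * (T * Real.sqrt T))) ≤ 14 / 25 * (T * ψ T) := by
    refine le_trans ?_ (hlow.trans hup)
    gcongr
    linarith
  have h6 : T * ψ T ≤ 11 / 10 * (c * (T * Real.sqrt T)) := by
    have := mul_le_mul_of_nonneg_left hTlt.le hT0.le
    linarith
  have h7 : 0 < T * ψ T := by positivity
  linarith

theorem exists_time_dist_lt (hQ : QuadBound φ ε B A p) (x : X) (c : ℝ) {r : ℝ} (hr : 0 < r) :
    ∃ T₀ > 0, ∀ (u : ℝ → X) (m : ℝ → ℝ), Traj φ ε u m → u 0 = x → cost φ ε u m ≤ c →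
      ∀ t ∈ Icc 0 T₀, dist (u t) x < r := by
  have hcont : Continuous fun T : ℝ =>
      4 * (c + (B * dist x p ^ 2 + A)) * (ε * (Real.exp (T / ε) - 1)) := by fun_prop
  have h0 : ∀ᶠ T in 𝓝 (0 : ℝ),
      4 * (c + (B * dist x p ^ 2 + A)) * (ε * (Real.exp (T / ε) - 1)) < r ^ 2 := by
    refine (hcont.tendsto 0).eventually_lt_const ?_
    simp only [zero_div, Real.exp_zero, sub_self, mul_zero]
    positivity
  obtain ⟨δ, hδ, H⟩ := Metric.eventually_nhds_iff.1 h0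
  refine ⟨δ / 2, by positivity, ?_⟩
  rintro u m hu rfl hc t ht
  have h1 := hu.sq_dist_le hQ ht.1 hc
  have h2 : dist t 0 < δ := by
    rw [Real.dist_eq, sub_zero, abs_of_nonneg ht.1]; linarith [ht.2]
  have h3 := h1.trans_lt (H h2)
  rw [dist_comm] at h3
  exact lt_of_pow_lt_pow_left₀ 2 hr.le h3

theorem exists_radius_of_lsc (hQ : QuadBound φ ε B A p) {x : X} {y : EReal} (hy : y < φ x) :
    ∃ r > 0, ∀ z, dist z x < r → y < φ z := by
  obtain ⟨r, hr, H⟩ := Metric.eventually_nhds_iff.1 (hQ.lsc x y hy)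
  exact ⟨r, hr, fun z hz => H hz⟩

/-- Almost minimizing trajectories from a point of the domain pass, at some small positive time,
through points where `φ` is almost as low as at the initial point. -/
theorem exists_time_potential_le (hQ : QuadBound φ ε B A p) (hc : IsGeodesicallyConvex lam φ)
    {x : X} (hx : φ x ≠ ⊤) {η T₂ : ℝ} (hη : 0 < η) (hT₂ : 0 < T₂) :
    ∃ T₁ > 0, ∃ δ > 0, ∀ (u : ℝ → X) (m : ℝ → ℝ), Traj φ ε u m → u 0 = x →
      cost φ ε u m ≤ (value φ ε x).toReal + δ →
      ∃ T ∈ Icc T₁ T₂, φ (u T) ≤ (((φ x).toReal + η : ℝ) : EReal) := by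
  have hε := hQ.eps_pos
  have hB := hQ.B_nonneg
  set V := (value φ ε x).toReal with hV
  set f := (φ x).toReal with hf
  set ρ := η / 100 with hρ
  have hρ0 : 0 < ρ := by positivity
  obtain ⟨r₁, hr₁, Hr₁⟩ := exists_radius_of_lsc hQ (x := x) (y := ((f - ρ : ℝ) : EReal)) (by
    rw [← EReal.coe_toReal hx (hQ.ne_bot x), EReal.coe_lt_coe_iff]; linarith)
  obtain ⟨r₂, hr₂, Hr₂⟩ : ∃ r > 0, |lam| / 8 * r ^ 2 ≤ ρ := by
    have h0 : ∀ᶠ r in 𝓝[>] (0 : ℝ), |lam| / 8 * r ^ 2 < ρ := by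
      refine Tendsto.eventually_lt_const (v := |lam| / 8 * 0 ^ 2) (by simpa using hρ0) ?_
      exact (Continuous.tendsto (by fun_prop) (0 : ℝ)).mono_left nhdsWithin_le_nhds
    obtain ⟨r, h1, h2⟩ := (h0.and self_mem_nhdsWithin).exists
    exact ⟨r, h2, h1.le⟩
  obtain ⟨T₀, hT₀, HT₀⟩ := exists_time_dist_lt hQ x (V + 1) (r := min r₁ (min r₂ 1)) (by positivity)
  -- Short enough that the trajectory stays near `x` and the exponential weight varies by a factor
  -- at most `21/20`.
  set T₃ := min T₂ (min T₀ (ε * Real.log (21 / 20))) with hT₃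
  have hlog : 0 < Real.log (21 / 20) := Real.log_pos (by norm_num)
  have hT₃0 : 0 < T₃ := by positivity
  have hexp : ∀ T, T ≤ T₃ → Real.exp (T / ε) ≤ 21 / 20 := by
    intro T hT
    have h1 : T ≤ ε * Real.log (21 / 20) :=
      hT.trans ((min_le_right _ _).trans (min_le_right _ _))
    rw [← Real.exp_log (show (0 : ℝ) < 21 / 20 by norm_num)]
    refine Real.exp_le_exp.2 ?_
    rw [div_le_iff₀ hε]; linarith
  set Cv := B * (1 + dist x p) ^ 2 + A with hCv
  -- An a priori bound for `∫ ψ` that does not depend on the trajectory, so that `T₁` and `δ` can be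
  -- fixed beforehand. Here `-Cv` bounds the value from below on the unit ball around `x`.
  set C := |21 / 20 * (ε * (V + 1 + Cv) + ε * |f - ρ|)| + 1 with hC
  have hC0 : 0 < C := by positivity
  set s := η * Real.sqrt (T₃ / 2) / (11 * (2 * C / T₃)) with hs
  have hsT₃ : 0 < Real.sqrt (T₃ / 2) := Real.sqrt_pos.2 (by positivity)
  have hs0 : 0 < s := by positivity
  set T₁ := min (T₃ / 2) (s ^ 2) with hT₁
  have hT₁0 : 0 < T₁ := by positivity
  have hsqT₁ : Real.sqrt T₁ ≤ s := by
    rw [← Real.sqrt_sq hs0.le]; exact Real.sqrt_le_sqrt (min_le_right _ _)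
  -- The comparison error `ε δ` is then at most `Tψ(T)/100` whenever `T ≥ T₁` and `ψ(T) ≥ η`.
  set δ := min 1 (T₁ * η / (100 * ε)) with hδ
  refine ⟨T₁, hT₁0, δ, by positivity, ?_⟩
  rintro u m hu rfl hcost
  have hcost1 : cost φ ε u m ≤ V + 1 := hcost.trans (add_le_add le_rfl (min_le_left _ _))
  have hεδ : ε * δ ≤ T₁ * (η / 100) := by
    have := mul_le_mul_of_nonneg_left (min_le_right 1 (T₁ * η / (100 * ε))) hε.le
    refine this.trans (le_of_eq ?_)
    field_simp
  have hdist : ∀ t ∈ Icc 0 T₃, dist (u t) (u 0) < min r₁ (min r₂ 1) := fun t ht =>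
    HT₀ u m hu rfl hcost1 t ⟨ht.1, ht.2.trans ((min_le_right _ _).trans (min_le_left _ _))⟩
  have hlow : ∀ t ∈ Icc 0 T₃, ((f - ρ : ℝ) : EReal) < φ (u t) := fun t ht =>
    Hr₁ _ ((hdist t ht).trans_le (min_le_left _ _))
  set ψ : ℝ → ℝ := fun t => (φ (u t)).toReal - (f - ρ) with hψ
  have hseg : ∀ T ∈ Icc 0 T₃, Segment φ u m T := fun T hT => hu.segment hT.1
  have hPψ : ∀ t ∈ Icc 0 T₃, φ (u t) ≠ ⊤ → 0 ≤ ψ t := by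
    intro t ht hne
    have h1 := hlow t ht
    rw [← EReal.coe_toReal hne (hQ.ne_bot _), EReal.coe_lt_coe_iff] at h1
    simp only [hψ]; linarith
  have hae : ∀ T ∈ Icc 0 T₃, ∀ᵐ t ∂(volume.restrict (Ioc 0 T)), φ (u t) ≠ ⊤ ∧ 0 ≤ ψ t := by
    intro T hT
    filter_upwards [(hseg T hT).finite, ae_restrict_mem measurableSet_Ioc] with t ht htI
    exact ⟨ht, hPψ t ⟨htI.1.le, htI.2.trans hT.2⟩ ht⟩
  have hψi : ∀ T ∈ Icc 0 T₃, IntervalIntegrable ψ volume 0 T := fun T hT =>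
    (hseg T hT).potential.sub intervalIntegrable_const
  have hweight : ∀ T ∈ Icc 0 T₃, ∫ t in 0..T, ψ t
      ≤ 21 / 20 * ((∫ t in 0..T, (φ (u t)).toReal * Real.exp (-t / ε))
        - ∫ t in 0..T, (f - ρ) * Real.exp (-t / ε)) := by
    intro T hT
    rw [← intervalIntegral.integral_sub ((hseg T hT).potential.mul_continuousOn (by fun_prop))
      (Continuous.intervalIntegrable (by fun_prop) _ _), ← intervalIntegral.integral_const_mul]
    refine intervalIntegral.integral_mono_ae_restrict hT.1 (hψi T hT)
      ((((hseg T hT).potential.mul_continuousOn (by fun_prop)).sub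
      (Continuous.intervalIntegrable (by fun_prop) _ _)).const_mul _) ?_
    rw [← restrict_Ioc_eq_restrict_Icc]
    filter_upwards [hae T hT, ae_restrict_mem measurableSet_Ioc] with t ht htI
    have h1 : 1 ≤ 21 / 20 * Real.exp (-t / ε) := by
      have h2 := hexp t (htI.2.trans hT.2)
      rw [neg_div, Real.exp_neg, ← div_eq_mul_inv, le_div_iff₀ (Real.exp_pos _)]
      linarith
    have h3 := mul_le_mul_of_nonneg_right h1 ht.2
    simp only [hψ] at h3 ⊢
    linarith
  have hCψ : ∫ t in 0..T₃, ψ t < C := by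
    have hI : T₃ ∈ Icc 0 T₃ := ⟨hT₃0.le, le_rfl⟩
    have h1 := hweight T₃ hI
    have h2 := (hu.value_shift_le hQ hT₃0.le)
    have h3 := h2.2
    rw [(hseg T₃ hI).integral_lagrangian] at h3
    have h4 : 0 ≤ ∫ t in 0..T₃, m t ^ 2 * Real.exp (-t / ε) :=
      intervalIntegral.integral_nonneg hT₃0.le fun t _ => by positivity
    have h5 : -Cv ≤ (value φ ε (u T₃)).toReal := by
      have h6 := value_ge hQ (u T₃)
      rw [← EReal.coe_toReal h2.1 (value_ne_bot hQ _), EReal.coe_le_coe_iff] at h6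
      have h7 : dist (u T₃) p ≤ 1 + dist (u 0) p := by
        have h8 := (hdist T₃ hI).trans_le ((min_le_right _ _).trans (min_le_right _ _))
        have := dist_triangle (u T₃) (u 0) p
        linarith
      have h9 : B * dist (u T₃) p ^ 2 ≤ B * (1 + dist (u 0) p) ^ 2 := by gcongr
      simp only [hCv]; linarith
    have hCv0 : 0 ≤ Cv := by have := hQ.A_nonneg; positivity
    have h10 : -Cv ≤ Real.exp (-T₃ / ε) * (value φ ε (u T₃)).toReal := by
      have h11 : Real.exp (-T₃ / ε) ≤ 1 := by
        rw [Real.exp_le_one_iff, neg_div]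
        have : 0 ≤ T₃ / ε := by positivity
        linarith
      have h12 := Real.exp_pos (-T₃ / ε)
      nlinarith
    have h13 : (∫ t in 0..T₃, (φ (u t)).toReal * Real.exp (-t / ε)) ≤ ε * (V + 1 + Cv) := by
      have h14 : (∫ t in 0..T₃, (φ (u t)).toReal * Real.exp (-t / ε)) / ε ≤ V + 1 + Cv := by
        linarith
      rw [div_le_iff₀ hε] at h14
      linarith
    have h15 : -(ε * |f - ρ|) ≤ ∫ t in 0..T₃, (f - ρ) * Real.exp (-t / ε) := by
      rw [intervalIntegral.integral_const_mul, integral_exp_neg_div hε]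
      have h16 : 0 ≤ 1 - Real.exp (-T₃ / ε) ∧ 1 - Real.exp (-T₃ / ε) ≤ 1 := by
        have h12 := Real.exp_pos (-T₃ / ε)
        have h11 : Real.exp (-T₃ / ε) ≤ 1 := by
          rw [Real.exp_le_one_iff, neg_div]
          have : 0 ≤ T₃ / ε := by positivity
          linarith
        constructor <;> linarith
      have h17 : |(f - ρ) * (ε * (1 - Real.exp (-T₃ / ε)))| ≤ ε * |f - ρ| := by
        rw [abs_mul, abs_mul, abs_of_pos hε, abs_of_nonneg h16.1]
        have := mul_le_mul_of_nonneg_left h16.2 (mul_nonneg hε.le (abs_nonneg (f - ρ)))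
        linarith
      exact (neg_le_of_abs_le h17)
    have h18 := le_abs_self (21 / 20 * (ε * (V + 1 + Cv) + ε * |f - ρ|))
    simp only [hC]
    linarith
  -- The mean of `t/T` is `1/2`. Adding `2/100` from the two slacks `ρ` and `1/100` from `ε δ`, and
  -- multiplying by the weight factor `21/20`, gives `0.5565 ≤ 14/25`.
  have hq : ∀ T ∈ Icc T₁ T₃, φ (u T) ≠ ⊤ → η ≤ ψ T → ∫ t in 0..T, ψ t ≤ 14 / 25 * (T * ψ T) := by
    intro T hT hφT hηψ
    have hT0 : 0 < T := hT₁0.trans_le hT.1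
    have hTI : T ∈ Icc 0 T₃ := ⟨hT0.le, hT.2⟩
    have hle : f ≤ (φ (u T)).toReal := by simp only [hψ] at hηψ; linarith
    have h1 := hu.integral_potential_le hQ hc hT0 hx hφT hle hcost
    rw [← hf] at h1
    have hD : |lam| / 8 * dist (u 0) (u T) ^ 2 ≤ ρ := by
      refine le_trans ?_ Hr₂
      have h2 := ((hdist T hTI).trans_le ((min_le_right _ _).trans (min_le_left _ _))).le
      rw [dist_comm] at h2
      gcongr
    have h3 : (∫ t in 0..T, (f + t / T * ((φ (u T)).toReal - f)
        + |lam| / 8 * dist (u 0) (u T) ^ 2) * Real.exp (-t / ε))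
        - ∫ t in 0..T, (f - ρ) * Real.exp (-t / ε)
        ≤ ∫ t in 0..T, (t / T * ψ T + 2 * ρ) := by
      rw [← intervalIntegral.integral_sub (Continuous.intervalIntegrable (by fun_prop) _ _)
        (Continuous.intervalIntegrable (by fun_prop) _ _)]
      refine intervalIntegral.integral_mono_on hT0.le (Continuous.intervalIntegrable (by fun_prop) _ _)
        (Continuous.intervalIntegrable (by fun_prop) _ _) fun t ht => ?_
      have htT : 0 ≤ t / T := div_nonneg ht.1 hT0.le
      have h4 : t / T * ((φ (u T)).toReal - f) ≤ t / T * ψ T :=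
        mul_le_mul_of_nonneg_left (by simp only [hψ]; linarith) htT
      have h5 : 0 ≤ t / T * ψ T + 2 * ρ := by
        have : 0 ≤ ψ T := hη.le.trans hηψ
        positivity
      have h6 : Real.exp (-t / ε) ≤ 1 := by
        rw [Real.exp_le_one_iff, neg_div]
        have : 0 ≤ t / ε := div_nonneg ht.1 hε.le
        linarith
      calc _ = (t / T * ((φ (u T)).toReal - f) + |lam| / 8 * dist (u 0) (u T) ^ 2 + ρ)
            * Real.exp (-t / ε) := by ring
        _ ≤ (t / T * ψ T + 2 * ρ) * Real.exp (-t / ε) := by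
            refine mul_le_mul_of_nonneg_right ?_ (Real.exp_pos _).le
            linarith
        _ ≤ _ := mul_le_of_le_one_right h5 h6
    have h7 : ∫ t in 0..T, (t / T * ψ T + 2 * ρ) = T / 2 * ψ T + 2 * ρ * T := by
      rw [intervalIntegral.integral_add (Continuous.intervalIntegrable (by fun_prop) _ _)
        (by simp), intervalIntegral.integral_mul_const, intervalIntegral.integral_div, integral_id,
        intervalIntegral.integral_const]
      simp only [smul_eq_mul]
      field_simp
      ring
    have h8 := hweight T hTI
    have h9 : T₁ * (η / 100) ≤ T * (ψ T / 100) := by gcongr; exact hT.1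
    have h10 : ρ * T ≤ T * (ψ T / 100) := by
      rw [mul_comm]; simp only [hρ]; gcongr
    have h11 : 0 ≤ T * ψ T := mul_nonneg hT0.le (hη.le.trans hηψ)
    linarith
  have hsmall : 11 * (2 * C / T₃) * Real.sqrt T₁ ≤ η * Real.sqrt (T₃ / 2) := by
    have h1 : 0 < 11 * (2 * C / T₃) := by positivity
    rw [hs, le_div_iff₀ h1] at hsqT₁
    linarith
  obtain ⟨T, hT, hPT, hlt⟩ := exists_lt_of_integral_le (P := fun t => φ (u t) ≠ ⊤) hT₁0
    (min_le_left _ _) hη hC0 (hψi T₃ ⟨hT₃0.le, le_rfl⟩) (hae T₃ ⟨hT₃0.le, le_rfl⟩) hCψ hsmall hq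
  refine ⟨T, ⟨hT.1, hT.2.trans (min_le_left _ _)⟩, ?_⟩
  rw [← EReal.coe_toReal hPT (hQ.ne_bot _), EReal.coe_le_coe_iff]
  simp only [hψ] at hlt
  linarith

end Descent

/-! ### The conditioned slope of the value function -/

section Slope

variable {X : Type*} [MetricSpace X] {φ : X → EReal} {ε B A lam : ℝ} {p : X}

/-- The lower side of the neighbourhood is lower semicontinuity, uniform for short times; the upper
side is `exists_time_potential_le`, and is void when `φ x = ⊤`. It matters that `T₁` does not depend
on the trajectory: the optimality gap can then be chosen small relative to `T₁`. -/
theorem exists_time_potential_mem (hQ : QuadBound φ ε B A p) (hc : IsGeodesicallyConvex lam φ)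
    {x : X} {N : Set EReal} (hN : N ∈ 𝓝 (φ x)) {T₂ : ℝ} (hT₂ : 0 < T₂) :
    ∃ T₁ > 0, ∃ δ > 0, ∀ (u : ℝ → X) (m : ℝ → ℝ), Traj φ ε u m → u 0 = x →
      cost φ ε u m ≤ (value φ ε x).toReal + δ → ∃ T ∈ Icc T₁ T₂, φ (u T) ∈ N := by
  have hlow : ∀ y < φ x, ∃ T₀ > 0, ∀ (u : ℝ → X) (m : ℝ → ℝ), Traj φ ε u m → u 0 = x →
      cost φ ε u m ≤ (value φ ε x).toReal + 1 → ∀ t ∈ Icc 0 T₀, y < φ (u t) := by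
    intro y hy
    obtain ⟨r, hr, Hr⟩ := exists_radius_of_lsc hQ hy
    obtain ⟨T₀, hT₀, H⟩ := exists_time_dist_lt hQ x ((value φ ε x).toReal + 1) hr
    exact ⟨T₀, hT₀, fun u m hu h0 hcost t ht => Hr _ (H u m hu h0 hcost t ht)⟩
  by_cases hx : φ x = ⊤
  · rw [hx] at hN hlow
    obtain ⟨y, hy, hyN⟩ := (EReal.nhds_top_basis.mem_iff).1 hN
    obtain ⟨T₀, hT₀, H⟩ := hlow y (EReal.coe_lt_top _)
    refine ⟨min T₀ T₂, by positivity, 1, one_pos, fun u m hu h0 hcost => ?_⟩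
    exact ⟨min T₀ T₂, ⟨le_rfl, min_le_right _ _⟩,
      hyN (H u m hu h0 hcost _ ⟨by positivity, min_le_left _ _⟩)⟩
  · have hf : φ x = ((φ x).toReal : EReal) := (EReal.coe_toReal hx (hQ.ne_bot x)).symm
    rw [hf] at hN
    have hN' := (EReal.continuous_coe_iff.2 continuous_id).continuousAt.preimage_mem_nhds hN
    obtain ⟨η, hη, HN⟩ := Metric.mem_nhds_iff.1 hN'
    obtain ⟨T₀, hT₀, H⟩ := hlow (((φ x).toReal - η / 2 : ℝ) : EReal) (by
      conv_rhs => rw [hf]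
      rw [EReal.coe_lt_coe_iff]; linarith)
    obtain ⟨T₁, hT₁, δ, hδ, HT⟩ := exists_time_potential_le hQ hc hx (half_pos hη)
      (T₂ := min T₀ T₂) (by positivity)
    refine ⟨T₁, hT₁, min 1 δ, by positivity, fun u m hu h0 hcost => ?_⟩
    obtain ⟨T, hT, hle⟩ := HT u m hu h0 (hcost.trans (add_le_add le_rfl (min_le_right _ _)))
    refine ⟨T, ⟨hT.1, hT.2.trans (min_le_right _ _)⟩, ?_⟩
    have hlo := H u m hu h0 (hcost.trans (add_le_add le_rfl (min_le_left _ _))) T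
      ⟨hT₁.le.trans hT.1, hT.2.trans (min_le_left _ _)⟩
    have hne : φ (u T) ≠ ⊤ := (hle.trans_lt (EReal.coe_lt_top _)).ne
    rw [← EReal.coe_toReal hne (hQ.ne_bot _)] at hle hlo ⊢
    rw [EReal.coe_le_coe_iff] at hle
    rw [EReal.coe_lt_coe_iff] at hlo
    have hmem : (φ (u T)).toReal ∈ Metric.ball (φ x).toReal η := by
      rw [Metric.mem_ball, Real.dist_eq, abs_lt]
      constructor <;> linarith
    exact HN hmem

/-- A steep descent direction is found at a point `u T` of an almost minimizing trajectory with `φ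
(u T)` in the prescribed neighbourhood. `Traj.descent` bounds the drop of `V` from below, and AM-GM
between its kinetic and potential terms turns this into a rate per unit distance. -/
theorem le_conditionedSlope (hQ : QuadBound φ ε B A p) (hc : IsGeodesicallyConvex lam φ)
    {x : X} (hV : value φ ε x ≠ ⊤) {K θ : ℝ} (hK : 0 < K)
    (hKx : (((value φ ε x).toReal + K : ℝ) : EReal) < φ x) (hθ0 : 0 < θ) (hθ : θ < 1) :
    ENNReal.ofReal (θ * Real.sqrt (2 * K / ε)) ≤ conditionedSlope φ (value φ ε) x := by
  have hε := hQ.eps_pos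
  unfold conditionedSlope
  refine le_limsup_of_frequently_le ?_
  have hbasis := (nhdsWithin_hasBasis (Metric.nhds_basis_ball (x := x)) {x}ᶜ).inf
    ((𝓝 (φ x)).basis_sets.comap φ)
  rw [hbasis.frequently_iff]
  rintro ⟨r, N⟩ ⟨hr, hN⟩
  simp only [id] at hr hN ⊢
  obtain ⟨r₁, hr₁, Hr₁⟩ := exists_radius_of_lsc hQ hKx
  set V := (value φ ε x).toReal with hVdef
  obtain ⟨T₂, hT₂, HT₂⟩ := exists_time_dist_lt hQ x (V + 1) (r := min r r₁) (by positivity)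
  obtain ⟨T₁, hT₁, δ₀, hδ₀, HT₁⟩ := exists_time_potential_mem hQ hc hN hT₂
  -- The last entry makes the error `exp (T/ε) δ` at most the fraction `1 - θ` of the gain, which is
  -- at least `T₁ K/ε`.
  set δ := min 1 (min δ₀ ((1 - θ) * (T₁ / ε * K) / Real.exp (T₂ / ε))) with hδ
  have hθ' : 0 < 1 - θ := by linarith
  have hδ0 : 0 < δ := by positivity
  have hlt : value φ ε x < ((V + δ : ℝ) : EReal) := by
    rw [← EReal.coe_toReal hV (value_ne_bot hQ x), EReal.coe_lt_coe_iff]; linarith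
  obtain ⟨u, m, hu, rfl, hcost⟩ := exists_traj_of_value_lt hQ hlt
  have hdist := HT₂ u m hu rfl (hcost.le.trans (add_le_add le_rfl (min_le_left _ _)))
  obtain ⟨T, hT, hTN⟩ := HT₁ u m hu rfl (hcost.le.trans (add_le_add le_rfl
    ((min_le_right _ _).trans (min_le_left _ _))))
  have hT0 : 0 < T := hT₁.trans_le hT.1
  have hTI : T ∈ Icc 0 T₂ := ⟨hT0.le, hT.2⟩
  have hdesc := hu.descent hQ (K := K) hT0 hcost.le fun t ht =>
    (Hr₁ _ ((hdist t ⟨ht.1, ht.2.trans hT.2⟩).trans_le (min_le_right _ _))).le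
  rw [← hVdef] at hdesc
  set W := (value φ ε (u T)).toReal with hW
  set E := Real.exp (T / ε) - 1 with hE
  have hET : T / ε ≤ E := by
    have := Real.add_one_le_exp (T / ε)
    simp only [hE]; linarith
  have hE0 : 0 < E := lt_of_lt_of_le (by positivity) hET
  set D := dist (u 0) (u T) with hD
  set R := D ^ 2 / (2 * ε * E) + E * K with hR
  have herr : Real.exp (T / ε) * δ ≤ (1 - θ) * R := by
    have h1 : Real.exp (T / ε) ≤ Real.exp (T₂ / ε) := by
      have := hT.2
      gcongr
    calc Real.exp (T / ε) * δ
        ≤ Real.exp (T₂ / ε) * ((1 - θ) * (T₁ / ε * K) / Real.exp (T₂ / ε)) :=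
          mul_le_mul h1 ((min_le_right _ _).trans (min_le_right _ _)) hδ0.le (Real.exp_pos _).le
      _ = (1 - θ) * (T₁ / ε * K) := by field_simp
      _ ≤ (1 - θ) * (E * K) := by
          have h2 : T₁ / ε ≤ E := le_trans (by have := hT.1; gcongr) hET
          gcongr
      _ ≤ (1 - θ) * R := by
          refine mul_le_mul_of_nonneg_left ?_ hθ'.le
          have : 0 ≤ D ^ 2 / (2 * ε * E) := by positivity
          simp only [hR]; linarith
  have hgain : θ * R ≤ V - W := by linarith
  have hR0 : 0 < R := by positivity
  -- The value drops strictly, so the point is admissible in the punctured neighbourhood.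
  have hne : u T ≠ u 0 := by
    intro h
    have h1 : W = V := by rw [hW, hVdef, h]
    have := mul_pos hθ0 hR0
    linarith
  have hD0 : 0 < D := dist_pos.2 hne.symm
  have hamgm : D * Real.sqrt (2 * K / ε) ≤ R := by
    set q := Real.sqrt (2 * K / ε) with hq
    have hq2 : q ^ 2 = 2 * K / ε := Real.sq_sqrt (by positivity)
    have hKq : K = q ^ 2 * ε / 2 := by rw [hq2]; field_simp
    have : R - D * q = (D - ε * E * q) ^ 2 / (2 * ε * E) := by
      simp only [hR]
      rw [hKq]; field_simp; ring
    have h2 : 0 ≤ (D - ε * E * q) ^ 2 / (2 * ε * E) := by positivity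
    linarith
  have hVT : value φ ε (u T) ≠ ⊤ := (hu.value_shift_le hQ hT0.le).1
  refine ⟨u T, ⟨⟨(hdist T hTI).trans_le (min_le_left _ _), hne⟩, hTN⟩, ?_⟩
  rw [toENNReal_sub_eq hV (value_ne_bot hQ _) hVT (value_ne_bot hQ _), edist_dist,
    ← ENNReal.ofReal_div_of_pos hD0]
  refine ENNReal.ofReal_le_ofReal ?_
  rw [le_div_iff₀ hD0]
  calc θ * Real.sqrt (2 * K / ε) * D = θ * (D * Real.sqrt (2 * K / ε)) := by ring
    _ ≤ θ * R := by gcongr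
    _ ≤ _ := hgain

/-- The lower bound holds for every `K` below the gap `φ - V`. If `φ x = ⊤`, let `K → ∞`; otherwise
take `K = θΔ` and `θ → 1`. The infinite case is needed as well: it forces `φ` to be finite wherever
the slope and `V` are. -/
theorem conditionedSlope_eq_G (hQ : QuadBound φ ε B A p) (hc : IsGeodesicallyConvex lam φ)
    {x : X} (hV : value φ ε x ≠ ⊤) : conditionedSlope φ (value φ ε) x = G φ ε x := by
  have hε := hQ.eps_pos
  by_cases hx : φ x = ⊤
  · rw [G_of_eq_top hQ hx, eq_top_iff]
    refine le_of_forall_lt fun c hcT => ?_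
    have hlim : Tendsto (fun K : ℝ => ENNReal.ofReal (1 / 2 * Real.sqrt (2 * K / ε))) atTop (𝓝 ⊤) := by
      refine ENNReal.tendsto_ofReal_atTop.comp ?_
      refine Tendsto.const_mul_atTop (by norm_num) (Real.tendsto_sqrt_atTop.comp ?_)
      exact (tendsto_id.const_mul_atTop (by norm_num : (0 : ℝ) < 2)).atTop_div_const hε
    obtain ⟨K, hK, hK0⟩ := ((hlim.eventually (lt_mem_nhds hcT)).and (eventually_gt_atTop 0)).exists
    exact hK.trans_le (le_conditionedSlope hQ hc hV hK0 (by rw [hx]; exact EReal.coe_lt_top _)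
      (by norm_num) (by norm_num))
  · refine le_antisymm (conditionedSlope_le_G hQ hc hx) ?_
    rw [G_of_ne_top hQ hx]
    set Δ := (φ x).toReal - (value φ ε x).toReal with hΔ
    have h0 : 0 ≤ Δ :=
      sub_nonneg.2 (EReal.toReal_le_toReal (value_le_self hQ x) (value_ne_bot hQ x) hx)
    rcases h0.eq_or_lt with h | h
    · rw [← h]; simp
    have hlim : Tendsto (fun θ : ℝ => ENNReal.ofReal (θ * Real.sqrt (2 * (θ * Δ) / ε))) (𝓝[<] 1)
        (𝓝 (ENNReal.ofReal (1 * Real.sqrt (2 * (1 * Δ) / ε)))) := by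
      refine Tendsto.mono_left (Continuous.tendsto ?_ 1) nhdsWithin_le_nhds
      exact ENNReal.continuous_ofReal.comp (by fun_prop)
    rw [one_mul, one_mul] at hlim
    refine le_of_tendsto hlim ?_
    filter_upwards [self_mem_nhdsWithin, mem_nhdsWithin_of_mem_nhds (Ioi_mem_nhds one_pos)]
      with θ hθ1 hθ0
    refine le_conditionedSlope hQ hc hV (mul_pos hθ0 h) ?_ hθ0 hθ1
    conv_rhs => rw [← EReal.coe_toReal hx (hQ.ne_bot x)]
    rw [EReal.coe_lt_coe_iff]
    have : θ * Δ < Δ := mul_lt_of_lt_one_left h hθ1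
    linarith

end Slope

/-! ### The upper gradient property and minimizers -/

section Final

variable {X : Type*} [MetricSpace X] {φ : X → EReal} {ε B A lam : ℝ} {p : X}

theorem toReal_eq_add_of_G (hQ : QuadBound φ ε B A p) {x : X} (hx : φ x ≠ ⊤) :
    (φ x).toReal = (value φ ε x).toReal + ε * (G φ ε x).toReal ^ 2 / 2 := by
  have hε := hQ.eps_pos
  have h0 : 0 ≤ (φ x).toReal - (value φ ε x).toReal :=
    sub_nonneg.2 (EReal.toReal_le_toReal (value_le_self hQ x) (value_ne_bot hQ x) hx)
  rw [G_of_ne_top hQ hx, ENNReal.toReal_ofReal (Real.sqrt_nonneg _), Real.sq_sqrt (by positivity)]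
  field_simp; ring

theorem restrict_speedMeasure {u : ℝ → X} {I J : Set ℝ} (hJ : MeasurableSet J) (hJI : J ⊆ I) :
    (speedMeasure u I).restrict J = speedMeasure u J := by
  rw [speedMeasure, restrict_withDensity hJ, Measure.restrict_restrict hJ,
    inter_eq_left.2 hJI, speedMeasure]

theorem EReal_le_add_coe {a b : EReal} (ha' : a ≠ ⊥) (hb' : b ≠ ⊥) {x : ℝ}
    (h : b ≠ ⊤ → a ≠ ⊤ ∧ a.toReal ≤ b.toReal + x) :
    a ≤ b + ((ENNReal.ofReal x : ℝ≥0∞) : EReal) := by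
  by_cases hb : b = ⊤
  · rw [hb, EReal.top_add_of_ne_bot (EReal.coe_ennreal_ne_bot _)]
    exact le_top
  obtain ⟨ha, h1⟩ := h hb
  lift a to ℝ using ⟨ha, ha'⟩
  lift b to ℝ using ⟨hb, hb'⟩
  rw [EReal.coe_ennreal_ofReal, ← EReal.coe_add, EReal.coe_le_coe_iff]
  exact h1.trans (add_le_add le_rfl (le_max_left _ _))

/-- The measure `|u'| ℒ¹` is finite on `[s,t]`, so `L^q` moderation implies `L¹`, which is what the
change of time needs. Almost everywhere for this measure both `V` and the slope are finite, hence
`φ` is finite and `φ = V + ε g²/2` with `g` a measurable version of the slope. -/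
theorem isModeratedUpperGradient_conditionedSlope (hQ : QuadBound φ ε B A p)
    (hc : IsGeodesicallyConvex lam φ) {q : ℝ≥0∞} (hq : 1 ≤ q) :
    IsModeratedUpperGradient q (value φ ε) (conditionedSlope φ (value φ ε)) := by
  intro I u hI hac hV hgm hgi s hs t ht hst
  have hε := hQ.eps_pos
  have hJI : Icc s t ⊆ I := hI.out hs ht
  obtain ⟨m, hm, hspeed⟩ := hac
  replace hspeed : SpeedBound u m (Icc s t) := SpeedBound.mono (I := I) hspeed hJI
  have hmi : IntervalIntegrable m volume s t := by
    rw [intervalIntegrable_iff_integrableOn_Icc_of_le hst]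
    exact (memLp_one_iff_integrable.1 hm).mono_measure (Measure.restrict_mono_set _ hJI)
  have hcont := hspeed.continuousOn hst hmi
  have hmd := aemeasurable_metricDeriv_Icc hst hcont
  have hmdlt := hspeed.metricDeriv_lt_top hmi
  have hmdi := hspeed.integrableOn_metricDeriv hst hmi
  set a : ℝ → ℝ := fun r => (hmd.mk _ r).toReal with ha
  have ham : Measurable a := hmd.measurable_mk.ennreal_toReal
  have ha0 : ∀ r, 0 ≤ a r := fun r => ENNReal.toReal_nonneg
  have haeq : ∀ᵐ r ∂(volume.restrict (Icc s t)), metricDeriv u r = ENNReal.ofReal (a r) := by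
    filter_upwards [hmd.ae_eq_mk, hmdlt] with r h1 h2
    simp only [ha, ← h1, ENNReal.ofReal_toReal h2.ne]
  have hai : IntegrableOn a (Icc s t) := hmdi.congr (by
    filter_upwards [haeq] with r hr
    rw [hr, ENNReal.toReal_ofReal (ha0 r)])
  have hspeed_a : SpeedBound u a (Icc s t) := by
    intro x hx y hy hxy
    refine (hspeed.metricDeriv hmi x hx y hy hxy).trans (le_of_eq ?_)
    rw [intervalIntegral.integral_of_le hxy, intervalIntegral.integral_of_le hxy]
    refine integral_congr_ae ?_
    filter_upwards [ae_restrict_of_ae_restrict_of_subset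
      (Ioc_subset_Icc_self.trans (Icc_subset_Icc hx.1 hy.2)) haeq] with r hr
    rw [hr, ENNReal.toReal_ofReal (ha0 r)]
  have hμ : (speedMeasure u I).restrict (Icc s t)
      = (volume.restrict (Icc s t)).withDensity fun r => ENNReal.ofReal (a r) := by
    rw [restrict_speedMeasure measurableSet_Icc hJI, speedMeasure]
    exact withDensity_congr_ae haeq
  set μ := (volume.restrict (Icc s t)).withDensity fun r => ENNReal.ofReal (a r) with hμdef
  have : IsFiniteMeasure μ := isFiniteMeasure_withDensity_ofReal hai.2
  have hle : μ ≤ speedMeasure u I := hμ ▸ Measure.restrict_le_self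
  have hVfin : ∀ᵐ r ∂μ, value φ ε (u r) ≠ ⊤ :=
    (hV.1.filter_mono (ae_mono hle)).mono fun r hr => hr.1
  have hVi : Integrable (fun r => (value φ ε (u r)).toReal) μ :=
    (hV.2.mono_measure hle).integrable hq
  have hgm' := hgm.mono_measure hle
  have hgi' : ∫⁻ r, conditionedSlope φ (value φ ε) (u r) ∂μ ≠ ∞ :=
    ((lintegral_mono' hle le_rfl).trans_lt hgi).ne
  have hgfin := ae_lt_top' hgm' hgi'
  set g : ℝ → ℝ := fun r => (hgm'.mk _ r).toReal with hg
  have hgmeas : Measurable g := hgm'.measurable_mk.ennreal_toReal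
  have hg0 : ∀ r, 0 ≤ g r := fun r => ENNReal.toReal_nonneg
  have hgeq : ∀ᵐ r ∂μ, (conditionedSlope φ (value φ ε) (u r)).toReal = g r :=
    hgm'.ae_eq_mk.mono fun r hr => by simp only [hg, ← hr]
  have hgI : Integrable g μ :=
    (integrable_toReal_of_lintegral_ne_top hgm' hgi').congr hgeq
  have hdens : ∀ f : ℝ → ℝ, Integrable f μ → IntegrableOn (fun r => f r * a r) (Icc s t) := by
    intro f hf
    rw [hμdef, integrable_withDensity_iff ham.ennreal_ofReal
      (Eventually.of_forall fun _ => ENNReal.ofReal_lt_top)] at hf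
    exact hf.congr (Eventually.of_forall fun r => by simp only [ENNReal.toReal_ofReal (ha0 r)])
  have hall : ∀ᵐ r ∂(volume.restrict (Icc s t)), a r ≠ 0 →
      value φ ε (u r) ≠ ⊤ ∧ conditionedSlope φ (value φ ε) (u r) = ENNReal.ofReal (g r) := by
    have h1 : ∀ᵐ r ∂μ, value φ ε (u r) ≠ ⊤ ∧
        conditionedSlope φ (value φ ε) (u r) = ENNReal.ofReal (g r) := by
      filter_upwards [hVfin, hgfin, hgeq] with r h1 h2 h3
      exact ⟨h1, by rw [← h3, ENNReal.ofReal_toReal h2.ne]⟩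
    rw [hμdef, ae_withDensity_iff ham.ennreal_ofReal] at h1
    filter_upwards [h1] with r hr hne
    exact hr (by simpa using lt_of_le_of_ne (ha0 r) hne.symm)
  have hIoc : Ioc s t ⊆ Icc s t := Ioc_subset_Icc_self
  have hmain := value_along_curve_le hQ hst hspeed_a ham ha0 (hai.mono_set hIoc) hgmeas hg0
    ((hdens g hgI).mono_set hIoc) ((hdens _ hVi).mono_set hIoc) (by
      filter_upwards [ae_restrict_of_ae_restrict_of_subset hIoc hall] with r hr hne
      obtain ⟨h1, h2⟩ := hr hne
      rw [conditionedSlope_eq_G hQ hc h1] at h2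
      have hφr : φ (u r) ≠ ⊤ := fun htop => by
        rw [G_of_eq_top hQ htop] at h2
        exact ENNReal.ofReal_ne_top h2.symm
      refine ⟨hφr, ?_⟩
      rw [toReal_eq_add_of_G hQ hφr, h2, ENNReal.toReal_ofReal (hg0 r)])
  have hint : ∫⁻ r in Icc s t, conditionedSlope φ (value φ ε) (u r) * metricDeriv u r
      = ENNReal.ofReal (∫ r in s..t, g r * a r) := by
    rw [intervalIntegral.integral_of_le hst, ← integral_Icc_eq_integral_Ioc,
      ofReal_integral_eq_lintegral_ofReal (hdens g hgI)
        (Eventually.of_forall fun r => mul_nonneg (hg0 r) (ha0 r))]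
    refine lintegral_congr_ae ?_
    filter_upwards [hall, haeq] with r h1 h2
    rw [h2]
    by_cases h0 : a r = 0
    · simp [h0]
    · rw [(h1 h0).2, ENNReal.ofReal_mul (hg0 r)]
  rw [hint]
  exact ⟨EReal_le_add_coe (value_ne_bot hQ _) (value_ne_bot hQ _) hmain.2,
    EReal_le_add_coe (value_ne_bot hQ _) (value_ne_bot hQ _) hmain.1⟩

theorem nonneg_of_monotoneOn_of_hasDerivAt {f : ℝ → ℝ} {f' b t : ℝ} (hf : MonotoneOn f (Icc 0 b))
    (ht : t ∈ Ioo 0 b) (hd : HasDerivAt f f' t) : 0 ≤ f' := by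
  rw [← hd.deriv, ← derivWithin_of_mem_nhds (Icc_mem_nhds ht.1 ht.2)]
  exact hf.derivWithin_nonneg

/-- The value function along a minimizer. -/
theorem IsWEDMinimizer.value_eq (hQ : QuadBound φ ε B A p) {x : X} {u : ℝ → X}
    (hx : value φ ε x ≠ ⊤) (hu : IsWEDMinimizer φ ε x u) :
    Traj φ ε u (fun t => (metricDeriv u t).toReal) ∧ ∀ t, 0 ≤ t → value φ ε (u t) ≠ ⊤ ∧
      (value φ ε (u t)).toReal = Real.exp (t / ε) * ((value φ ε x).toReal
        - ∫ r in 0..t, lagrangian φ ε u (fun t => (metricDeriv u t).toReal) r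
          * Real.exp (-r / ε)) := by
  have hε := hQ.eps_pos
  have hw : wed φ ε u ≤ value φ ε x := le_iInf₂ hu.2
  have hT := traj_of_wed_ne_top hQ hu.1 (hw.trans_lt (lt_top_iff_ne_top.2 hx)).ne
  refine ⟨hT, fun t ht => ?_⟩
  have hu0 : u 0 = x := hu.1.2.1
  have hcost : cost φ ε u (fun t => (metricDeriv u t).toReal) ≤ (value φ ε x).toReal := by
    rw [hT.wed_eq hQ.ne_bot hε, ← EReal.coe_toReal hx (value_ne_bot hQ x),
      EReal.coe_le_coe_iff] at hw
    exact hw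
  have h1 := hT.value_shift_le hQ ht
  have h2 := ((hT.segment ht).value_le hQ h1.1).2
  rw [hu0] at h2
  refine ⟨h1.1, ?_⟩
  set J := ∫ r in 0..t, lagrangian φ ε u (fun t => (metricDeriv u t).toReal) r
    * Real.exp (-r / ε)
  have h3 : Real.exp (-t / ε) * (value φ ε (u t)).toReal = (value φ ε x).toReal - J := by
    linarith [h1.2]
  rw [← h3, ← mul_assoc, ← Real.exp_add, neg_div, add_neg_cancel, Real.exp_zero, one_mul]

/-- Differentiating the formula for `V` along the minimizer gives `-(V∘u)' = |u'|²/2 + G²/2`. The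
reverse estimate `-(V∘u)' ≤ G|u'|` forces equality in Young's inequality. -/
theorem IsWEDMinimizer.isCurveOfMaximalSlope (hQ : QuadBound φ ε B A p)
    (hc : IsGeodesicallyConvex lam φ) {x : X} {u : ℝ → X}
    (hx : value φ ε x ≠ ⊤) (hu : IsWEDMinimizer φ ε x u) :
    IsCurveOfMaximalSlope (value φ ε) (conditionedSlope φ (value φ ε)) u := by
  have hε := hQ.eps_pos
  obtain ⟨hT, hVu⟩ := hu.value_eq hQ hx
  set ℓ : ℝ → ℝ := fun r => lagrangian φ ε u (fun t => (metricDeriv u t).toReal) r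
    * Real.exp (-r / ε) with hℓ
  set W : ℝ → ℝ := fun t => Real.exp (t / ε) * ((value φ ε x).toReal - ∫ r in 0..t, ℓ r) with hW
  have hℓi : ∀ b, 0 ≤ b → IntervalIntegrable ℓ volume 0 b := fun b hb =>
    (hT.segment hb).lagrangian_integrable
  have hWc : ∀ b, 0 ≤ b → ContinuousOn W (Icc 0 b) := by
    intro b hb
    have := ((hℓi b hb).absolutelyContinuousOnInterval_intervalIntegral (c := 0)
      left_mem_uIcc).continuousOn
    rw [uIcc_of_le hb] at this
    exact ContinuousOn.mul (by fun_prop) (continuousOn_const.sub this)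
  refine ⟨isModeratedUpperGradient_conditionedSlope hQ hc le_top, hu.1.1, ?_, ?_⟩
  · intro T
    rcases lt_or_ge T 0 with hT0 | hT0
    · exact ⟨0, fun t ht => absurd (ht.1.trans ht.2) (not_le.2 hT0)⟩
    obtain ⟨C, hC⟩ := isCompact_Icc.exists_bound_of_continuousOn (hWc T hT0)
    refine ⟨C, fun t ht => ?_⟩
    obtain ⟨h1, h2⟩ := hVu t ht.1
    have h3 := abs_le.1 (hC t ht)
    rw [← EReal.coe_toReal h1 (value_ne_bot hQ _), h2, EReal.coe_le_coe_iff, EReal.coe_le_coe_iff]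
    exact h3
  obtain ⟨-, -, -, hmdlt⟩ := energy_of_mem_admissible hε hu.1
  have hucont := hT.continuousOn
  have hmd := aemeasurable_metricDeriv_Ici hucont
  set a : ℝ → ℝ := fun r => (hmd.mk _ r).toReal with ha
  have ham : Measurable a := hmd.measurable_mk.ennreal_toReal
  have ha0 : ∀ r, 0 ≤ a r := fun r => ENNReal.toReal_nonneg
  have haeq : ∀ᵐ r ∂(volume.restrict (Ioi (0 : ℝ))), metricDeriv u r = ENNReal.ofReal (a r) := by
    filter_upwards [hmd.ae_eq_mk, hmdlt] with r h1 h2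
    simp only [ha, ← h1, ENNReal.ofReal_toReal h2.ne]
  have hφm : AEMeasurable (fun r => (φ (u r)).toReal) (volume.restrict (Ioi 0)) :=
    (aemeasurable_comp_of_continuousOn hQ.lsc measurableSet_Ioi
      (hucont.mono Ioi_subset_Ici_self)).ereal_toReal
  have hWm : AEMeasurable W (volume.restrict (Ioi 0)) :=
    ((continuousOn_Ici_of_Icc hWc).mono Ioi_subset_Ici_self).aemeasurable measurableSet_Ioi
  have hγm : AEMeasurable (fun r => Real.sqrt (2 * ((φ (u r)).toReal - W r) / ε))
      (volume.restrict (Ioi 0)) := (((hφm.sub hWm).const_mul 2).div_const ε).sqrt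
  -- A measurable version of `G ∘ u`; the absolute value makes it nonnegative everywhere and changes
  -- nothing almost everywhere.
  set g : ℝ → ℝ := fun r => |hγm.mk _ r| with hg
  have hgm : Measurable g := hγm.measurable_mk.abs
  have hg0 : ∀ r, 0 ≤ g r := fun r => abs_nonneg _
  have hgeq : ∀ᵐ r ∂(volume.restrict (Ioi (0 : ℝ))), φ (u r) ≠ ⊤ ∧
      G φ ε (u r) = ENNReal.ofReal (g r) ∧ (φ (u r)).toReal = W r + ε * g r ^ 2 / 2 := by
    filter_upwards [hT.finite, hγm.ae_eq_mk, ae_restrict_mem measurableSet_Ioi] with r h1 h2 hr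
    have h3 : G φ ε (u r) = ENNReal.ofReal (g r) := by
      rw [G_of_ne_top hQ h1, (hVu r (le_of_lt hr)).2]
      simp only [hg, ← h2, abs_of_nonneg (Real.sqrt_nonneg _)]
      rfl
    refine ⟨h1, h3, ?_⟩
    have h4 := toReal_eq_add_of_G hQ h1
    rwa [h3, ENNReal.toReal_ofReal (hg0 r), (hVu r (le_of_lt hr)).2] at h4
  -- The upper gradient estimate in monotone form: its derivative gives the pointwise inequality
  -- `(V∘u)' + g|u'| ≥ 0`. Integrability of `g|u'|` follows from that of `g²`, which is `2(φ - V)/ε`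
  -- along `u`, and of `|u'|²`.
  have hmono : ∀ b, 0 ≤ b → IntervalIntegrable (fun r => g r * a r) volume 0 b ∧
      MonotoneOn (fun t => W t + ∫ r in 0..t, g r * a r) (Icc 0 b) := by
    intro b hb
    have hIoc : Ioc 0 b ⊆ Ioi 0 := Ioc_subset_Ioi_self
    have hseg := hT.segment hb
    have haa : ∀ᵐ r ∂(volume.restrict (Ioc 0 b)), (metricDeriv u r).toReal = a r := by
      filter_upwards [ae_restrict_of_ae_restrict_of_subset hIoc haeq] with r hr
      rw [hr, ENNReal.toReal_ofReal (ha0 r)]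
    have hai : IntegrableOn a (Ioc 0 b) := hseg.integrable.1.congr haa
    have hai2 : IntegrableOn (fun r => a r ^ 2) (Ioc 0 b) := hseg.sq_integrable.1.congr (by
      filter_upwards [haa] with r hr
      rw [hr])
    have hWi : IntegrableOn W (Ioc 0 b) := ((hWc b hb).integrableOn_Icc).mono_set Ioc_subset_Icc_self
    have hgi2 : IntegrableOn (fun r => g r ^ 2) (Ioc 0 b) := by
      refine ((hseg.potential.1.sub hWi).const_mul (2 / ε)).congr ?_
      filter_upwards [ae_restrict_of_ae_restrict_of_subset hIoc hgeq] with r hr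
      rw [Pi.sub_apply, hr.2.2]
      field_simp; ring
    have hga : IntegrableOn (fun r => g r * a r) (Ioc 0 b) := by
      refine Integrable.mono' (hgi2.add hai2) (hgm.mul ham).aestronglyMeasurable
        (Eventually.of_forall fun r => ?_)
      rw [Real.norm_of_nonneg (mul_nonneg (hg0 r) (ha0 r)), Pi.add_apply]
      nlinarith [sq_nonneg (g r - a r), sq_nonneg (g r + a r)]
    have hgaI : IntervalIntegrable (fun r => g r * a r) volume 0 b := by
      rwa [intervalIntegrable_iff_integrableOn_Ioc_of_le hb]
    have hWa : IntegrableOn (fun r => W r * a r) (Ioc 0 b) := by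
      obtain ⟨C, hC⟩ := isCompact_Icc.exists_bound_of_continuousOn (hWc b hb)
      refine Integrable.bdd_mul (c := C) hai (hWm.mono_set hIoc).aestronglyMeasurable ?_
      filter_upwards [ae_restrict_mem measurableSet_Ioc] with r hr
      exact hC r (Ioc_subset_Icc_self hr)
    have hspeed_a : SpeedBound u a (Icc 0 b) := by
      intro y hy z hz hyz
      refine (hT.speed y hy.1 z hz.1 hyz).trans (le_of_eq ?_)
      rw [intervalIntegral.integral_of_le hyz, intervalIntegral.integral_of_le hyz]
      exact integral_congr_ae (ae_restrict_of_ae_restrict_of_subset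
        (Ioc_subset_Ioc hy.1 hz.2) haa)
    refine ⟨hgaI, fun s hs t ht hst => ?_⟩
    have hsub : Ioc s t ⊆ Ioc 0 b := Ioc_subset_Ioc hs.1 ht.2
    have hmain := (value_along_curve_le hQ hst (hspeed_a.mono (Icc_subset_Icc hs.1 ht.2)) ham ha0
      (hai.mono_set hsub) hgm hg0 (hga.mono_set hsub) ((hWa.mono_set hsub).congr (by
        filter_upwards [ae_restrict_mem measurableSet_Ioc] with r hr
        rw [(hVu r (hs.1.trans hr.1.le)).2])) (by
        filter_upwards [ae_restrict_of_ae_restrict_of_subset (hsub.trans hIoc) hgeq,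
          ae_restrict_mem measurableSet_Ioc] with r hr hrI _
        refine ⟨hr.1, ?_⟩
        rw [(hVu r (hs.1.trans hrI.1.le)).2]
        exact hr.2.2)).1 (hVu t ht.1).1
    rw [(hVu s hs.1).2, (hVu t ht.1).2] at hmain
    have hadd := intervalIntegral.integral_add_adjacent_intervals (μ := volume)
      (f := fun r => g r * a r)
      (hgaI.mono_set (c := 0) (d := s) (by
        rw [uIcc_of_le hs.1, uIcc_of_le hb]; exact Icc_subset_Icc_right hs.2))
      (hgaI.mono_set (c := s) (d := t) (by
        rw [uIcc_of_le hst, uIcc_of_le hb]; exact Icc_subset_Icc hs.1 ht.2))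
    have h5 : W s ≤ W t + ∫ r in s..t, g r * a r := hmain.2
    simp only
    linarith
  have hderiv : ∀ᵐ t ∂(volume.restrict (Ioi (0 : ℝ))),
      HasDerivAt W (W t / ε - lagrangian φ ε u (fun t => (metricDeriv u t).toReal) t) t ∧
        0 ≤ W t / ε - lagrangian φ ε u (fun t => (metricDeriv u t).toReal) t + g t * a t := by
    refine ae_Ioi_of_forall_Ioo fun n => ?_
    have hn : (0 : ℝ) ≤ n := Nat.cast_nonneg n
    obtain ⟨hgaI, hmon⟩ := hmono n hn
    filter_upwards [(hℓi n hn).ae_hasDerivAt_integral, hgaI.ae_hasDerivAt_integral] with t h1 h2 ht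
    have htI : t ∈ uIcc (0 : ℝ) n := by rw [uIcc_of_le hn]; exact Ioo_subset_Icc_self ht
    have h3 := h1 htI 0 left_mem_uIcc
    have h4 := h2 htI 0 left_mem_uIcc
    have h5 : HasDerivAt W (W t / ε - lagrangian φ ε u (fun t => (metricDeriv u t).toReal) t) t := by
      refine ((hasDerivAt_exp_div ε t).mul (h3.const_sub _)).congr_deriv ?_
      have h6 : Real.exp (t / ε) * Real.exp (-t / ε) = 1 := by
        rw [← Real.exp_add, neg_div, add_neg_cancel, Real.exp_zero]
      simp only [hW, hℓ]
      linear_combination (-lagrangian φ ε u (fun t => (metricDeriv u t).toReal) t) * h6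
    exact ⟨h5, nonneg_of_monotoneOn_of_hasDerivAt hmon ht (h5.add h4)⟩
  filter_upwards [hderiv, haeq, hgeq, ae_restrict_mem measurableSet_Ioi] with t h1 h2 h3 ht
  have hlag : lagrangian φ ε u (fun t => (metricDeriv u t).toReal) t
      = a t ^ 2 / 2 + (W t + ε * g t ^ 2 / 2) / ε := by
    simp only [lagrangian, h2, ENNReal.toReal_ofReal (ha0 t), h3.2.2]
  have hlag2 : W t / ε - lagrangian φ ε u (fun t => (metricDeriv u t).toReal) t
      = -(a t ^ 2 / 2 + g t ^ 2 / 2) := by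
    rw [hlag]; field_simp; ring
  rw [hlag2] at h1
  have hag : g t = a t := by
    have : (g t - a t) ^ 2 ≤ 0 := by nlinarith [h1.2]
    have := pow_eq_zero_iff (two_ne_zero) |>.1 (le_antisymm this (sq_nonneg _))
    linarith
  refine ⟨Real.toNNReal (a t ^ 2), ?_, ?_, ?_⟩
  · have h4 : -(Real.toNNReal (a t ^ 2) : ℝ) = -(a t ^ 2 / 2 + g t ^ 2 / 2) := by
      rw [hag, Real.coe_toNNReal _ (sq_nonneg _)]; ring
    rw [h4]
    refine h1.1.congr_of_eventuallyEq ?_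
    filter_upwards [Ioi_mem_nhds ht] with s hs
    exact (hVu s (le_of_lt hs)).2
  · rw [h2, ← ENNReal.ofReal_pow (ha0 t)]; rfl
  · rw [conditionedSlope_eq_G hQ hc (hVu t (le_of_lt ht)).1, h3.2.1, hag,
      ← ENNReal.ofReal_pow (ha0 t)]
    rfl

end Final

end WED

end

theorem theorem7p1 {X : Type*} [MetricSpace X] [CompleteSpace X] (σ : TopologicalSpace X)
    (hσ : IsCompatible σ) (φ : X → EReal) (B : ℝ) (hφ : IsLSCC σ φ B)
    (lam : ℝ) (hconv : IsGeodesicallyConvex lam φ)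
    (ε : ℝ) (hε : 0 < ε) (hεB : B ≤ 1 / (16 * ε)) :
    (∀ u ∈ dom φ,
      value φ ε u ≠ ⊥ ∧ value φ ε u ≤ φ u ∧
      ENNReal.ofReal (Real.sqrt (2 * ((φ u).toReal - (value φ ε u).toReal) / ε)) = G φ ε u ∧
      G φ ε u = conditionedSlope φ (value φ ε) u) ∧
    IsModeratedUpperGradient 1 (value φ ε) (conditionedSlope φ (value φ ε)) ∧
    (∀ x ∈ dom (value φ ε), ∀ u : ℝ → X, IsWEDMinimizer φ ε x u →
      IsCurveOfMaximalSlope (value φ ε) (conditionedSlope φ (value φ ε)) u) := by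
  obtain ⟨p, A, hA, hb⟩ := hφ.coercive
  have hQ : QuadBound φ ε B A p :=
    ⟨hε, lowerSemicontinuous_of_seq fun _ _ => hφ.le_liminf hσ, hφ.B_nonneg, hεB, hA, hb⟩
  refine ⟨fun u hu => ?_, isModeratedUpperGradient_conditionedSlope hQ hconv le_rfl,
    fun x hx u hu => hu.isCurveOfMaximalSlope hQ hconv (ne_of_lt hx)⟩
  have hV : value φ ε u ≠ ⊤ := ((value_le_self hQ u).trans_lt hu).ne
  exact ⟨value_ne_bot hQ u, value_le_self hQ u, (G_of_ne_top hQ (ne_of_lt hu)).symm,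
    (conditionedSlope_eq_G hQ hconv hV).symm⟩
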